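/- Let $(M,g)$ be a compact smooth Riemannian manifold without boundary of dimension $n$ and let $H\subset M$ be a compact embedded submanifold without boundary of dimension $d$. Let $p(x,\xi)=|\xi|_{g(x)}$ on $T^*M$, and let $G^t$ be the homogeneous geodesic flow on $\dot T^*M=T^*M\setminus 0$, that is, the time-$t$ flow of the Hamilton vector field $H_p=\sum_j\big(\frac{\partial p}{\partial\xi_j}\frac{\partial}{\partial x_j}-\frac{\partial p}{\partial x_j}\frac{\partial}{\partial\xi_j}\big)$. Let $\dot N^*H\subset \dot T^*M$ be the set of nonzero conormal covectors of $H$. It carries the natural density which in coordinates $x=(x',x'')$ with $H=\{x''=0\}$ and dual coordinates $\xi=(\xi',\xi'')$ is $|g_H(x')|\,|g(x)|^{-1/2}\,|dx'\,d\xi''|$, where $|g|$ and $|g_H|$ are the determinants of the metric tensors of $M$ and $H$; the unit conormal bundle $SN^*H=\dot N^*H\cap p^{-1}(1)$ carries the Leray measure induced by this density and $p$. For $t\ne 0$ let $S\Sigma_t$ be the set of $(x,\xi)\in SN^*H$ such that $G^t(x,\xi)\in\dot N^*H$ and $dG^t:T_{(x,\xi)}\dot N^*H\to T_{G^t(x,\xi)}\dot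 N^*H$ is a linear isomorphism. On $S\Sigma_t$ let $J_t$ be the positive determinant of this map with respect to the natural densities, and let $\sigma_t\in\mathbb Z$ be the Maslov factor: the Maslov index of the path of Lagrangian planes $s\mapsto dG^s(T_{(x,\xi)}\dot N^*H)$, $s$ from $0$ to $t$, relative to the vertical spaces $V=\ker d\pi$ (with $\pi:T^*M\to M$ the projection), with the common radial direction divided out; explicitly $$\sigma_t(x,\xi)=\operatorname{sgn}(t)\Big[(n-d-1)+\sum_{s\text{ strictly between }0\text{ and }t}\Big(\dim\big(dG^s(T_{(x,\xi)}\dot N^*H)\cap V_{G^s(x,\xi)}\big)-1\Big)\Big].$$ Put $$q(t)=(2\pi)^{-n+d}\int_{S\Sigma_t} i^{\sigma_t}\sqrt{J_t},\qquad \mathcal T=\{t\neq 0: S\Sigma_t\text{ has positive measure}\}.$$ Let $\mathcal R\subset SN^*H$ be the set of recurrent directions: those $(x,\xi)\in SN^*H$ such that for each open neighborhood $U$ of $(x,\xi)$ in $SN^*H$ there is $t\neq 0$ with $G^t(x,\xi)\in U$. If $\mathcal R$ has measure zero in $SN^*H$, then $$\lim_{T\to\infty}\frac1T\sum_{t\in\mathcal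 T\cap[-T,T]}|q(t)|=0.$$ That is, this averaging condition is implied by the hypothesis of non-recurrence that $\mathcal R$ has measure zero. -/

import Mathlib

open Set Filter Topology MeasureTheory Bundle
open scoped Manifold ContDiff ENNReal

noncomputable section

namespace Kuznecov

/-- The model space `ℝⁿ`. -/
abbrev Eucl (n : ℕ) : Type := EuclideanSpace ℝ (Fin n)

/-- The coordinate covector `dxⁱ` of `ℝⁿ`. -/
def dualCoord {n : ℕ} (i : Fin n) : Eucl n →L[ℝ] ℝ := EuclideanSpace.proj i

/-- A smooth Riemannian metric on the `n`-dimensional manifold `M`. -/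
abbrev Metric (n : ℕ) (M : Type*) [TopologicalSpace M] [ChartedSpace (Eucl n) M]
    [IsManifold (𝓡 n) ∞ M] : Type _ :=
  ContMDiffRiemannianMetric (𝓡 n) ∞ (Eucl n) (fun x : M => TangentSpace (𝓡 n) x)

/-- The cotangent bundle `T^*M`; a point `z` is the covector `z.2` at the point `z.proj`. -/
abbrev Cotangent (n : ℕ) (M : Type*) [TopologicalSpace M] [ChartedSpace (Eucl n) M] : Type _ :=
  TotalSpace (Eucl n →L[ℝ] ℝ) (fun x : M => TangentSpace (𝓡 n) x →L[ℝ] ℝ)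

/-- The model with corners of the manifold `T^*M`. -/
abbrev cotModel (n : ℕ) : ModelWithCorners ℝ (Eucl n × (Eucl n →L[ℝ] ℝ))
    (ModelProd (Eucl n) (Eucl n →L[ℝ] ℝ)) :=
  (𝓡 n).prod 𝓘(ℝ, Eucl n →L[ℝ] ℝ)

/-- The tangent space at `x` of a subset `S` of a manifold: the span of the velocities at `x` of
the curves in `S` through `x`. -/
def tangentOf {E B X : Type*} [NormedAddCommGroup E] [NormedSpace ℝ E] [TopologicalSpace B]
    (I : ModelWithCorners ℝ E B) [TopologicalSpace X] [ChartedSpace B X] (S : Set X) (x : X) :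
    Submodule ℝ (TangentSpace I x) :=
  Submodule.span ℝ {v : TangentSpace I x | ∃ γ : ℝ → X, γ 0 = x ∧ (∀ s, γ s ∈ S) ∧
    HasMFDerivAt 𝓘(ℝ, ℝ) I γ 0 ((1 : ℝ →L[ℝ] ℝ).smulRight (v : TangentSpace I (γ 0)))}

section

variable {n : ℕ} {M : Type*} [TopologicalSpace M] [ChartedSpace (Eucl n) M]
  [IsManifold (𝓡 n) ∞ M]

instance : MeasurableSpace (Cotangent n M) := borel _

instance : BorelSpace (Cotangent n M) := ⟨rfl⟩

/-! ### Coordinates -/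

/-- The coordinate vector `∂/∂xᵢ` at `x` of the chart `φ`. -/
def coordVec (φ : OpenPartialHomeomorph M (Eucl n)) (x : M) (i : Fin n) : TangentSpace (𝓡 n) x :=
  (mfderiv (𝓡 n) (𝓡 n) φ x).inverse (EuclideanSpace.single i (1 : ℝ) : Eucl n)

/-- The matrix `(gᵢⱼ)` of the metric at `x` in the chart `φ`. -/
def gram (g : Metric n M) (φ : OpenPartialHomeomorph M (Eucl n)) (x : M) :
    Matrix (Fin n) (Fin n) ℝ :=
  Matrix.of fun i j => g.inner x (coordVec φ x i) (coordVec φ x j)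

/-- The principal symbol `p(x, ξ) = |ξ|_{g(x)} = (∑ g^{ij} ξᵢ ξⱼ)^{1/2}` of the half-Laplacian
(computed in the preferred chart at `x`; the value does not depend on the chart). -/
def symbol (g : Metric n M) (z : Cotangent n M) : ℝ :=
  Real.sqrt (∑ i, ∑ j, (gram g (chartAt (Eucl n) z.proj) z.proj)⁻¹ i j
    * z.2 (coordVec (chartAt (Eucl n) z.proj) z.proj i)
    * z.2 (coordVec (chartAt (Eucl n) z.proj) z.proj j))

/-! ### The homogeneous geodesic flow -/

/-- The Hamilton vector field `H_p = ∑ⱼ (∂p/∂ξⱼ ∂/∂xⱼ - ∂p/∂xⱼ ∂/∂ξⱼ)` of the principal symbol.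
The preferred chart of `T^*M` at `z` is the canonical chart `(x, ξ)` induced by the
preferred chart of `M` at `z.proj`, and Mathlib's tangent space at `z` is the model space
`ℝⁿ × (ℝⁿ)^*` as seen through that chart. -/
def hamiltonField (g : Metric n M) (z : Cotangent n M) : TangentSpace (cotModel n) z :=
  let D : Eucl n × (Eucl n →L[ℝ] ℝ) →L[ℝ] ℝ :=
    fderiv ℝ (fun u => symbol g ((extChartAt (cotModel n) z).symm u)) (extChartAt (cotModel n) z z)
  ((WithLp.toLp 2 fun j => D (0, dualCoord j),
    -(D.comp (ContinuousLinearMap.inl ℝ (Eucl n) (Eucl n →L[ℝ] ℝ)))) :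
      Eucl n × (Eucl n →L[ℝ] ℝ))

open Classical in
/-- The homogeneous geodesic flow `G^t`: `geodesicFlow g t z` is the value at time `t` of the
integral curve of `H_p` that starts at `z`. -/
def geodesicFlow (g : Metric n M) (t : ℝ) (z : Cotangent n M) : Cotangent n M :=
  if h : ∃ γ : ℝ → Cotangent n M, γ 0 = z ∧ IsMIntegralCurve (I := cotModel n) γ (hamiltonField g)
  then h.choose t else z

/-! ### Submanifolds and conormal directions -/

/-- `φ` is a smooth chart of `M`, with coordinates `x = (x', x'') ∈ ℝᵈ × ℝⁿ⁻ᵈ`, in whose domain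
`H` is defined by `x'' = 0`. -/
def IsAdapted (d : ℕ) (H : Set M) (φ : OpenPartialHomeomorph M (Eucl n)) : Prop :=
  φ ∈ IsManifold.maximalAtlas (𝓡 n) ∞ M ∧
    ∀ y ∈ φ.source, (y ∈ H ↔ ∀ i : Fin n, d ≤ i.val → φ y i = 0)

/-- `H` is an embedded submanifold (without boundary) of dimension `d`. -/
def IsEmbeddedSubmanifold (d : ℕ) (H : Set M) : Prop :=
  d ≤ n ∧ ∀ x ∈ H, ∃ φ : OpenPartialHomeomorph M (Eucl n), IsAdapted d H φ ∧ x ∈ φ.source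

open Classical in
/-- A chart around `x ∈ H` adapted to `H`. -/
def adaptedChart (d : ℕ) (H : Set M) (x : M) : OpenPartialHomeomorph M (Eucl n) :=
  if h : ∃ φ : OpenPartialHomeomorph M (Eucl n), IsAdapted d H φ ∧ x ∈ φ.source
  then h.choose else chartAt (Eucl n) x

/-- The set of nonzero conormal covectors `Ṅ^*H`. -/
def conormal (H : Set M) : Set (Cotangent n M) :=
  {z | z.proj ∈ H ∧ z.2 ≠ 0 ∧ ∀ v ∈ tangentOf (𝓡 n) H z.proj, z.2 v = 0}

/-- The unit conormal bundle `SN^*H = Ṅ^*H ∩ p⁻¹(1)`. -/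
def unitConormal (g : Metric n M) (H : Set M) : Set (Cotangent n M) :=
  {z | z ∈ conormal H ∧ symbol g z = 1}

/-- The point `(x', 0)` of `ℝⁿ`, where `w = (x', ξ'')`. -/
def basePart (d : ℕ) (w : Eucl n) : Eucl n :=
  WithLp.toLp 2 fun i => if i.val < d then w i else 0

/-- The covector `∑_{i ≥ d} ξᵢ dxⁱ` of `ℝⁿ`, where `w = (x', ξ'')`. -/
def fiberPart (d : ℕ) (w : Eucl n) : Eucl n →L[ℝ] ℝ :=
  ∑ i : Fin n, (if i.val < d then 0 else w i) • dualCoord i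

/-- The parametrization of `Ṅ^*H` by `w = (x', ξ'')` in an adapted chart `φ`: the covector
`∑_{i ≥ d} ξᵢ dxⁱ` at the point with coordinates `(x', 0)`. -/
def conormalParam (d : ℕ) (φ : OpenPartialHomeomorph M (Eucl n)) (w : Eucl n) : Cotangent n M :=
  ⟨φ.symm (basePart d w),
    (fiberPart d w).comp (mfderiv (𝓡 n) (𝓡 n) φ (φ.symm (basePart d w)))⟩

/-- The domain of `conormalParam`. -/
def conormalDomain (d : ℕ) (φ : OpenPartialHomeomorph M (Eucl n)) : Set (Eucl n) :=
  {w | basePart d w ∈ φ.target ∧ fiberPart d w ≠ 0}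

/-- The coordinates `(x', ξ'')` of a covector in the canonical coordinates `(x, ξ)` of the
chart `φ`. -/
def conormalCoord (d : ℕ) (φ : OpenPartialHomeomorph M (Eucl n)) (z : Cotangent n M) : Eucl n :=
  WithLp.toLp 2 fun i => if i.val < d then φ z.proj i else z.2 (coordVec φ z.proj i)

/-- The coefficient `|g_H(x')| / |g(x)|^{1/2}` at `x = (x', 0) ∈ H`, where `|·|` are the
determinants of the metric tensors of `H` and of `M` in the adapted chart `φ`. -/
def densityCoeff (g : Metric n M) (d : ℕ) (φ : OpenPartialHomeomorph M (Eucl n)) (x : M) : ℝ :=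
  ((gram g φ x).toSquareBlockProp fun i : Fin n => i.val < d).det / Real.sqrt (gram g φ x).det

/-- The part in the chart `φ` of the natural volume on `Ṅ^*H`: the density
`|g_H(x')| / |g(x)|^{1/2} |dx' dξ''|`. -/
def localVolume (g : Metric n M) (d : ℕ) (φ : OpenPartialHomeomorph M (Eucl n)) :
    Measure (Cotangent n M) :=
  Measure.map (conormalParam d φ)
    (((volume : Measure (Eucl n)).restrict (conormalDomain d φ)).withDensity
      fun w => ENNReal.ofReal (densityCoeff g d φ (φ.symm (basePart d w))))

/-- The natural volume on `Ṅ^*H`, as a measure on `T^*M`. The local volumes agree where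
two adapted charts overlap; the measure which they define together is their supremum. -/
def conormalVolume (g : Metric n M) (d : ℕ) (H : Set M) : Measure (Cotangent n M) :=
  ⨆ (φ : OpenPartialHomeomorph M (Eucl n)) (_ : IsAdapted d H φ), localVolume g d φ

/-- The radial projection `(x, ξ) ↦ (x, ξ / p(x, ξ))`. -/
def normalize (g : Metric n M) (z : Cotangent n M) : Cotangent n M :=
  ⟨z.proj, (symbol g z)⁻¹ • z.2⟩

/-- The Leray measure on `SN^*H = Ṅ^*H ∩ p⁻¹(1)` induced by the natural volume on `Ṅ^*H` and
the function `p`, as a measure on `T^*M`. The volume `dν` on `Ṅ^*H` is homogeneous of degree `n - d`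
under dilations of the fibers, so `dν = r^{n-d-1} dr dμ` where `r = p` and `μ` is the Leray
measure; hence `μ A` is `n - d` times the volume of the cone `{r z : z ∈ A, 0 < r < 1}`. -/
def lerayMeasure (g : Metric n M) (d : ℕ) (H : Set M) : Measure (Cotangent n M) :=
  ((n - d : ℕ) : ℝ≥0∞) •
    Measure.map (normalize g) ((conormalVolume g d H).restrict {z | 0 < symbol g z ∧ symbol g z < 1})

/-! ### Looping directions and the function `q` -/

/-- `SΣ_t`: the unit conormal directions `z` such that `G^t z` is conormal to `H` and
`dG^t : T_z Ṅ^*H → T_{G^t z} Ṅ^*H` is a linear isomorphism. -/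
def unitLooping (g : Metric n M) (H : Set M) (t : ℝ) : Set (Cotangent n M) :=
  {z | z ∈ unitConormal g H ∧ geodesicFlow g t z ∈ conormal H ∧
    BijOn (mfderiv (cotModel n) (cotModel n) (geodesicFlow g t) z)
      (tangentOf (cotModel n) (conormal H) z : Set (TangentSpace (cotModel n) z))
      (tangentOf (cotModel n) (conormal H) (geodesicFlow g t z) :
        Set (TangentSpace (cotModel n) (geodesicFlow g t z)))}

/-- `J_t(z)`, the positive determinant of `dG^t : T_z Ṅ^*H → T_{G^t z} Ṅ^*H` with respect
to the natural volumes: in the coordinates `(x', ξ'')` of adapted charts around the base points of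
`z` and of `G^t z`, the absolute value of the Jacobian determinant of `G^t` times the quotient of
the coefficients of the natural volume. It does not depend on the charts. -/
def jacobian (g : Metric n M) (d : ℕ) (H : Set M) (t : ℝ) (z : Cotangent n M) : ℝ :=
  let φ := adaptedChart d H z.proj
  let ψ := adaptedChart d H (geodesicFlow g t z).proj
  |(fderiv ℝ (fun w => conormalCoord d ψ (geodesicFlow g t (conormalParam d φ w)))
      (conormalCoord d φ z)).det|
    * densityCoeff g d ψ (geodesicFlow g t z).proj / densityCoeff g d φ z.proj

/-- The dimension of the intersection of `dG^s (T_z Ṅ^*H)` with the vertical space at `G^s z`. It is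
at least `1` for conormal `z`, because of the radial direction. -/
def verticalDim (g : Metric n M) (H : Set M) (s : ℝ) (z : Cotangent n M) : ℕ :=
  Module.finrank ℝ
    (((tangentOf (cotModel n) (conormal H) z).map
        (mfderiv (cotModel n) (cotModel n) (geodesicFlow g s) z).toLinearMap ⊓
      LinearMap.ker (mfderiv (cotModel n) (𝓡 n)
        (fun u : Cotangent n M => u.proj) (geodesicFlow g s z)).toLinearMap :
      Submodule ℝ (TangentSpace (cotModel n) (geodesicFlow g s z))))

/-- The Maslov factor `σ_t(z)`, for `z ∈ SΣ_t`: the Maslov index of the path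
`dG^s (T_z Ṅ^*H)`, `s` from `0` to `t`, of Lagrangian planes relative to the vertical spaces, after
the common radial direction has been divided out. As `p` is convex in `ξ`, all crossings
have the same sign. The crossings in the interior of the path are the focal points
of `H`, counted with multiplicity; the crossings at the two ends have multiplicity
`n - d - 1` each and count one half. -/
def maslov (g : Metric n M) (d : ℕ) (H : Set M) (t : ℝ) (z : Cotangent n M) : ℤ :=
  (SignType.sign t : ℤ) * (((n : ℤ) - d - 1) +
    ∑ᶠ s ∈ Ioo (min 0 t) (max 0 t), ((verticalDim g H s z : ℤ) - 1))

/-- `q(t) = (2π)^{-n+d} ∫_{SΣ_t} i^{σ_t} √J_t`. -/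
def q (g : Metric n M) (d : ℕ) (H : Set M) (t : ℝ) : ℂ :=
  ((2 * Real.pi : ℝ) : ℂ) ^ (-(n : ℤ) + d) *
    ∫ z in unitLooping g H t,
      Complex.I ^ maslov g d H t z * (Real.sqrt (jacobian g d H t z) : ℂ) ∂(lerayMeasure g d H)

/-- The set `𝒯` of nonzero times `t` for which `SΣ_t` has positive measure. -/
def loopTimes (g : Metric n M) (d : ℕ) (H : Set M) : Set ℝ :=
  {t | t ≠ 0 ∧ 0 < lerayMeasure g d H (unitLooping g H t)}

/-- The averaging condition `lim_{T → ∞} (1/T) ∑_{t ∈ 𝒯 ∩ [-T, T]} |q(t)| = 0`. The sums are taken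
in `[0, ∞]`, so the condition includes that they are finite for large `T`. -/
def AveragingCondition (g : Metric n M) (d : ℕ) (H : Set M) : Prop :=
  Tendsto (fun T : ℝ => (ENNReal.ofReal T)⁻¹ *
    ∑' t : ↥(loopTimes g d H ∩ Icc (-T) T), ENNReal.ofReal ‖q g d H (t : ℝ)‖) atTop (𝓝 0)

/-- The set `ℛ ⊆ SN^*H` of recurrent directions: those `z` such that each open neighborhood of `z`
in `SN^*H` contains `G^t z` for some `t ≠ 0`. -/
def recurrentSet (g : Metric n M) (H : Set M) : Set (Cotangent n M) :=
  {z | z ∈ unitConormal g H ∧ ∀ U : Set (Cotangent n M), IsOpen U → z ∈ U →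
    ∃ t : ℝ, t ≠ 0 ∧ geodesicFlow g t z ∈ U ∩ unitConormal g H}

end

end Kuznecov

end

open Set Filter Topology MeasureTheory Bundle
open scoped Manifold ContDiff ENNReal

set_option linter.unusedSectionVars false

noncomputable section

namespace Kuznecov

variable {n : ℕ} {M : Type*} [TopologicalSpace M] [ChartedSpace (Eucl n) M]
  [IsManifold (𝓡 n) ∞ M]

/-! The factor `i^σ` has modulus one, so it plays no role; the theorem is a statement about volumes
and return times. Let `μ` be the Leray measure, which is finite, and let `S_t` (`returnSet`) be the
set of unit conormal directions that are conormal again at time `t`. The Jacobian `J_t` is dominated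
on `SΣ_t` by a Borel function `K_t` with `∫_{S_t ∩ G^{-t}B} K_t dμ ≤ c μ(S_{-t} ∩ B)` for Borel `B`
(`exists_measurable_jacobian`). Since `√K ≤ r + K/r` for every `r > 0` (`rpow_half_le`), the
directions landing in `B` at time `t` contribute to `|q(t)|` at most a constant times `r μ(S_t ∩
G^{-t}B) + r⁻¹ μ(S_{-t} ∩ B)`, where `r` may be chosen freely.

Two counting facts control the sum over `t`. A conormal direction is not conormal again within a
uniform time `ε` (`exists_forall_notMem_conormal`), so a point lies in `O(T)` of the sets `S_t` with
`0 < |t| ≤ T` (`exists_card_le_mul`). And the non-recurrent directions are covered by countably many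
Borel sets `A_i`, each met at most once by every orbit (`exists_wandering_cover`). As the recurrent
set is null, the union `E` of the first `N` sets `A_i` has complement of measure at most `δ²` for
suitable `N`. Take `r = 1/δ` where `G^t z` is in `E` and `r = δ` where it is not. The terms `δ⁻¹
μ(S_t ∩ G^{-t}E)` sum to at most `δ⁻¹ N μ(univ)`, whatever `T` is; the three other kinds of terms
sum to `O(δT)`. Dividing by `T` and letting `T → ∞`, then `δ → 0`, gives the limit
(`tendsto_average_of_le`).

The geometric work is to supply these inputs. The field `H_p` is not smooth at the zero section, so
the flow is obtained from the Hamilton field of `p²/2` (`spray`), which is smooth everywhere and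
agrees with `H_p` on the compact level `p = 1`; homogeneity carries the flow to the other levels.
Only continuity of the flow in the initial point is established. Differentiability is never needed:
the change of variables (`lintegral_volRatio_le`) is applied where the coordinate expression is
differentiable, and elsewhere the default derivative `0` has determinant `0`. That the natural
volume and `J_t` do not depend on adapted charts is `abs_det_mul_densityCoeff` and
`volRatio_eq_volRatio`; the passage from `Ṅ^*H` to the Leray measure uses cones over subsets of
`SN^*H` (`lintegral_lerayMeasure_volRatio_le`). -/

/-- The phase space `ℝⁿ × (ℝⁿ)^*`. -/
abbrev Phase (n : ℕ) : Type := Eucl n × (Eucl n →L[ℝ] ℝ)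

/-- The covector part of a point of `T^*M`, as a functional on the model space. -/
def cov (z : Cotangent n M) : Eucl n →L[ℝ] ℝ := z.2

/-- The covector `ξ` at `x`. -/
def mkCov (x : M) (ξ : Eucl n →L[ℝ] ℝ) : Cotangent n M := ⟨x, ξ⟩

/-- The derivative of a chart, as a map of the model space. -/
def dchart (e : OpenPartialHomeomorph M (Eucl n)) (x : M) : Eucl n →L[ℝ] Eucl n :=
  mfderiv (𝓡 n) (𝓡 n) e x

/-- The canonical coordinates `(x, ξ)` on `T^*M` induced by the chart `e` of `M`. -/
def cotCoord (e : OpenPartialHomeomorph M (Eucl n)) (z : Cotangent n M) : Phase n :=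
  (e z.proj, (cov z).comp (dchart e z.proj).inverse)

/-- The inverse of `cotCoord`. -/
def cotParam (e : OpenPartialHomeomorph M (Eucl n)) (u : Phase n) : Cotangent n M :=
  mkCov (e.symm u.1) (u.2.comp (dchart e (e.symm u.1)))

/-- The canonical transformation `(x, ξ) ↦ (τ x, (Dτ)^{-T} ξ)`. -/
def cotTrans (τ : Eucl n → Eucl n) (u : Phase n) : Phase n :=
  (τ u.1, u.2.comp (fderiv ℝ τ u.1).inverse)

/-! ### Canonical coordinates on the cotangent bundle -/

section Charts

variable {e e' : OpenPartialHomeomorph M (Eucl n)}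

theorem mdifferentiable_of_mem_maximalAtlas
    (he : e ∈ IsManifold.maximalAtlas (𝓡 n) ∞ M) : e.MDifferentiable (𝓡 n) (𝓡 n) :=
  ⟨(contMDiffOn_of_mem_maximalAtlas he).mdifferentiableOn (by simp),
    (contMDiffOn_symm_of_mem_maximalAtlas he).mdifferentiableOn (by simp)⟩

theorem isInvertible_dchart (he : e ∈ IsManifold.maximalAtlas (𝓡 n) ∞ M) {x : M}
    (hx : x ∈ e.source) : (dchart e x).IsInvertible :=
  ⟨(mdifferentiable_of_mem_maximalAtlas he).mfderiv hx, rfl⟩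

theorem eq_inverse_of_comp_eq_id {E F : Type*} [NormedAddCommGroup E] [NormedSpace ℝ E]
    [NormedAddCommGroup F] [NormedSpace ℝ F] {A : E →L[ℝ] F} {B : F →L[ℝ] E}
    (hA : A.IsInvertible) (h : B.comp A = ContinuousLinearMap.id ℝ E) : B = A.inverse := by
  obtain ⟨A, rfl⟩ := hA
  rw [ContinuousLinearMap.inverse_equiv]
  ext1 v
  simpa using congrArg (fun L : E →L[ℝ] E => L (A.symm v)) h

theorem mfderiv_chart_symm (he : e ∈ IsManifold.maximalAtlas (𝓡 n) ∞ M) {x : M}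
    (hx : x ∈ e.source) :
    (mfderiv (𝓡 n) (𝓡 n) e.symm (e x) : Eucl n →L[ℝ] Eucl n) = (dchart e x).inverse := by
  refine eq_inverse_of_comp_eq_id (isInvertible_dchart he hx) ?_
  exact (mdifferentiable_of_mem_maximalAtlas he).symm_comp_deriv hx

@[simp] theorem mkCov_proj_cov (z : Cotangent n M) : mkCov z.proj (cov z) = z := rfl

@[simp] theorem cov_mkCov (x : M) (ξ : Eucl n →L[ℝ] ℝ) : cov (mkCov x ξ) = ξ := rfl

@[simp] theorem proj_mkCov (x : M) (ξ : Eucl n →L[ℝ] ℝ) : (mkCov x ξ).proj = x := rfl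

theorem cotParam_cotCoord (he : e ∈ IsManifold.maximalAtlas (𝓡 n) ∞ M) {z : Cotangent n M}
    (hz : z.proj ∈ e.source) : cotParam e (cotCoord e z) = z := by
  have hx : e.symm (e z.proj) = z.proj := e.left_inv hz
  unfold cotParam cotCoord
  simp only [hx]
  rw [ContinuousLinearMap.comp_assoc, (isInvertible_dchart he hz).inverse_comp_self,
    ContinuousLinearMap.comp_id, mkCov_proj_cov]

theorem cotCoord_cotParam (he : e ∈ IsManifold.maximalAtlas (𝓡 n) ∞ M) {u : Phase n}
    (hu : u.1 ∈ e.target) : cotCoord e (cotParam e u) = u := by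
  have h := (isInvertible_dchart he (e.map_target hu)).self_comp_inverse
  refine Prod.ext (e.right_inv hu) ?_
  simp only [cotCoord, cotParam, cov_mkCov, proj_mkCov]
  rw [ContinuousLinearMap.comp_assoc, h, ContinuousLinearMap.comp_id]

theorem contDiffOn_transition (he : e ∈ IsManifold.maximalAtlas (𝓡 n) ∞ M)
    (he' : e' ∈ IsManifold.maximalAtlas (𝓡 n) ∞ M) :
    ContDiffOn ℝ ∞ (e' ∘ e.symm) (e.symm.trans e').source := by
  have h : ContMDiffOn (𝓡 n) (𝓡 n) ∞ (e' ∘ e.symm) (e.symm.trans e').source := by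
    refine (contMDiffOn_of_mem_maximalAtlas he').comp
      ((contMDiffOn_symm_of_mem_maximalAtlas he).mono ?_) ?_
    · intro x hx; simpa using hx.1
    · intro x hx; exact hx.2
  exact contMDiffOn_iff_contDiffOn.mp h

theorem dchart_eq_comp (he : e ∈ IsManifold.maximalAtlas (𝓡 n) ∞ M)
    (he' : e' ∈ IsManifold.maximalAtlas (𝓡 n) ∞ M) {x : M} (hx : x ∈ e.source)
    (hx' : x ∈ e'.source) :
    dchart e' x = (fderiv ℝ (e' ∘ e.symm) (e x)).comp (dchart e x) := by
  have h1 : MDifferentiableAt (𝓡 n) (𝓡 n) (e' ∘ e.symm) (e x) := by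
    refine MDifferentiableAt.comp (e x) (I' := 𝓡 n) ?_
      ((mdifferentiable_of_mem_maximalAtlas he).mdifferentiableAt_symm (e.map_source hx))
    rw [e.left_inv hx]
    exact (mdifferentiable_of_mem_maximalAtlas he').mdifferentiableAt hx'
  have h2 := (mdifferentiable_of_mem_maximalAtlas he).mdifferentiableAt hx
  have h3 : e' =ᶠ[𝓝 x] (e' ∘ e.symm) ∘ e := by
    filter_upwards [e.open_source.mem_nhds hx] with y hy
    simp [e.left_inv hy]
  unfold dchart
  rw [h3.mfderiv_eq, mfderiv_comp x h1 h2, mfderiv_eq_fderiv]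
  rfl

theorem isInvertible_fderiv_transition (he : e ∈ IsManifold.maximalAtlas (𝓡 n) ∞ M)
    (he' : e' ∈ IsManifold.maximalAtlas (𝓡 n) ∞ M) {x : M} (hx : x ∈ e.source)
    (hx' : x ∈ e'.source) : (fderiv ℝ (e' ∘ e.symm) (e x)).IsInvertible := by
  have h := dchart_eq_comp he he' hx hx'
  obtain ⟨A, hA⟩ := isInvertible_dchart he hx
  obtain ⟨B, hB⟩ := isInvertible_dchart he' hx'
  refine ⟨A.symm.trans B, ?_⟩
  rw [← hA, ← hB] at h
  ext1 v
  have := congrArg (fun L : Eucl n →L[ℝ] Eucl n => L (A.symm v)) h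
  simpa using this

theorem inverse_dchart (he : e ∈ IsManifold.maximalAtlas (𝓡 n) ∞ M)
    (he' : e' ∈ IsManifold.maximalAtlas (𝓡 n) ∞ M) {x : M} (hx : x ∈ e.source)
    (hx' : x ∈ e'.source) :
    (dchart e' x).inverse =
      (dchart e x).inverse.comp (fderiv ℝ (e' ∘ e.symm) (e x)).inverse := by
  rw [dchart_eq_comp he he' hx hx']
  exact ContinuousLinearMap.IsInvertible.inverse_comp_of_left
    (isInvertible_fderiv_transition he he' hx hx')

theorem cotCoord_eq_cotTrans (he : e ∈ IsManifold.maximalAtlas (𝓡 n) ∞ M)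
    (he' : e' ∈ IsManifold.maximalAtlas (𝓡 n) ∞ M) {z : Cotangent n M} (hz : z.proj ∈ e.source)
    (hz' : z.proj ∈ e'.source) : cotCoord e' z = cotTrans (e' ∘ e.symm) (cotCoord e z) := by
  refine Prod.ext ?_ ?_
  · simp [cotCoord, cotTrans, e.left_inv hz]
  · change (cov z).comp (dchart e' z.proj).inverse = _
    rw [inverse_dchart he he' hz hz']
    rfl

theorem contDiffOn_cotTrans {τ : Eucl n → Eucl n} {s : Set (Eucl n)} (hs : IsOpen s)
    (hτ : ContDiffOn ℝ ∞ τ s) (hinv : ∀ x ∈ s, (fderiv ℝ τ x).IsInvertible) :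
    ContDiffOn ℝ ∞ (cotTrans τ) (s ×ˢ univ) := by
  rintro ⟨x, ξ⟩ ⟨hx, -⟩
  apply ContDiffAt.contDiffWithinAt
  have h1 : ContDiffAt ℝ ∞ τ x := hτ.contDiffAt (hs.mem_nhds hx)
  have h2 : ContDiffAt ℝ ∞ (fderiv ℝ τ) x := h1.fderiv_right (by simp)
  have h3 : ContDiffAt ℝ ∞ ContinuousLinearMap.inverse (fderiv ℝ τ x) := by
    obtain ⟨A, hA⟩ := hinv x hx
    rw [← hA]
    exact contDiffAt_map_inverse A
  have h4 : ContDiffAt ℝ ∞ (fun u : Phase n => (fderiv ℝ τ u.1).inverse) (x, ξ) :=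
    (h3.comp x h2).comp (x, ξ) contDiffAt_fst
  exact (h1.comp (x, ξ) contDiffAt_fst).prodMk (contDiffAt_snd.clm_comp h4)

theorem contDiffOn_cotTrans_transition (he : e ∈ IsManifold.maximalAtlas (𝓡 n) ∞ M)
    (he' : e' ∈ IsManifold.maximalAtlas (𝓡 n) ∞ M) :
    ContDiffOn ℝ ∞ (cotTrans (e' ∘ e.symm)) ((e.symm.trans e').source ×ˢ univ) := by
  refine contDiffOn_cotTrans (e.symm.trans e').open_source (contDiffOn_transition he he') ?_
  intro x hx
  have h := isInvertible_fderiv_transition he he' (e.map_target hx.1) hx.2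
  rwa [e.right_inv hx.1] at h

/-- The preferred chart of the bundle `T^*M` comes from trivializations of `TM`, and these are
derivatives of charts of `M`. Unwinding them makes everything defined through `extChartAt`, in
particular `hamiltonField`, computable in canonical coordinates. -/
theorem extChartAt_cotangent {z₀ z : Cotangent n M}
    (hz : z.proj ∈ (chartAt (Eucl n) z₀.proj).source) :
    extChartAt (cotModel n) z₀ z = cotCoord (chartAt (Eucl n) z₀.proj) z := by
  have h : extChartAt (cotModel n) z₀ z =
      chartAt (ModelProd (Eucl n) (Eucl n →L[ℝ] ℝ)) z₀ z := by
    simp [extChartAt]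
  rw [h, hom_chart]
  refine Prod.ext rfl ?_
  have h2 : (Trivialization.symmL ℝ (trivializationAt (Eucl n) (TangentSpace (𝓡 n)) z₀.proj)
      z.proj : Eucl n →L[ℝ] Eucl n) = (dchart (chartAt (Eucl n) z₀.proj) z.proj).inverse := by
    rw [TangentBundle.symmL_trivializationAt hz, ← mfderiv_chart_symm
      (IsManifold.chart_mem_maximalAtlas _) hz]
    simp [extChartAt]
    rfl
  change ContinuousLinearMap.inCoordinates (Eucl n) (fun x : M => TangentSpace (𝓡 n) x) ℝ
    (fun _ : M => ℝ) z₀.proj z.proj z₀.proj z.proj z.2 = (cov z).comp _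
  rw [← h2]
  ext v
  simp [ContinuousLinearMap.inCoordinates]
  rfl

theorem mem_extChartAt_cotangent_source {z₀ z : Cotangent n M} :
    z ∈ (extChartAt (cotModel n) z₀).source ↔
      z.proj ∈ (chartAt (Eucl n) z₀.proj).source := by
  rw [extChartAt_source, FiberBundle.chartedSpace_chartAt]
  simp [Trivialization.source_eq, hom_trivializationAt_baseSet]
  tauto

theorem mem_extChartAt_cotangent_target {z₀ : Cotangent n M} {u : Phase n} :
    u ∈ (extChartAt (cotModel n) z₀).target ↔ u.1 ∈ (chartAt (Eucl n) z₀.proj).target := by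
  rw [FiberBundle.extChartAt_target]
  simp only [mem_prod, mem_inter_iff, mem_univ, and_true, mem_preimage,
    hom_trivializationAt_baseSet, TangentBundle.trivializationAt_baseSet]
  simp [extChartAt]
  intro h
  exact (chartAt (Eucl n) z₀.proj).map_target h

theorem extChartAt_cotangent_symm {z₀ : Cotangent n M} {u : Phase n}
    (hu : u.1 ∈ (chartAt (Eucl n) z₀.proj).target) :
    (extChartAt (cotModel n) z₀).symm u = cotParam (chartAt (Eucl n) z₀.proj) u := by
  have h1 : u ∈ (extChartAt (cotModel n) z₀).target := mem_extChartAt_cotangent_target.2 hu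
  have h2 : (cotParam (chartAt (Eucl n) z₀.proj) u).proj ∈ (chartAt (Eucl n) z₀.proj).source :=
    (chartAt (Eucl n) z₀.proj).map_target hu
  refine (extChartAt (cotModel n) z₀).injOn ((extChartAt (cotModel n) z₀).map_target h1)
    (mem_extChartAt_cotangent_source.2 h2) ?_
  rw [(extChartAt (cotModel n) z₀).right_inv h1, extChartAt_cotangent h2,
    cotCoord_cotParam (IsManifold.chart_mem_maximalAtlas _) hu]

theorem continuous_proj_cotangent : Continuous (fun z : Cotangent n M => z.proj) :=
  FiberBundle.continuous_proj (Eucl n →L[ℝ] ℝ) (fun x : M => TangentSpace (𝓡 n) x →L[ℝ] ℝ)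

theorem isOpen_proj_preimage {s : Set M} (hs : IsOpen s) :
    IsOpen {z : Cotangent n M | z.proj ∈ s} := hs.preimage continuous_proj_cotangent

theorem contMDiffAt_cotCoord (he : e ∈ IsManifold.maximalAtlas (𝓡 n) ∞ M) {z : Cotangent n M}
    (hz : z.proj ∈ e.source) : ContMDiffAt (cotModel n) 𝓘(ℝ, Phase n) ∞ (cotCoord e) z := by
  have hc := IsManifold.chart_mem_maximalAtlas (I := 𝓡 n) (n := ∞) z.proj
  have h1 : ContMDiffAt (cotModel n) 𝓘(ℝ, Phase n) ∞ (extChartAt (cotModel n) z) z :=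
    contMDiffAt_extChartAt
  have h2 : ContDiffAt ℝ ∞ (cotTrans (e ∘ (chartAt (Eucl n) z.proj).symm))
      (extChartAt (cotModel n) z z) := by
    refine (contDiffOn_cotTrans_transition hc he).contDiffAt
      (((((chartAt (Eucl n) z.proj).symm.trans e).open_source).prod isOpen_univ).mem_nhds ?_)
    rw [extChartAt_cotangent (mem_chart_source _ _)]
    simp [cotCoord, hz]
  refine (h2.contMDiffAt.comp z h1).congr_of_eventuallyEq ?_
  filter_upwards [(isOpen_proj_preimage (e.open_source.inter
    (chartAt (Eucl n) z.proj).open_source)).mem_nhds ⟨hz, mem_chart_source _ _⟩] with y hy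
  rw [Function.comp_apply, extChartAt_cotangent hy.2, cotCoord_eq_cotTrans hc he hy.2 hy.1]

theorem contMDiffAt_cotParam (he : e ∈ IsManifold.maximalAtlas (𝓡 n) ∞ M) {u : Phase n}
    (hu : u.1 ∈ e.target) : ContMDiffAt 𝓘(ℝ, Phase n) (cotModel n) ∞ (cotParam e) u := by
  set x := e.symm u.1 with hx
  set z := cotParam e u with hzdef
  have hc := IsManifold.chart_mem_maximalAtlas (I := 𝓡 n) (n := ∞) x
  have hmem : u ∈ ((e.symm.trans (chartAt (Eucl n) x)).source ×ˢ univ : Set (Phase n)) := by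
    simp [hu, ← hx]
  have hnhds := (((e.symm.trans (chartAt (Eucl n) x)).open_source).prod
    (isOpen_univ (X := Eucl n →L[ℝ] ℝ))).mem_nhds hmem
  have h2 : ContDiffAt ℝ ∞ (cotTrans (chartAt (Eucl n) x ∘ e.symm)) u :=
    (contDiffOn_cotTrans_transition he hc).contDiffAt hnhds
  have h3 : cotTrans (chartAt (Eucl n) x ∘ e.symm) u ∈ (extChartAt (cotModel n) z).target := by
    rw [mem_extChartAt_cotangent_target]
    exact (chartAt (Eucl n) x).map_source (mem_chart_source _ _)
  have h1 : ContMDiffAt 𝓘(ℝ, Phase n) (cotModel n) ∞ (extChartAt (cotModel n) z).symm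
      (cotTrans (chartAt (Eucl n) x ∘ e.symm) u) :=
    (contMDiffOn_extChartAt_symm z).contMDiffAt
      ((isOpen_extChartAt_target z).mem_nhds h3)
  refine (h1.comp u h2.contMDiffAt).congr_of_eventuallyEq ?_
  filter_upwards [hnhds] with v hv
  have hv1 : v.1 ∈ e.target := hv.1.1
  have hv2 : e.symm v.1 ∈ (chartAt (Eucl n) x).source := hv.1.2
  have h4 := cotCoord_eq_cotTrans he hc (z := cotParam e v) (e.map_target hv1) hv2
  rw [cotCoord_cotParam he hv1] at h4
  rw [Function.comp_apply, ← h4, extChartAt_cotangent_symm ((chartAt (Eucl n) x).map_source hv2)]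
  exact (cotParam_cotCoord hc hv2).symm

/-- Uniqueness of integral curves needs a Hausdorff phase space. Points over different base points
are separated in `M`, points of one fiber by canonical coordinates. -/
instance [T2Space M] : T2Space (Cotangent n M) := by
  refine ⟨fun z w hzw => ?_⟩
  by_cases h : z.proj = w.proj
  · have hc := IsManifold.chart_mem_maximalAtlas (I := 𝓡 n) (n := ∞) z.proj
    have hz : z.proj ∈ (chartAt (Eucl n) z.proj).source := mem_chart_source _ _
    have hw : w.proj ∈ (chartAt (Eucl n) z.proj).source := h ▸ hz
    have hne : cotCoord (chartAt (Eucl n) z.proj) z ≠ cotCoord (chartAt (Eucl n) z.proj) w := by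
      intro h'
      apply hzw
      rw [← cotParam_cotCoord hc hz, h', cotParam_cotCoord hc hw]
    obtain ⟨U, V, hU, hV, hzU, hwV, hd⟩ := t2_separation hne
    have h1 := (contMDiffAt_cotCoord hc hz).continuousAt.preimage_mem_nhds (hU.mem_nhds hzU)
    have h2 := (contMDiffAt_cotCoord hc hw).continuousAt.preimage_mem_nhds (hV.mem_nhds hwV)
    obtain ⟨U', hU', hUo, hzU'⟩ := mem_nhds_iff.1 h1
    obtain ⟨V', hV', hVo, hwV'⟩ := mem_nhds_iff.1 h2
    exact ⟨U', V', hUo, hVo, hzU', hwV', (hd.preimage _).mono hU' hV'⟩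
  · obtain ⟨U, V, hU, hV, hzU, hwV, hd⟩ := t2_separation h
    exact ⟨_, _, isOpen_proj_preimage hU, isOpen_proj_preimage hV, hzU, hwV,
      hd.preimage (fun z : Cotangent n M => z.proj)⟩

end Charts

end Kuznecov

namespace Kuznecov

variable {n : ℕ} {M : Type*} [TopologicalSpace M] [ChartedSpace (Eucl n) M]
  [IsManifold (𝓡 n) ∞ M]

/-! ### The symbol in coordinates -/

/-- The components of a covector of `ℝⁿ`. -/
def comps (ξ : Eucl n →L[ℝ] ℝ) (i : Fin n) : ℝ := ξ (EuclideanSpace.single i (1 : ℝ))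

/-- The square of the symbol. -/
def symbolSq (g : Metric n M) (z : Cotangent n M) : ℝ :=
  ∑ i, ∑ j, (gram g (chartAt (Eucl n) z.proj) z.proj)⁻¹ i j
    * z.2 (coordVec (chartAt (Eucl n) z.proj) z.proj i)
    * z.2 (coordVec (chartAt (Eucl n) z.proj) z.proj j)

theorem symbol_eq_sqrt (g : Metric n M) (z : Cotangent n M) :
    symbol g z = Real.sqrt (symbolSq g z) := rfl

/-- The quadratic form of the inverse of a matrix. -/
def invQuad (G : Matrix (Fin n) (Fin n) ℝ) (v : Fin n → ℝ) : ℝ := v ⬝ᵥ (G⁻¹.mulVec v)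

theorem invQuad_eq_sum (G : Matrix (Fin n) (Fin n) ℝ) (v : Fin n → ℝ) :
    invQuad G v = ∑ i, ∑ j, G⁻¹ i j * v i * v j := by
  simp only [invQuad, dotProduct, Matrix.mulVec, Finset.mul_sum]
  exact Finset.sum_congr rfl fun i _ => Finset.sum_congr rfl fun j _ => by ring

theorem eucl_eq_sum (v : Eucl n) : v = ∑ i, v i • EuclideanSpace.single i (1 : ℝ) := by
  ext j
  simp [Finset.sum_apply, Pi.single_apply]

section Gram

variable {e e' : OpenPartialHomeomorph M (Eucl n)}

theorem symbolSq_eq_invQuad_chartAt (g : Metric n M) (z : Cotangent n M) :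
    symbolSq g z = invQuad (gram g (chartAt (Eucl n) z.proj) z.proj)
      (comps (cotCoord (chartAt (Eucl n) z.proj) z).2) := by
  rw [invQuad_eq_sum]; rfl

theorem coordVec_eq_sum (he : e ∈ IsManifold.maximalAtlas (𝓡 n) ∞ M)
    (he' : e' ∈ IsManifold.maximalAtlas (𝓡 n) ∞ M) {x : M} (hx : x ∈ e.source)
    (hx' : x ∈ e'.source) (i : Fin n) :
    coordVec e x i = ∑ k, (fderiv ℝ (e' ∘ e.symm) (e x) (EuclideanSpace.single i (1 : ℝ))) k •
      coordVec e' x k := by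
  have h : ((dchart e x).inverse (EuclideanSpace.single i (1 : ℝ)) : Eucl n) =
      ∑ k, (fderiv ℝ (e' ∘ e.symm) (e x) (EuclideanSpace.single i (1 : ℝ))) k •
        (dchart e' x).inverse (EuclideanSpace.single k (1 : ℝ)) := by
    obtain ⟨T, hT⟩ := isInvertible_fderiv_transition he he' hx hx'
    rw [inverse_dchart he he' hx hx', ← hT]
    simp only [← map_smul, ← map_sum, ← eucl_eq_sum]
    simp
  exact h

/-- The matrix of the derivative of a change of charts. -/
def transMatrix (e e' : OpenPartialHomeomorph M (Eucl n)) (x : M) : Matrix (Fin n) (Fin n) ℝ :=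
  Matrix.of fun k i => (fderiv ℝ (e' ∘ e.symm) (e x) (EuclideanSpace.single i (1 : ℝ))) k

theorem gram_eq_mul (g : Metric n M) (he : e ∈ IsManifold.maximalAtlas (𝓡 n) ∞ M)
    (he' : e' ∈ IsManifold.maximalAtlas (𝓡 n) ∞ M) {x : M} (hx : x ∈ e.source)
    (hx' : x ∈ e'.source) :
    gram g e x = (transMatrix e e' x).transpose * gram g e' x * transMatrix e e' x := by
  ext i j
  simp only [gram, Matrix.of_apply, Matrix.mul_apply, Matrix.transpose_apply]
  rw [coordVec_eq_sum he he' hx hx' i, coordVec_eq_sum he he' hx hx' j]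
  simp only [map_sum, map_smul, _root_.sum_apply, _root_.smul_apply,
    smul_eq_mul, transMatrix, Matrix.of_apply]
  refine Finset.sum_congr rfl fun k _ => ?_
  rw [mul_comm]

theorem comps_cotCoord (he : e ∈ IsManifold.maximalAtlas (𝓡 n) ∞ M)
    (he' : e' ∈ IsManifold.maximalAtlas (𝓡 n) ∞ M) {z : Cotangent n M} (hx : z.proj ∈ e.source)
    (hx' : z.proj ∈ e'.source) :
    comps (cotCoord e z).2 =
      (transMatrix e e' z.proj).transpose.mulVec (comps (cotCoord e' z).2) := by
  ext i
  have h : comps (cotCoord e z).2 i = z.2 (coordVec e z.proj i) := rfl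
  rw [h, coordVec_eq_sum he he' hx hx' i, map_sum]
  refine Finset.sum_congr rfl fun k _ => ?_
  rw [map_smul]
  rfl

theorem isUnit_det_transMatrix (he : e ∈ IsManifold.maximalAtlas (𝓡 n) ∞ M)
    (he' : e' ∈ IsManifold.maximalAtlas (𝓡 n) ∞ M) {x : M} (hx : x ∈ e.source)
    (hx' : x ∈ e'.source) : IsUnit (transMatrix e e' x).det := by
  obtain ⟨T, hT⟩ := isInvertible_fderiv_transition he he' hx hx'
  have h : transMatrix e e' x = LinearMap.toMatrix (EuclideanSpace.basisFun (Fin n) ℝ).toBasis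
      (EuclideanSpace.basisFun (Fin n) ℝ).toBasis (fderiv ℝ (e' ∘ e.symm) (e x)).toLinearMap := by
    ext k i
    simp [transMatrix, LinearMap.toMatrix_apply]
  rw [h, ← hT]
  exact LinearEquiv.isUnit_det T.toLinearEquiv _ _

theorem gram_posDef (g : Metric n M) (he : e ∈ IsManifold.maximalAtlas (𝓡 n) ∞ M) {x : M}
    (hx : x ∈ e.source) : (gram g e x).PosDef := by
  refine Matrix.PosDef.of_dotProduct_mulVec_pos ?_ fun v hv => ?_
  · ext i j
    simp [gram, g.symm x]
  · set w : TangentSpace (𝓡 n) x := ∑ i, v i • coordVec e x i with hw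
    have h1 : star v ⬝ᵥ (gram g e x).mulVec v = g.inner x w w := by
      simp only [hw, map_sum, map_smul, _root_.sum_apply, _root_.smul_apply, smul_eq_mul,
        dotProduct, Matrix.mulVec, gram, Matrix.of_apply, Finset.mul_sum]
      rw [Finset.sum_comm]
      refine Finset.sum_congr rfl fun i _ => Finset.sum_congr rfl fun j _ => ?_
      simp only [star_trivial]
      ring
    rw [h1]
    refine g.pos x w fun h0 => hv ?_
    have h2 : (w : Eucl n) = (dchart e x).inverse (WithLp.toLp 2 v) := by
      conv_rhs => rw [eucl_eq_sum (WithLp.toLp 2 v)]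
      rw [map_sum]
      exact Finset.sum_congr rfl fun i _ => ((dchart e x).inverse.map_smul _ _).symm
    obtain ⟨A, hA⟩ := isInvertible_dchart he hx
    rw [← hA, ContinuousLinearMap.inverse_equiv] at h2
    have h3 : (A.symm : Eucl n →L[ℝ] Eucl n) (WithLp.toLp 2 v) = 0 := h2.symm.trans h0
    have h4 : WithLp.toLp 2 v = (0 : Eucl n) := by simpa using h3
    simpa using congrArg (WithLp.ofLp) h4

/-- The Gram matrix changes by `G = Aᵀ G' A` and the covector components by `v = Aᵀ v'`, so the
inverse quadratic form is invariant. This replaces the preferred chart, which jumps from point to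
point, by one fixed chart in which regularity can be checked. -/
theorem symbolSq_eq (g : Metric n M) (he : e ∈ IsManifold.maximalAtlas (𝓡 n) ∞ M)
    {z : Cotangent n M} (hz : z.proj ∈ e.source) :
    symbolSq g z = invQuad (gram g e z.proj) (comps (cotCoord e z).2) := by
  have hc := IsManifold.chart_mem_maximalAtlas (I := 𝓡 n) (n := ∞) z.proj
  have hx := mem_chart_source (Eucl n) z.proj
  rw [symbolSq_eq_invQuad_chartAt, gram_eq_mul g hc he hx hz, comps_cotCoord hc he hx hz]
  set A := transMatrix (chartAt (Eucl n) z.proj) e z.proj with hA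
  have hu : IsUnit A.det := isUnit_det_transMatrix hc he hx hz
  have hu' : IsUnit A.transpose.det := by rwa [Matrix.det_transpose]
  unfold invQuad
  rw [Matrix.mul_inv_rev, Matrix.mul_inv_rev, Matrix.mulVec_mulVec, Matrix.mul_assoc,
    Matrix.mul_assoc, Matrix.nonsing_inv_mul _ hu', Matrix.mul_one, Matrix.mulVec_transpose,
    ← Matrix.dotProduct_mulVec, Matrix.mulVec_mulVec, ← Matrix.mul_assoc,
    Matrix.mul_nonsing_inv _ hu, Matrix.one_mul]

theorem invQuad_pos {G : Matrix (Fin n) (Fin n) ℝ} (hG : G.PosDef) {v : Fin n → ℝ}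
    (hv : v ≠ 0) : 0 < invQuad G v := by
  simpa [invQuad] using hG.inv.dotProduct_mulVec_pos hv

theorem comps_eq_zero_iff {ξ : Eucl n →L[ℝ] ℝ} : comps ξ = 0 ↔ ξ = 0 := by
  constructor
  · intro h
    ext v
    rw [eucl_eq_sum v, map_sum]
    simp only [map_smul]
    exact Finset.sum_eq_zero fun i _ => by
      have := congrFun h i
      simp only [comps, Pi.zero_apply] at this
      simp [this]
  · rintro rfl; ext; simp [comps]

theorem symbolSq_pos_iff (g : Metric n M) {z : Cotangent n M} : 0 < symbolSq g z ↔ cov z ≠ 0 := by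
  have hc := IsManifold.chart_mem_maximalAtlas (I := 𝓡 n) (n := ∞) z.proj
  have hx := mem_chart_source (Eucl n) z.proj
  rw [symbolSq_eq g hc hx]
  constructor
  · intro h h0
    have : (cotCoord (chartAt (Eucl n) z.proj) z).2 = 0 := by simp [cotCoord, h0]
    rw [this] at h
    simp [comps_eq_zero_iff.2 rfl, invQuad] at h
  · intro h
    refine invQuad_pos (gram_posDef g hc hx) fun h0 => h ?_
    have h1 : (cotCoord (chartAt (Eucl n) z.proj) z).2 = 0 := comps_eq_zero_iff.1 h0
    have h2 := cotParam_cotCoord hc (z := z) hx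
    have h3 : cov (cotParam (chartAt (Eucl n) z.proj) (cotCoord (chartAt (Eucl n) z.proj) z)) = 0 := by
      simp [cotParam, h1]
    rwa [h2] at h3

theorem symbol_pos_iff (g : Metric n M) {z : Cotangent n M} : 0 < symbol g z ↔ cov z ≠ 0 := by
  rw [symbol_eq_sqrt, Real.sqrt_pos, symbolSq_pos_iff]

theorem symbolSq_nonneg (g : Metric n M) (z : Cotangent n M) : 0 ≤ symbolSq g z := by
  by_cases h : cov z = 0
  · have : z.2 = 0 := h
    simp [symbolSq, this]
  · exact ((symbolSq_pos_iff g).2 h).le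

theorem symbol_sq (g : Metric n M) (z : Cotangent n M) : symbol g z ^ 2 = symbolSq g z := by
  rw [symbol_eq_sqrt, Real.sq_sqrt (symbolSq_nonneg g z)]

/-! ### Smoothness of the symbol -/

/-- In the trivialization at `x` the coordinate vector field is a column of the Jacobian of a smooth
change of charts. -/
theorem contMDiffAt_coordVec (he : e ∈ IsManifold.maximalAtlas (𝓡 n) ∞ M) {x : M}
    (hx : x ∈ e.source) (i : Fin n) :
    ContMDiffAt (𝓡 n) ((𝓡 n).prod 𝓘(ℝ, Eucl n)) ∞
      (fun y : M => TotalSpace.mk' (Eucl n) y (coordVec e y i)) x := by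
  have hc := IsManifold.chart_mem_maximalAtlas (I := 𝓡 n) (n := ∞) x
  have hx0 := mem_chart_source (Eucl n) x
  rw [contMDiffAt_section]
  have h1 : ContMDiffAt (𝓡 n) 𝓘(ℝ, Eucl n) ∞ (fun y : M =>
      fderiv ℝ (chartAt (Eucl n) x ∘ e.symm) (e y) (EuclideanSpace.single i (1 : ℝ))) x := by
    have h2 : ContDiffAt ℝ ∞ (chartAt (Eucl n) x ∘ e.symm) (e x) :=
      (contDiffOn_transition he hc).contDiffAt
        ((e.symm.trans (chartAt (Eucl n) x)).open_source.mem_nhds (by simp [hx]))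
    have h3 : ContDiffAt ℝ ∞ (fun v => fderiv ℝ (chartAt (Eucl n) x ∘ e.symm) v
        (EuclideanSpace.single i (1 : ℝ))) (e x) :=
      (h2.fderiv_right (by simp)).clm_apply contDiffAt_const
    exact h3.contMDiffAt.comp x ((contMDiffOn_of_mem_maximalAtlas he).contMDiffAt
      (e.open_source.mem_nhds hx))
  refine h1.congr_of_eventuallyEq ?_
  filter_upwards [(e.open_source.inter (chartAt (Eucl n) x).open_source).mem_nhds ⟨hx, hx0⟩]
    with y hy
  have h5 : (Trivialization.continuousLinearMapAt ℝ
      (trivializationAt (Eucl n) (TangentSpace (𝓡 n)) x) y : Eucl n →L[ℝ] Eucl n) =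
      dchart (chartAt (Eucl n) x) y := by
    rw [TangentBundle.continuousLinearMapAt_trivializationAt hy.2]
    simp [extChartAt]
    rfl
  have h6 : (trivializationAt (Eucl n) (TangentSpace (𝓡 n)) x
      (TotalSpace.mk' (Eucl n) y (coordVec e y i))).2 =
      (Trivialization.continuousLinearMapAt ℝ
      (trivializationAt (Eucl n) (TangentSpace (𝓡 n)) x) y : Eucl n →L[ℝ] Eucl n)
        (coordVec e y i) := by
    have := Trivialization.coe_linearMapAt_of_mem (R := ℝ)
      (trivializationAt (Eucl n) (TangentSpace (𝓡 n)) x) (b := y) (by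
        rw [TangentBundle.trivializationAt_baseSet]; exact hy.2)
    exact (congrFun this (coordVec e y i)).symm
  rw [h6, h5, dchart_eq_comp he hc hy.1 hy.2]
  obtain ⟨A, hA⟩ := isInvertible_dchart he hy.1
  have h7 : (coordVec e y i : Eucl n) = A.symm (EuclideanSpace.single i (1 : ℝ)) := by
    have : (coordVec e y i : Eucl n) =
      (dchart e y).inverse (EuclideanSpace.single i (1 : ℝ)) := rfl
    rw [this, ← hA, ContinuousLinearMap.inverse_equiv]
    rfl
  have h8 : dchart e y (coordVec e y i : Eucl n) = EuclideanSpace.single i (1 : ℝ) := by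
    rw [← hA, h7]; simp
  exact congrArg (fderiv ℝ (chartAt (Eucl n) x ∘ e.symm) (e y)) h8

theorem contMDiffAt_gram (g : Metric n M) (he : e ∈ IsManifold.maximalAtlas (𝓡 n) ∞ M) {x : M}
    (hx : x ∈ e.source) (i j : Fin n) :
    ContMDiffAt (𝓡 n) 𝓘(ℝ, ℝ) ∞ (fun y => gram g e y i j) x := by
  have h1 := g.contMDiff.contMDiffAt (x := x)
  have h2 := contMDiffAt_coordVec he hx i
  have h3 := contMDiffAt_coordVec he hx j
  have : ContMDiffAt (𝓡 n) ((𝓡 n).prod 𝓘(ℝ)) ∞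
      (fun m ↦ TotalSpace.mk' ℝ (E := Bundle.Trivial M ℝ) m
        (g.inner m (coordVec e m i) (coordVec e m j))) x := by
    apply ContMDiffAt.clm_bundle_apply₂ (F₁ := Eucl n) (F₂ := Eucl n)
    · exact h1
    · exact h2
    · exact h3
  simp only [contMDiffAt_totalSpace] at this
  exact this.2

theorem contDiffAt_det {E : Type*} [NormedAddCommGroup E] [NormedSpace ℝ E] {m : WithTop ℕ∞}
    {G : E → Matrix (Fin n) (Fin n) ℝ} {u : E} (h : ∀ i j, ContDiffAt ℝ m (fun v => G v i j) u) :
    ContDiffAt ℝ m (fun v => (G v).det) u := by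
  simp only [Matrix.det_apply]
  refine ContDiffAt.sum fun σ _ => ContDiffAt.const_smul _ ?_
  exact contDiffAt_prod fun i _ => h _ _

theorem contDiffAt_matrix_inv {E : Type*} [NormedAddCommGroup E] [NormedSpace ℝ E]
    {m : WithTop ℕ∞} {G : E → Matrix (Fin n) (Fin n) ℝ} {u : E}
    (h : ∀ i j, ContDiffAt ℝ m (fun v => G v i j) u) (hu : (G u).det ≠ 0) (i j : Fin n) :
    ContDiffAt ℝ m (fun v => (G v)⁻¹ i j) u := by
  -- Cramer's rule reduces the inverse to determinants, which are polynomial in the entries.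
  have h1 : ∀ v, (G v)⁻¹ i j = ((G v).det)⁻¹ * ((G v).updateRow j (Pi.single i 1)).det := by
    intro v
    simp [Matrix.inv_def, Matrix.adjugate_apply]
  simp only [h1]
  refine ((contDiffAt_det h).inv hu).mul (contDiffAt_det fun k l => ?_)
  by_cases hk : k = j
  · subst hk
    simpa [Matrix.updateRow_self] using contDiffAt_const
  · simpa [Matrix.updateRow_ne hk] using h k l

theorem contDiffAt_symbolSq_cotParam (g : Metric n M)
    (he : e ∈ IsManifold.maximalAtlas (𝓡 n) ∞ M) {u : Phase n} (hu : u.1 ∈ e.target) :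
    ContDiffAt ℝ ∞ (fun v => symbolSq g (cotParam e v)) u := by
  have h1 : (fun v => symbolSq g (cotParam e v)) =ᶠ[𝓝 u]
      fun v => ∑ i, ∑ j, (gram g e (e.symm v.1))⁻¹ i j * comps v.2 i * comps v.2 j := by
    filter_upwards [(e.open_target.preimage continuous_fst).mem_nhds hu] with v hv
    rw [symbolSq_eq g he (z := cotParam e v) (e.map_target hv), cotCoord_cotParam he hv,
      invQuad_eq_sum]
    rfl
  refine ContDiffAt.congr_of_eventuallyEq ?_ h1
  have h2 : ∀ i j, ContDiffAt ℝ ∞ (fun v : Phase n => gram g e (e.symm v.1) i j) u := by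
    intro i j
    have h3 : ContMDiffAt (𝓡 n) 𝓘(ℝ, ℝ) ∞ (fun y => gram g e (e.symm y) i j) u.1 :=
      (contMDiffAt_gram g he (e.map_target hu) i j).comp u.1
        ((contMDiffOn_symm_of_mem_maximalAtlas he).contMDiffAt (e.open_target.mem_nhds hu))
    exact h3.contDiffAt.comp u contDiffAt_fst
  have h4 : ∀ i, ContDiffAt ℝ ∞ (fun v : Phase n => comps v.2 i) u := fun i =>
    contDiffAt_snd.clm_apply contDiffAt_const
  refine ContDiffAt.sum fun i _ => ContDiffAt.sum fun j _ => ((?_ : ContDiffAt _ _ _ _).mul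
    (h4 i)).mul (h4 j)
  exact contDiffAt_matrix_inv h2 (gram_posDef g he (e.map_target hu)).det_pos.ne' i j

end Gram
end Kuznecov

namespace Kuznecov

variable {n : ℕ} {M : Type*} [TopologicalSpace M] [ChartedSpace (Eucl n) M]
  [IsManifold (𝓡 n) ∞ M]

instance : AddCommGroup (Phase n →L[ℝ] ℝ) := ContinuousLinearMap.addCommGroup

instance : NormedAddCommGroup (Phase n →L[ℝ] ℝ) := ContinuousLinearMap.toNormedAddCommGroup

instance : NormedSpace ℝ (Phase n →L[ℝ] ℝ) := ContinuousLinearMap.toNormedSpace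

/-! ### Linear symplectic geometry of the phase space -/

/-- The symplectic form of the phase space. -/
def sympl (v w : Phase n) : ℝ := v.2 w.1 - w.2 v.1

/-- The Hamiltonian vector of a differential. -/
def sharp (D : Phase n →L[ℝ] ℝ) : Phase n :=
  (WithLp.toLp 2 fun j => D (0, dualCoord j), -(D.comp (ContinuousLinearMap.inl ℝ _ _)))

theorem covector_eq_sum (ξ : Eucl n →L[ℝ] ℝ) : ξ = ∑ i, comps ξ i • dualCoord i := by
  ext v
  conv_lhs => rw [eucl_eq_sum v, map_sum]
  simp only [map_smul, _root_.sum_apply, _root_.smul_apply, smul_eq_mul, comps, dualCoord]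
  exact Finset.sum_congr rfl fun i _ => by rw [mul_comm]; rfl

/-- As the form is nondegenerate, this pairing characterizes `sharp D` without coordinates; it is
the reason why Hamilton fields are natural under symplectic maps. -/
theorem sympl_sharp (D : Phase n →L[ℝ] ℝ) (w : Phase n) : sympl (sharp D) w = -D w := by
  have h1 : D w = D (w.1, 0) + D (0, w.2) := by rw [← map_add]; simp
  have h2 : D (0, w.2) = w.2 (sharp D).1 := by
    have : ((0, w.2) : Phase n) = ∑ i, comps w.2 i • ((0, dualCoord i) : Phase n) := by
      refine Prod.ext ?_ ?_
      · simp [Prod.fst_sum]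
      · conv_lhs => rw [covector_eq_sum w.2]
        simp [Prod.snd_sum]
    rw [this, map_sum, eucl_eq_sum (sharp D).1, map_sum]
    simp only [map_smul, smul_eq_mul, sharp, comps]
    exact Finset.sum_congr rfl fun i _ => mul_comm _ _
  have h3 : (sharp D).2 w.1 = -D (w.1, 0) := by simp [sharp]
  rw [sympl, h3, h1, h2]; ring

theorem apply_sharp_self (D : Phase n →L[ℝ] ℝ) : D (sharp D) = 0 := by
  have h := sympl_sharp D (sharp D)
  simp only [sympl, sub_self] at h
  linarith

theorem sympl_nondegenerate {v : Phase n} (h : ∀ w, sympl v w = 0) : v = 0 := by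
  have h1 : v.2 = 0 := by
    ext w
    simpa [sympl] using h (w, 0)
  have h2 : v.1 = 0 := by
    ext i
    have := h (0, dualCoord i)
    simpa [sympl, dualCoord] using this
  exact Prod.ext h2 h1

theorem sharp_add (D D' : Phase n →L[ℝ] ℝ) : sharp (D + D') = sharp D + sharp D' := by
  refine Prod.ext ?_ ?_
  · ext i; simp [sharp]
  · ext v; simp [sharp]; ring

theorem sharp_smul (c : ℝ) (D : Phase n →L[ℝ] ℝ) : sharp (c • D) = c • sharp D := by
  refine Prod.ext ?_ ?_
  · ext i; simp [sharp]
  · ext v; simp [sharp]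

/-- `sharp` as a continuous linear map. -/
def sharpL (n : ℕ) : (Phase n →L[ℝ] ℝ) →L[ℝ] Phase n :=
  LinearMap.toContinuousLinearMap
    { toFun := sharp, map_add' := sharp_add, map_smul' := sharp_smul }

theorem sharpL_apply (D : Phase n →L[ℝ] ℝ) : sharpL n D = sharp D := rfl

/-- A map that preserves a nondegenerate form is injective, hence surjective in finite dimension. So
it suffices to compare the pairings of both sides with vectors `S w`. -/
theorem map_sharp_comp {S : Phase n →L[ℝ] Phase n}
    (hS : ∀ v w, sympl (S v) (S w) = sympl v w) (D : Phase n →L[ℝ] ℝ) :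
    S (sharp (D.comp S)) = sharp D := by
  have hinj : Function.Injective S.toLinearMap := by
    rw [← LinearMap.ker_eq_bot, LinearMap.ker_eq_bot']
    intro v hv
    refine sympl_nondegenerate fun w => ?_
    have hv' : S v = 0 := hv
    rw [← hS, hv']
    simp [sympl]
  have hsurj := LinearMap.surjective_of_injective hinj
  rw [← sub_eq_zero]
  refine sympl_nondegenerate fun w => ?_
  obtain ⟨w, rfl⟩ := hsurj w
  have h1 : sympl (S (sharp (D.comp S))) (S w) = -D (S w) := by
    rw [hS, sympl_sharp]; rfl
  have h2 : sympl (sharp D) (S w) = -D (S w) := sympl_sharp D _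
  change sympl _ (S w) = 0
  simp only [sympl] at h1 h2 ⊢
  simp only [Prod.fst_sub, Prod.snd_sub, _root_.sub_apply, map_sub]
  linarith

/-- Write `(τ x, η)` for the image of `(x, ξ)`. Differentiating `η(Dτ a) = ξ(a)` expresses the
derivative of `η` through `D²τ`; the terms with `D²τ` cancel in the antisymmetric form because
second derivatives are symmetric. -/
theorem sympl_fderiv_cotTrans {τ : Eucl n → Eucl n} {s : Set (Eucl n)} (hs : IsOpen s)
    (hτ : ContDiffOn ℝ ∞ τ s) (hinv : ∀ x ∈ s, (fderiv ℝ τ x).IsInvertible) {u : Phase n}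
    (hu : u.1 ∈ s) (v w : Phase n) :
    sympl (fderiv ℝ (cotTrans τ) u v) (fderiv ℝ (cotTrans τ) u w) = sympl v w := by
  have hsm : ContDiffAt ℝ ∞ (cotTrans τ) u := (contDiffOn_cotTrans hs hτ hinv).contDiffAt
    ((hs.prod isOpen_univ).mem_nhds ⟨hu, mem_univ _⟩)
  have hd : DifferentiableAt ℝ (cotTrans τ) u := hsm.differentiableAt (by simp)
  have hτu : ContDiffAt ℝ ∞ τ u.1 := hτ.contDiffAt (hs.mem_nhds hu)
  have hdτ : DifferentiableAt ℝ τ u.1 := hτu.differentiableAt (by simp)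
  have hτ' : DifferentiableAt ℝ (fderiv ℝ τ) u.1 :=
    (hτu.fderiv_right (m := ∞) (by simp)).differentiableAt (by simp)
  have hsym : IsSymmSndFDerivAt ℝ τ u.1 := hτu.isSymmSndFDerivAt (by
    rw [minSmoothness_of_isRCLikeNormedField]; exact ENat.LEInfty.out)
  have h1 : ∀ v, (fderiv ℝ (cotTrans τ) u v).1 = fderiv ℝ τ u.1 v.1 := by
    intro v
    have h : HasFDerivAt (fun u => (cotTrans τ u).1)
        ((ContinuousLinearMap.fst ℝ _ _).comp (fderiv ℝ (cotTrans τ) u)) u :=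
      hd.hasFDerivAt.fst
    have h' : HasFDerivAt (fun u => (cotTrans τ u).1)
        ((fderiv ℝ τ u.1).comp (ContinuousLinearMap.fst ℝ _ _)) u :=
      hdτ.hasFDerivAt.comp u hasFDerivAt_fst
    exact congrArg (fun L => L v) (h.unique h')
  have h2 : ∀ v, ∀ a, (fderiv ℝ (cotTrans τ) u v).2 (fderiv ℝ τ u.1 a) +
      (cotTrans τ u).2 (fderiv ℝ (fderiv ℝ τ) u.1 v.1 a) = v.2 a := by
    intro v a
    have h : HasFDerivAt (fun u => (cotTrans τ u).2)
        ((ContinuousLinearMap.snd ℝ _ _).comp (fderiv ℝ (cotTrans τ) u)) u :=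
      hd.hasFDerivAt.snd
    have h3 : HasFDerivAt (fun u : Phase n => fderiv ℝ τ u.1)
      ((fderiv ℝ (fderiv ℝ τ) u.1).comp (ContinuousLinearMap.fst ℝ _ _)) u :=
      hτ'.hasFDerivAt.comp u hasFDerivAt_fst
    have h4 := h.clm_apply (h3.clm_apply (hasFDerivAt_const a u))
    have h5 : HasFDerivAt (fun u : Phase n => u.2 a)
        ((ContinuousLinearMap.apply ℝ ℝ a).comp (ContinuousLinearMap.snd ℝ _ _)) u :=
      (ContinuousLinearMap.apply ℝ ℝ a).hasFDerivAt.comp u hasFDerivAt_snd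
    have h6 : (fun u : Phase n => (cotTrans τ u).2 (fderiv ℝ τ u.1 a)) =ᶠ[𝓝 u]
        fun u : Phase n => u.2 a := by
      filter_upwards [(hs.preimage continuous_fst).mem_nhds hu] with y hy
      obtain ⟨A, hA⟩ := hinv y.1 hy
      simp only [cotTrans]
      rw [← hA, ContinuousLinearMap.inverse_equiv]
      simp
    have h7 := congrArg (fun L => L v) (h4.unique (h5.congr_of_eventuallyEq h6))
    simp at h7
    linarith
  have e1 := h2 v w.1
  have e2 := h2 w v.1
  have e3 : fderiv ℝ (fderiv ℝ τ) u.1 v.1 w.1 = fderiv ℝ (fderiv ℝ τ) u.1 w.1 v.1 := hsym v.1 w.1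
  simp only [sympl, h1]
  rw [e3] at e1
  linarith

theorem fderiv_cotTrans_sharp {τ : Eucl n → Eucl n} {s : Set (Eucl n)} (hs : IsOpen s)
    (hτ : ContDiffOn ℝ ∞ τ s) (hinv : ∀ x ∈ s, (fderiv ℝ τ x).IsInvertible) {u : Phase n}
    (hu : u.1 ∈ s) {p p' : Phase n → ℝ} (hp : DifferentiableAt ℝ p (cotTrans τ u))
    (h : p' =ᶠ[𝓝 u] p ∘ cotTrans τ) :
    fderiv ℝ (cotTrans τ) u (sharp (fderiv ℝ p' u)) = sharp (fderiv ℝ p (cotTrans τ u)) := by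
  have hsm : ContDiffAt ℝ ∞ (cotTrans τ) u := (contDiffOn_cotTrans hs hτ hinv).contDiffAt
    ((hs.prod isOpen_univ).mem_nhds ⟨hu, mem_univ _⟩)
  rw [h.fderiv_eq, fderiv_comp u hp (hsm.differentiableAt (by simp))]
  exact map_sharp_comp (sympl_fderiv_cotTrans hs hτ hinv hu) _

/-! ### The geodesic spray -/

/-- The Hamilton vector field of half the square of the symbol. -/
def spray (g : Metric n M) (z : Cotangent n M) : TangentSpace (cotModel n) z :=
  sharp (fderiv ℝ (fun u => symbolSq g ((extChartAt (cotModel n) z).symm u) / 2)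
    (extChartAt (cotModel n) z z))

variable (g : Metric n M)

theorem hamiltonField_eq_sharp (z : Cotangent n M) : hamiltonField g z =
    sharp (fderiv ℝ (fun u => symbol g ((extChartAt (cotModel n) z).symm u))
      (extChartAt (cotModel n) z z)) := rfl

theorem symbolSq_chart_eventuallyEq (z : Cotangent n M) :
    (fun u => symbolSq g ((extChartAt (cotModel n) z).symm u)) =ᶠ[𝓝 (extChartAt (cotModel n) z z)]
      fun u => symbolSq g (cotParam (chartAt (Eucl n) z.proj) u) := by
  filter_upwards [(isOpen_extChartAt_target z).mem_nhds (mem_extChartAt_target z)] with u hu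
  rw [extChartAt_cotangent_symm (mem_extChartAt_cotangent_target.1 hu)]

theorem contDiffAt_symbolSq_chart (z : Cotangent n M) :
    ContDiffAt ℝ ∞ (fun u => symbolSq g ((extChartAt (cotModel n) z).symm u))
      (extChartAt (cotModel n) z z) :=
  (contDiffAt_symbolSq_cotParam g (IsManifold.chart_mem_maximalAtlas _)
    (mem_extChartAt_cotangent_target.1 (mem_extChartAt_target z))).congr_of_eventuallyEq
    (symbolSq_chart_eventuallyEq g z)

/-- This is `d(p²/2) = p dp`. It lets a field that is smooth on all of `T^*M` stand in for `H_p`. -/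
theorem symbol_smul_hamiltonField (z : Cotangent n M) (hz : cov z ≠ 0) :
    symbol g z • hamiltonField g z = spray g z := by
  have h1 := (contDiffAt_symbolSq_chart g z).differentiableAt (by simp)
  have h0 : symbolSq g ((extChartAt (cotModel n) z).symm (extChartAt (cotModel n) z z)) ≠ 0 := by
    rw [extChartAt_to_inv]
    exact ((symbolSq_pos_iff g).2 hz).ne'
  have hs := (symbol_pos_iff g).2 hz
  have h2 := (h1.hasFDerivAt.sqrt h0).fderiv
  have h3 := (h1.hasFDerivAt.mul_const (1 / 2 : ℝ)).fderiv
  have h4 : (fun u => symbolSq g ((extChartAt (cotModel n) z).symm u) / 2) =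
      fun u => symbolSq g ((extChartAt (cotModel n) z).symm u) * (1 / 2) := by
    ext u; ring
  have h5 : (fun u => symbol g ((extChartAt (cotModel n) z).symm u)) =
      fun u => Real.sqrt (symbolSq g ((extChartAt (cotModel n) z).symm u)) := rfl
  rw [hamiltonField_eq_sharp, h5]
  unfold spray
  rw [h4, h3, h2]
  refine (sharp_smul _ _).symm.trans ?_
  congr 1
  rw [extChartAt_to_inv, smul_smul, ← symbol_eq_sqrt]
  congr 1
  field_simp

theorem hamiltonField_eq_spray {z : Cotangent n M} (hz : symbol g z = 1) :
    hamiltonField g z = spray g z := by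
  rw [← symbol_smul_hamiltonField g z ((symbol_pos_iff g).1 (by rw [hz]; norm_num)), hz, one_smul]

/-- The field at `z` is written in the chart belonging to `z`. Read in the trivialization at `z₀` it
is pushed forward by the derivative of a canonical transformation, and symplectic invariance turns
the result into the Hamiltonian vector computed in the single chart at `z₀`. -/
theorem contMDiff_spray :
    ContMDiff (cotModel n) (cotModel n).tangent 1
      (fun z => (⟨z, spray g z⟩ : TangentBundle (cotModel n) (Cotangent n M))) := by
  intro z₀
  set e := chartAt (Eucl n) z₀.proj with he_def
  have he := IsManifold.chart_mem_maximalAtlas (I := 𝓡 n) (n := ∞) z₀.proj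
  have hz₀ := mem_chart_source (Eucl n) z₀.proj
  have key : ContMDiffAt (cotModel n) 𝓘(ℝ, Phase n) 1 (fun z => sharpL n
      (fderiv ℝ (fun u => symbolSq g (cotParam e u) / 2) (cotCoord e z))) z₀ := by
    have h1 : ContDiffAt ℝ ∞ (fun u => symbolSq g (cotParam e u) / 2) (cotCoord e z₀) :=
      (contDiffAt_symbolSq_cotParam g he (e.map_source hz₀)).div_const 2
    have h2 : ContDiffAt ℝ 1 (fun v => sharpL n
        (fderiv ℝ (fun u => symbolSq g (cotParam e u) / 2) v)) (cotCoord e z₀) :=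
      (sharpL n).contDiff.contDiffAt.comp _ ((h1.fderiv_right (m := ∞) (by simp)).of_le (by simp))
    exact h2.contMDiffAt.comp z₀ ((contMDiffAt_cotCoord he hz₀).of_le (by simp))
  rw [contMDiffAt_section]
  refine key.congr_of_eventuallyEq ?_
  filter_upwards [(isOpen_proj_preimage e.open_source).mem_nhds hz₀] with z hz
  rw [TangentBundle.trivializationAt_apply]
  simp only [sharpL_apply]
  have he' := IsManifold.chart_mem_maximalAtlas (I := 𝓡 n) (n := ∞) z.proj
  have hz' := mem_chart_source (Eucl n) z.proj
  set τ := e ∘ (chartAt (Eucl n) z.proj).symm with hτ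
  have hmem : (extChartAt (cotModel n) z z).1 ∈ ((chartAt (Eucl n) z.proj).symm.trans e).source := by
    rw [extChartAt_cotangent hz']
    simp [cotCoord, hz]
  have hT : cotTrans τ (extChartAt (cotModel n) z z) = cotCoord e z := by
    rw [extChartAt_cotangent hz', cotCoord_eq_cotTrans he' he hz' hz]
  have hev : ∀ᶠ u in 𝓝 (extChartAt (cotModel n) z z),
      u.1 ∈ ((chartAt (Eucl n) z.proj).symm.trans e).source :=
    (((chartAt (Eucl n) z.proj).symm.trans e).open_source.preimage continuous_fst).mem_nhds hmem
  have hval : ∀ u : Phase n, u.1 ∈ ((chartAt (Eucl n) z.proj).symm.trans e).source →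
      cotCoord e (cotParam (chartAt (Eucl n) z.proj) u) = cotTrans τ u := by
    intro u hu
    have h := cotCoord_eq_cotTrans he' he (z := cotParam (chartAt (Eucl n) z.proj) u)
      ((chartAt (Eucl n) z.proj).map_target hu.1) hu.2
    rwa [cotCoord_cotParam he' hu.1] at h
  have h1 : fderivWithin ℝ ((chartAt (ModelProd (Eucl n) (Eucl n →L[ℝ] ℝ)) z₀).extend (cotModel n) ∘
      ((chartAt (ModelProd (Eucl n) (Eucl n →L[ℝ] ℝ)) z).extend (cotModel n)).symm)
      (range (cotModel n)) ((chartAt (ModelProd (Eucl n) (Eucl n →L[ℝ] ℝ)) z).extend (cotModel n) z)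
      = fderiv ℝ (cotTrans τ) (extChartAt (cotModel n) z z) := by
    rw [ModelWithCorners.range_eq_univ, fderivWithin_univ]
    refine Filter.EventuallyEq.fderiv_eq ?_
    filter_upwards [hev] with u hu
    change extChartAt (cotModel n) z₀ ((extChartAt (cotModel n) z).symm u) = _
    rw [extChartAt_cotangent_symm hu.1, extChartAt_cotangent (by exact hu.2), ← he_def, hval u hu]
  rw [h1]
  have hp : DifferentiableAt ℝ (fun u => symbolSq g (cotParam e u) / 2)
      (cotTrans τ (extChartAt (cotModel n) z z)) := by
    rw [hT]
    exact ((contDiffAt_symbolSq_cotParam g he (e.map_source hz)).div_const 2).differentiableAt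
      (by simp)
  have h2 := fderiv_cotTrans_sharp ((chartAt (Eucl n) z.proj).symm.trans e).open_source
    (contDiffOn_transition he' he) (fun x hx => by
      have h := isInvertible_fderiv_transition he' he
        ((chartAt (Eucl n) z.proj).map_target hx.1) hx.2
      rwa [(chartAt (Eucl n) z.proj).right_inv hx.1] at h) hmem hp
    (p' := fun u => symbolSq g ((extChartAt (cotModel n) z).symm u) / 2) (by
      filter_upwards [hev] with u hu
      rw [Function.comp_apply, extChartAt_cotangent_symm hu.1, ← hval u hu,
        cotParam_cotCoord he (by exact hu.2)])
  rw [hT] at h2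
  exact h2

end Kuznecov

namespace Kuznecov

/-! ### Flows of vector fields along compact invariant sets -/

section Flow

variable {E : Type*} [NormedAddCommGroup E] [NormedSpace ℝ E] [CompleteSpace E]
  {B : Type*} [TopologicalSpace B] {I : ModelWithCorners ℝ E B}
  {N : Type*} [TopologicalSpace N] [ChartedSpace B N] [IsManifold I 1 N]
  [BoundarylessManifold I N] {v : (x : N) → TangentSpace I x}

theorem hasMFDerivAt_curve_iff {γ : ℝ → N} {t : ℝ} {w : E} :
    HasMFDerivAt 𝓘(ℝ, ℝ) I γ t ((1 : ℝ →L[ℝ] ℝ).smulRight (w : TangentSpace I (γ t))) ↔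
      ContinuousAt γ t ∧ HasDerivAt (extChartAt I (γ t) ∘ γ) w t := by
  have h1 : HasFDerivAt (extChartAt I (γ t) ∘ γ)
      ((1 : ℝ →L[ℝ] ℝ).smulRight w) t ↔ HasDerivAt (extChartAt I (γ t) ∘ γ) w t := by
    rw [hasDerivAt_iff_hasFDerivAt]
    exact Iff.of_eq (congrArg (fun L => HasFDerivAt (extChartAt I (γ t) ∘ γ) L t)
      (by ext; simp))
  rw [← h1, ← hasFDerivWithinAt_univ]
  exact and_congr Iff.rfl (Iff.of_eq (by simp only [mfld_simps]; rfl))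

/-- Picard–Lindelöf in the chart at `x₀`, in the version with joint continuity in time and initial
value. This continuity is all that is required later about the dependence on the initial point. -/
theorem exists_continuousOn_local_flow {x₀ : N}
    (hv : ContMDiffAt I I.tangent 1 (fun x => (⟨x, v x⟩ : TangentBundle I N)) x₀) :
    ∃ U ∈ 𝓝 x₀, ∃ ε > (0 : ℝ), ∃ α : N → ℝ → N,
      (∀ x ∈ U, α x 0 = x ∧ IsMIntegralCurveOn (α x) v (Ioo (-ε) ε)) ∧
      ContinuousOn (fun p : ℝ × N => α p.2 p.1) (Ioo (-ε) ε ×ˢ U) := by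
  have hx₀ : I.IsInteriorPoint x₀ := BoundarylessManifold.isInteriorPoint
  rw [contMDiffAt_iff] at hv
  obtain ⟨_, hv⟩ := hv
  obtain ⟨ε, hε, a, r, L, K, hr, hpl⟩ := IsPicardLindelof.of_contDiffAt_one
    (hv.contDiffAt (range_mem_nhds_isInteriorPoint hx₀)).snd
  obtain ⟨β, hβ, hβc⟩ :=
    (hpl 0).exists_forall_mem_closedBall_eq_hasDerivWithinAt_continuousOn
  simp only [zero_sub, zero_add] at hβ hβc
  set y₀ := extChartAt I x₀ x₀ with hy₀
  have hr' : (0 : ℝ) < r := hr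
  have hmem : (y₀, (0 : ℝ)) ∈ Metric.ball y₀ r ×ˢ Ioo (-ε) ε :=
    ⟨Metric.mem_ball_self hr', by constructor <;> linarith⟩
  have hopen : IsOpen (Metric.ball y₀ r ×ˢ Ioo (-ε) ε) := Metric.isOpen_ball.prod isOpen_Ioo
  have hsub : Metric.ball y₀ r ×ˢ Ioo (-ε) ε ⊆ Metric.closedBall y₀ r ×ˢ Icc (-ε) ε :=
    prod_mono Metric.ball_subset_closedBall Ioo_subset_Icc_self
  have hca : ContinuousAt β (y₀, 0) := (hβc.mono hsub).continuousAt (hopen.mem_nhds hmem)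
  have h0 : β (y₀, 0) = y₀ := (hβ y₀ (Metric.mem_closedBall_self hr'.le)).1
  have htgt : β ⁻¹' (interior (extChartAt I x₀).target) ∈ 𝓝 (y₀, (0 : ℝ)) := by
    apply hca
    rw [h0]
    exact isOpen_interior.mem_nhds ((I.isInteriorPoint_iff).mp hx₀)
  obtain ⟨V, hV, T, hT, hVT⟩ := mem_nhds_prod_iff.1 (inter_mem htgt (hopen.mem_nhds hmem))
  obtain ⟨δ, hδ, hδT⟩ := Metric.mem_nhds_iff.1 hT
  rw [Real.ball_eq_Ioo, zero_sub, zero_add] at hδT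
  have hU : (extChartAt I x₀).source ∩ extChartAt I x₀ ⁻¹' V ∈ 𝓝 x₀ :=
    inter_mem (extChartAt_source_mem_nhds x₀) ((continuousAt_extChartAt x₀).preimage_mem_nhds hV)
  refine ⟨_, hU, δ, hδ, fun x t => (extChartAt I x₀).symm (β (extChartAt I x₀ x, t)),
    fun x hx => ⟨?_, ?_⟩, ?_⟩
  · have h1 : (extChartAt I x₀ x, (0 : ℝ)) ∈ V ×ˢ T := ⟨hx.2, mem_of_mem_nhds hT⟩
    have h2 := (hsub (hVT h1).2).1
    simp only
    rw [(hβ _ h2).1, (extChartAt I x₀).left_inv hx.1]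
  · intro t ht
    have h1 : (extChartAt I x₀ x, t) ∈ V ×ˢ T := ⟨hx.2, hδT ht⟩
    have h2 := (hVT h1).2
    set f : ℝ → E := fun s => β (extChartAt I x₀ x, s) with hf
    have hder := ((hβ _ (hsub h2).1).2 t (hsub h2).2).hasDerivAt (Icc_mem_nhds h2.2.1 h2.2.2)
    let xₜ : N := (extChartAt I x₀).symm (f t)
    obtain ⟨w, hw⟩ : ∃ w : E, w = v xₜ := ⟨_, rfl⟩
    have h : HasDerivAt f (x := t) (tangentCoordChange I xₜ x₀ xₜ w) := by
      rw [hw, tangentCoordChange_def]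
      exact hder
    have hf3 : f t ∈ interior (extChartAt I x₀).target := (hVT h1).1
    have hf3' := mem_of_mem_of_subset hf3 interior_subset
    have hft1 := mem_preimage.mp <|
      mem_of_mem_of_subset hf3' (extChartAt I x₀).target_subset_preimage_source
    have hft2 := mem_extChartAt_source (I := I) xₜ
    apply HasMFDerivAt.hasMFDerivWithinAt
    refine hasMFDerivAt_curve_iff.2 ⟨(continuousAt_extChartAt_symm'' hf3').comp h.continuousAt, ?_⟩
    change HasDerivAt ((extChartAt I xₜ ∘ (extChartAt I x₀).symm) ∘ f) (v xₜ : E) t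
    rw [← hw, ← tangentCoordChange_self (I := I) (x := xₜ) (z := xₜ) (v := w) hft2,
      ← tangentCoordChange_comp (x := x₀) ⟨⟨hft2, hft1⟩, hft2⟩]
    apply HasFDerivAt.comp_hasDerivAt _ _ h
    apply HasFDerivWithinAt.hasFDerivAt (s := range I) _ <|
      mem_nhds_iff.mpr ⟨interior (extChartAt I x₀).target,
        subset_trans interior_subset (extChartAt_target_subset_range ..),
        isOpen_interior, hf3⟩
    rw [← (extChartAt I x₀).right_inv hf3']
    exact hasFDerivWithinAt_tangentCoordChange ⟨hft1, hft2⟩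
  · rintro ⟨t, x⟩ ⟨ht, hx⟩
    have h1 : (extChartAt I x₀ x, t) ∈ V ×ˢ T := ⟨hx.2, hδT ht⟩
    have hf3 : β (extChartAt I x₀ x, t) ∈ interior (extChartAt I x₀).target := (hVT h1).1
    have h3 : ContinuousAt β (extChartAt I x₀ x, t) :=
      (hβc.mono hsub).continuousAt (hopen.mem_nhds (hVT h1).2)
    have h4 : ContinuousAt (fun p : ℝ × N => (extChartAt I x₀ p.2, p.1)) (t, x) :=
      ((continuousAt_extChartAt' hx.1).comp continuousAt_snd).prodMk continuousAt_fst
    have h5 : ContinuousAt (fun p : ℝ × N => β (extChartAt I x₀ p.2, p.1)) (t, x) :=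
      ContinuousAt.comp (f := fun p : ℝ × N => (extChartAt I x₀ p.2, p.1)) (g := β) h3 h4
    exact (ContinuousAt.comp (f := fun p : ℝ × N => β (extChartAt I x₀ p.2, p.1))
      (continuousAt_extChartAt_symm'' (interior_subset hf3)) h5).continuousWithinAt

variable [T2Space N] {K : Set N}

/-- Integral curves that start in `K` stay in `K`. -/
def IsInvariantUnder (v : (x : N) → TangentSpace I x) (K : Set N) : Prop :=
  ∀ (γ : ℝ → N) (a : ℝ), 0 < a → γ 0 ∈ K → IsMIntegralCurveOn γ v (Ioo (-a) a) →
    ∀ t ∈ Ioo (-a) a, γ t ∈ K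

/-- Finitely many local flows cover a compact set and have a common life span. Where their domains
overlap they agree by uniqueness of integral curves, so they glue. -/
theorem exists_uniform_local_flow
    (hv : ContMDiff I I.tangent 1 (fun x => (⟨x, v x⟩ : TangentBundle I N)))
    (hK : IsCompact K) :
    ∃ ε > (0 : ℝ), ∃ α : N → ℝ → N,
      (∀ x ∈ K, α x 0 = x ∧ IsMIntegralCurveOn (α x) v (Ioo (-ε) ε)) ∧
      ContinuousOn (fun p : ℝ × N => α p.2 p.1) (Ioo (-ε) ε ×ˢ K) := by
  -- The open neighborhood `U` is part of the induction property because joint continuity can be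
  -- glued over a union of open sets, but not over a union of arbitrary ones.
  let P : Set N → Prop := fun s => ∃ ε > (0 : ℝ), ∃ U, IsOpen U ∧ s ⊆ U ∧ ∃ α : N → ℝ → N,
      (∀ x ∈ U, α x 0 = x ∧ IsMIntegralCurveOn (α x) v (Ioo (-ε) ε)) ∧
      ContinuousOn (fun p : ℝ × N => α p.2 p.1) (Ioo (-ε) ε ×ˢ U)
  have hP : P K := by
    refine hK.induction_on (p := P) ?_ ?_ ?_ ?_
    · exact ⟨1, one_pos, ∅, isOpen_empty, subset_rfl, fun x _ => x, by simp, by simp⟩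
    · rintro s t hst ⟨ε, hε, U, hU, htU, h⟩
      exact ⟨ε, hε, U, hU, hst.trans htU, h⟩
    · rintro s t ⟨ε, hε, U, hU, hsU, α, hα, hαc⟩ ⟨δ, hδ, V, hV, htV, β, hβ, hβc⟩
      have hm : 0 < min ε δ := lt_min hε hδ
      have h1 : Ioo (-min ε δ) (min ε δ) ⊆ Ioo (-ε) ε :=
        Ioo_subset_Ioo (neg_le_neg (min_le_left _ _)) (min_le_left _ _)
      have h2 : Ioo (-min ε δ) (min ε δ) ⊆ Ioo (-δ) δ :=
        Ioo_subset_Ioo (neg_le_neg (min_le_right _ _)) (min_le_right _ _)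
      classical
      have heq : ∀ x ∈ U, x ∈ V → EqOn (α x) (β x) (Ioo (-min ε δ) (min ε δ)) := by
        intro x hx hx'
        refine isMIntegralCurveOn_Ioo_eqOn_of_contMDiff_boundaryless (t₀ := 0)
          ⟨by linarith, hm⟩ hv ((hα x hx).2.mono h1) ((hβ x hx').2.mono h2) ?_
        rw [(hα x hx).1, (hβ x hx').1]
      refine ⟨min ε δ, hm, U ∪ V, hU.union hV, union_subset_union hsU htV,
        fun x => if x ∈ U then α x else β x, ?_, ?_⟩
      · intro x hx
        by_cases hxU : x ∈ U
        · simp only [hxU, if_true]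
          exact ⟨(hα x hxU).1, (hα x hxU).2.mono h1⟩
        · simp only [hxU, if_false]
          have hxV := hx.resolve_left hxU
          exact ⟨(hβ x hxV).1, (hβ x hxV).2.mono h2⟩
      · rintro ⟨t, x⟩ ⟨ht, hx⟩
        by_cases hxU : x ∈ U
        · have h3 : ContinuousAt (fun p : ℝ × N => α p.2 p.1) (t, x) :=
            hαc.continuousAt ((isOpen_Ioo.prod hU).mem_nhds ⟨h1 ht, hxU⟩)
          refine (h3.congr ?_).continuousWithinAt
          filter_upwards [(isOpen_Ioo.prod hU).mem_nhds ⟨h1 ht, hxU⟩] with p hp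
          simp [hp.2]
        · have hxV := hx.resolve_left hxU
          have h3 : ContinuousAt (fun p : ℝ × N => β p.2 p.1) (t, x) :=
            hβc.continuousAt ((isOpen_Ioo.prod hV).mem_nhds ⟨h2 ht, hxV⟩)
          refine (h3.congr ?_).continuousWithinAt
          filter_upwards [(isOpen_Ioo.prod hV).mem_nhds ⟨ht, hxV⟩] with p hp
          by_cases hpU : p.2 ∈ U
          · simp only [hpU, if_true]
            exact (heq p.2 hpU hp.2 hp.1).symm
          · simp [hpU]
    · intro x _
      obtain ⟨U, hU, ε, hε, α, h1, h2⟩ := exists_continuousOn_local_flow (hv.contMDiffAt (x := x))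
      obtain ⟨U', hU'U, hU', hx⟩ := mem_nhds_iff.1 hU
      exact ⟨U', mem_nhdsWithin_of_mem_nhds (hU'.mem_nhds hx), ε, hε, U', hU', subset_rfl, α,
        fun x hx => h1 x (hU'U hx), h2.mono (prod_mono subset_rfl hU'U)⟩
  obtain ⟨ε, hε, U, -, hKU, α, h1, h2⟩ := hP
  exact ⟨ε, hε, α, fun x hx => h1 x (hKU hx), h2.mono (prod_mono subset_rfl hKU)⟩

/-- A curve on `(-a, a)` stays in `K`, so it can be restarted at distance `ε/2` from either end,
where the uniform life span `ε` prolongs it by `ε/2`. Iterating reaches every time. -/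
theorem exists_isMIntegralCurve_of_isCompact
    (hv : ContMDiff I I.tangent 1 (fun x => (⟨x, v x⟩ : TangentBundle I N)))
    (hK : IsCompact K) (hinv : IsInvariantUnder v K) {x : N} (hx : x ∈ K) :
    ∃ γ : ℝ → N, γ 0 = x ∧ IsMIntegralCurve γ v := by
  obtain ⟨ε, hε, α, hα, -⟩ := exists_uniform_local_flow hv hK
  have key : ∀ m : ℕ, ∃ γ : ℝ → N, γ 0 = x ∧
      IsMIntegralCurveOn γ v (Ioo (-((m + 2) * (ε / 2))) ((m + 2) * (ε / 2))) := by
    intro m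
    induction m with
    | zero =>
      refine ⟨α x, (hα x hx).1, ?_⟩
      have : ((0 : ℕ) + 2 : ℝ) * (ε / 2) = ε := by push_cast; ring
      rw [this]
      exact (hα x hx).2
    | succ m ih =>
      obtain ⟨γ, h0, hγ⟩ := ih
      set a := (m + 2 : ℝ) * (ε / 2) with ha
      have hεa : ε ≤ a := by rw [ha]; nlinarith [(Nat.cast_nonneg m : (0 : ℝ) ≤ m)]
      have ha' : ((m + 1 : ℕ) + 2 : ℝ) * (ε / 2) = a + ε / 2 := by rw [ha]; push_cast; ring
      rw [ha']
      have hmem : ∀ t ∈ Ioo (-a) a, γ t ∈ K :=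
        hinv γ a (by linarith) (by rw [h0]; exact hx) hγ
      obtain ⟨e1, hγ1⟩ := hα (γ (-(a - ε / 2))) (hmem _ ⟨by linarith, by linarith⟩)
      obtain ⟨e2, hγ2⟩ := hα (γ (a - ε / 2)) (hmem _ ⟨by linarith, by linarith⟩)
      rw [← isMIntegralCurveOn_comp_add (dt := a - ε / 2)] at hγ1
      rw [← isMIntegralCurveOn_comp_sub (dt := a - ε / 2)] at hγ2
      simp_rw [Set.mem_Ioo, ← sub_lt_iff_lt_add, ← lt_sub_iff_add_lt, ← Set.mem_Ioo] at hγ1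
      simp_rw [Set.mem_Ioo, lt_sub_iff_add_lt, sub_lt_iff_lt_add, ← Set.mem_Ioo] at hγ2
      have p1 := isMIntegralCurveOn_piecewise (t₀ := -(a - ε / 2)) hv hγ hγ1
        ⟨⟨by linarith, by linarith⟩, ⟨by linarith, by linarith⟩⟩ (by rw [Function.comp_apply, neg_add_cancel, e1])
      have p1' := p1.mono (s' := Ioo (-(a + ε / 2)) a) (by
        intro t ht
        by_cases h : -a < t
        · exact Or.inl ⟨h, ht.2⟩
        · exact Or.inr ⟨by linarith [ht.1], by linarith⟩)
      have p2 := isMIntegralCurveOn_piecewise (t₀ := a - ε / 2) hv p1' hγ2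
        ⟨⟨by linarith, by linarith⟩, ⟨by linarith, by linarith⟩⟩ (by
          rw [piecewise, if_pos ⟨by linarith, by linarith⟩]; simp [e2])
      refine ⟨_, ?_, p2.mono ?_⟩
      · rw [piecewise, if_pos ⟨by linarith, by linarith⟩, piecewise,
          if_pos ⟨by linarith, by linarith⟩, h0]
      · intro t ht
        by_cases h : t < a
        · exact Or.inl ⟨ht.1, h⟩
        · exact Or.inr ⟨by linarith, by linarith [ht.2]⟩
  rw [exists_isMIntegralCurve_iff_exists_isMIntegralCurveOn_Ioo hv]
  intro a
  obtain ⟨m, hm⟩ := exists_nat_ge (a / (ε / 2))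
  obtain ⟨γ, h0, hγ⟩ := key m
  have : a ≤ (m + 2) * (ε / 2) := by
    rw [div_le_iff₀ (by positivity)] at hm
    nlinarith
  exact ⟨γ, h0, hγ.mono (Ioo_subset_Ioo (by linarith) this)⟩

/-- For short times the flow coincides with the continuous local flow; the group law propagates
continuity to all times. -/
theorem continuousOn_flow_of_isCompact
    (hv : ContMDiff I I.tangent 1 (fun x => (⟨x, v x⟩ : TangentBundle I N)))
    (hK : IsCompact K) {Φ : ℝ → N → N} (h0 : ∀ x ∈ K, Φ 0 x = x)
    (hΦ : ∀ x ∈ K, IsMIntegralCurve (fun t => Φ t x) v) (hΦK : ∀ x ∈ K, ∀ t, Φ t x ∈ K) :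
    ContinuousOn (fun p : ℝ × N => Φ p.1 p.2) (univ ×ˢ K) := by
  have hgroup : ∀ x ∈ K, ∀ s t, Φ (s + t) x = Φ t (Φ s x) := by
    intro x hx s t
    have h1 : IsMIntegralCurve ((fun t => Φ t x) ∘ (· + s)) v := (hΦ x hx).comp_add s
    have h2 := isMIntegralCurve_Ioo_eq_of_contMDiff_boundaryless (t₀ := 0) hv h1
      (hΦ _ (hΦK x hx s)) (by simp [h0 _ (hΦK x hx s)])
    have := congrFun h2 t
    simpa [add_comm] using this
  obtain ⟨ε, hε, α, hα, hαc⟩ := exists_uniform_local_flow hv hK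
  have hbase : ContinuousOn (fun p : ℝ × N => Φ p.1 p.2) (Ioo (-ε) ε ×ˢ K) := by
    refine hαc.congr ?_
    rintro ⟨t, x⟩ ⟨ht, hx⟩
    refine isMIntegralCurveOn_Ioo_eqOn_of_contMDiff_boundaryless (t₀ := 0)
      ⟨by linarith, hε⟩ hv ((hΦ x hx).isMIntegralCurveOn _) (hα x hx).2 ?_ ht
    simp only [h0 x hx, (hα x hx).1]
  have key : ∀ m : ℕ, ContinuousOn (fun p : ℝ × N => Φ p.1 p.2)
      (Ioo (-((m + 1) * ε)) ((m + 1) * ε) ×ˢ K) := by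
    intro m
    induction m with
    | zero => simpa using hbase
    | succ m ih =>
      have hm : (0 : ℝ) < m + 1 := by positivity
      have hm2 : (0 : ℝ) < m + 1 + 1 := by positivity
      -- Time `t` is split in the proportion `m + 1` to `1`: the longer piece falls under the
      -- induction hypothesis and the shorter one has length below `ε`.
      have h1 : ContinuousOn (fun p : ℝ × N => (p.1 / (m + 1 + 1), Φ (p.1 * (m + 1) / (m + 1 + 1)) p.2))
          (Ioo (-(((m + 1 : ℕ) + 1) * ε)) (((m + 1 : ℕ) + 1) * ε) ×ˢ K) := by
        refine ContinuousOn.prodMk (by fun_prop) ?_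
        refine ih.comp (f := fun p : ℝ × N => (p.1 * (m + 1) / (m + 1 + 1), p.2)) (by fun_prop) ?_
        rintro ⟨t, x⟩ ⟨ht, hx⟩
        refine ⟨⟨?_, ?_⟩, hx⟩
        · have := ht.1
          push_cast at this
          simp only
          rw [lt_div_iff₀ hm2]
          nlinarith
        · have := ht.2
          push_cast at this
          simp only
          rw [div_lt_iff₀ hm2]
          nlinarith
      refine (hbase.comp h1 ?_).congr ?_
      · rintro ⟨t, x⟩ ⟨ht, hx⟩
        refine ⟨⟨?_, ?_⟩, hΦK x hx _⟩
        · have := ht.1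
          push_cast at this
          simp only
          rw [lt_div_iff₀ hm2]
          linarith
        · have := ht.2
          push_cast at this
          simp only
          rw [div_lt_iff₀ hm2]
          linarith
      · rintro ⟨t, x⟩ ⟨ht, hx⟩
        simp only [Function.comp_apply]
        rw [← hgroup x hx]
        congr 1
        field_simp
  rintro ⟨t, x⟩ ⟨-, hx⟩
  obtain ⟨m, hm⟩ := exists_nat_gt (|t| / ε)
  rw [div_lt_iff₀ hε] at hm
  have ht : t ∈ Ioo (-((m + 1) * ε)) ((m + 1) * ε) := by
    rw [mem_Ioo, ← abs_lt]
    linarith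
  refine (key m (t, x) ⟨ht, hx⟩).mono_of_mem_nhdsWithin ?_
  rw [nhdsWithin_prod_eq, nhdsWithin_univ]
  exact prod_mem_prod (isOpen_Ioo.mem_nhds ht) self_mem_nhdsWithin

end Flow

end Kuznecov

/-! ### Conservation, homogeneity and compact level sets of the symbol -/

namespace Kuznecov

variable {n : ℕ} {M : Type*} [TopologicalSpace M] [ChartedSpace (Eucl n) M]
  [IsManifold (𝓡 n) ∞ M]

variable (g : Metric n M)

/-! ### Conservation of the symbol -/

/-- Off the zero section the field is proportional to `sharp D`, and `D (sharp D) = 0` by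
antisymmetry. The zero section is included because an integral curve is not yet known to avoid it;
there the derivative of `symbolSq` vanishes at a minimum, whatever value `hamiltonField` takes. -/
theorem fderiv_symbolSq_hamiltonField (z : Cotangent n M) :
    fderiv ℝ (fun u => symbolSq g ((extChartAt (cotModel n) z).symm u))
      (extChartAt (cotModel n) z z) (hamiltonField g z : Phase n) = 0 := by
  by_cases hz : cov z = 0
  · have h0 : symbolSq g z = 0 :=
      le_antisymm (not_lt.1 fun h => (symbolSq_pos_iff g).1 h hz) (symbolSq_nonneg g z)
    have h1 : IsLocalMin (fun u => symbolSq g ((extChartAt (cotModel n) z).symm u))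
        (extChartAt (cotModel n) z z) := by
      refine Filter.Eventually.of_forall fun u => ?_
      simp only
      rw [extChartAt_to_inv, h0]
      exact symbolSq_nonneg g _
    rw [h1.fderiv_eq_zero]
    rfl
  · have hs := (symbol_pos_iff g).2 hz
    have h1 := (contDiffAt_symbolSq_chart g z).differentiableAt (by simp)
    have h2 : (fderiv ℝ (fun u => symbolSq g ((extChartAt (cotModel n) z).symm u) / 2)
        (extChartAt (cotModel n) z z)) = (1 / 2 : ℝ) •
        fderiv ℝ (fun u => symbolSq g ((extChartAt (cotModel n) z).symm u))
          (extChartAt (cotModel n) z z) := by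
      have h4 : (fun u => symbolSq g ((extChartAt (cotModel n) z).symm u) / 2) =
          fun u => symbolSq g ((extChartAt (cotModel n) z).symm u) * (1 / 2) := by
        ext u; ring
      rw [h4]
      exact (h1.hasFDerivAt.mul_const (1 / 2 : ℝ)).fderiv
    set D := fderiv ℝ (fun u => symbolSq g ((extChartAt (cotModel n) z).symm u))
      (extChartAt (cotModel n) z z)
    have h3 : symbol g z • (hamiltonField g z : Phase n) = (1 / 2 : ℝ) • sharp D := by
      rw [← sharp_smul, ← h2]
      exact symbol_smul_hamiltonField g z hz
    have h5 : ∀ w : Phase n, symbol g z • w = (1 / 2 : ℝ) • sharp D → D w = 0 := by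
      intro w hw
      have h6 : symbol g z • D w = 0 := by
        rw [← map_smul, hw, map_smul, apply_sharp_self, smul_zero]
      exact (smul_eq_zero.1 h6).resolve_left hs.ne'
    exact h5 _ h3

theorem fderiv_symbolSq_spray (z : Cotangent n M) :
    fderiv ℝ (fun u => symbolSq g ((extChartAt (cotModel n) z).symm u))
      (extChartAt (cotModel n) z z) (spray g z : Phase n) = 0 := by
  by_cases hz : cov z = 0
  · have h0 : symbolSq g z = 0 :=
      le_antisymm (not_lt.1 fun h => (symbolSq_pos_iff g).1 h hz) (symbolSq_nonneg g z)
    have h1 : IsLocalMin (fun u => symbolSq g ((extChartAt (cotModel n) z).symm u))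
        (extChartAt (cotModel n) z z) := by
      refine Filter.Eventually.of_forall fun u => ?_
      simp only
      rw [extChartAt_to_inv, h0]
      exact symbolSq_nonneg g _
    rw [h1.fderiv_eq_zero]
    rfl
  · rw [← symbol_smul_hamiltonField g z hz]
    refine ((fderiv ℝ (fun u => symbolSq g ((extChartAt (cotModel n) z).symm u))
      (extChartAt (cotModel n) z z)).map_smul _ _).trans ?_
    rw [fderiv_symbolSq_hamiltonField, smul_zero]

theorem hasDerivAt_symbolSq_comp {γ : ℝ → Cotangent n M} {t : ℝ} {w : Phase n}
    (hγ : HasMFDerivAt 𝓘(ℝ, ℝ) (cotModel n) γ t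
      ((1 : ℝ →L[ℝ] ℝ).smulRight (w : TangentSpace (cotModel n) (γ t)))) :
    HasDerivAt (fun s => symbolSq g (γ s))
      (fderiv ℝ (fun u => symbolSq g ((extChartAt (cotModel n) (γ t)).symm u))
        (extChartAt (cotModel n) (γ t) (γ t)) w) t := by
  obtain ⟨hc, hd⟩ := hasMFDerivAt_curve_iff.1 hγ
  have h1 := ((contDiffAt_symbolSq_chart g (γ t)).differentiableAt (by simp)).hasFDerivAt
  have h2 := HasFDerivAt.comp_hasDerivAt (f := extChartAt (cotModel n) (γ t) ∘ γ) t h1 hd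
  refine h2.congr_of_eventuallyEq ?_
  filter_upwards [hc.preimage_mem_nhds (extChartAt_source_mem_nhds (I := cotModel n) (γ t))]
    with s hs
  simp only [Function.comp_apply]
  rw [(extChartAt (cotModel n) (γ t)).left_inv hs]

theorem symbolSq_eq_of_isMIntegralCurve {γ : ℝ → Cotangent n M}
    (hγ : IsMIntegralCurve γ (hamiltonField g)) (t : ℝ) : symbolSq g (γ t) = symbolSq g (γ 0) := by
  have h : ∀ s, HasDerivAt (fun s => symbolSq g (γ s)) 0 s := by
    intro s
    have h1 := hasDerivAt_symbolSq_comp g (w := hamiltonField g (γ s)) (hγ s)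
    rwa [fderiv_symbolSq_hamiltonField] at h1
  exact is_const_of_deriv_eq_zero (fun s => (h s).differentiableAt) (fun s => (h s).deriv) t 0

theorem symbolSq_eq_of_isMIntegralCurveOn {γ : ℝ → Cotangent n M} {a : ℝ} (ha : 0 < a)
    (hγ : IsMIntegralCurveOn γ (spray g) (Ioo (-a) a)) {t : ℝ} (ht : t ∈ Ioo (-a) a) :
    symbolSq g (γ t) = symbolSq g (γ 0) := by
  have h : ∀ s ∈ Ioo (-a) a, HasDerivAt (fun s => symbolSq g (γ s)) 0 s := by
    intro s hs
    have h1 := hasDerivAt_symbolSq_comp g (w := spray g (γ s))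
      ((hγ s hs).hasMFDerivAt (Ioo_mem_nhds hs.1 hs.2))
    rwa [fderiv_symbolSq_spray] at h1
  exact isOpen_Ioo.is_const_of_deriv_eq_zero isPreconnected_Ioo
    (fun s hs => (h s hs).differentiableAt.differentiableWithinAt)
    (fun s hs => (h s hs).deriv) ht ⟨by linarith, ha⟩

/-! ### Dilations of the fibers -/

/-- The dilation `(x, ξ) ↦ (x, r ξ)`. -/
def dil (r : ℝ) (z : Cotangent n M) : Cotangent n M := mkCov z.proj (r • cov z)

/-- The dilation of the phase space. -/
def dilL (n : ℕ) (r : ℝ) : Phase n →L[ℝ] Phase n :=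
  (ContinuousLinearMap.fst ℝ _ _).prod (r • ContinuousLinearMap.snd ℝ _ _)

@[simp] theorem dilL_apply (r : ℝ) (u : Phase n) : dilL n r u = (u.1, r • u.2) := rfl

@[simp] theorem proj_dil (r : ℝ) (z : Cotangent n M) : (dil r z).proj = z.proj := rfl

@[simp] theorem cov_dil (r : ℝ) (z : Cotangent n M) : cov (dil r z) = r • cov z := rfl

theorem dil_dil (r s : ℝ) (z : Cotangent n M) : dil r (dil s z) = dil (r * s) z := by
  simp [dil, mul_smul]

theorem dil_one (z : Cotangent n M) : dil 1 z = z := by simp [dil]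

theorem normalize_eq_dil (z : Cotangent n M) : normalize g z = dil (symbol g z)⁻¹ z := rfl

theorem cotCoord_dil (e : OpenPartialHomeomorph M (Eucl n)) (r : ℝ) (z : Cotangent n M) :
    cotCoord e (dil r z) = dilL n r (cotCoord e z) := by
  refine Prod.ext rfl ?_
  ext v
  simp [cotCoord]

theorem cotParam_dilL (e : OpenPartialHomeomorph M (Eucl n)) (r : ℝ) (u : Phase n) :
    cotParam e (dilL n r u) = dil r (cotParam e u) := by
  unfold cotParam dil
  simp only [dilL_apply, cov_mkCov, proj_mkCov]
  congr 1

theorem symbolSq_dil (r : ℝ) (z : Cotangent n M) : symbolSq g (dil r z) = r ^ 2 * symbolSq g z := by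
  have h : ∀ v, (dil r z).2 v = r * z.2 v := fun v => rfl
  simp only [symbolSq, Finset.mul_sum]
  refine Finset.sum_congr rfl fun i _ => Finset.sum_congr rfl fun j _ => ?_
  rw [h, h]
  simp only [proj_dil]
  ring

theorem symbol_dil {r : ℝ} (hr : 0 ≤ r) (z : Cotangent n M) :
    symbol g (dil r z) = r * symbol g z := by
  rw [symbol_eq_sqrt, symbolSq_dil, Real.sqrt_mul (sq_nonneg r), Real.sqrt_sq hr, symbol_eq_sqrt]

theorem symbol_normalize {z : Cotangent n M} (hz : cov z ≠ 0) : symbol g (normalize g z) = 1 := by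
  have h := (symbol_pos_iff g).2 hz
  rw [normalize_eq_dil, symbol_dil g (inv_nonneg.2 h.le), inv_mul_cancel₀ h.ne']

theorem dil_symbol_normalize {z : Cotangent n M} (hz : cov z ≠ 0) :
    dil (symbol g z) (normalize g z) = z := by
  rw [normalize_eq_dil, dil_dil, mul_inv_cancel₀ ((symbol_pos_iff g).2 hz).ne', dil_one]

theorem continuous_dil : Continuous (fun p : ℝ × Cotangent n M => dil p.1 p.2) := by
  rw [continuous_iff_continuousAt]
  rintro ⟨r, z⟩
  have he := IsManifold.chart_mem_maximalAtlas (I := 𝓡 n) (n := ∞) z.proj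
  have hz := mem_chart_source (Eucl n) z.proj
  set e := chartAt (Eucl n) z.proj
  have h1 : ContinuousAt (fun p : ℝ × Cotangent n M => dilL n p.1 (cotCoord e p.2)) (r, z) := by
    have h2 : ContinuousAt (fun p : ℝ × Cotangent n M => cotCoord e p.2) (r, z) :=
      ContinuousAt.comp (f := fun p : ℝ × Cotangent n M => p.2) (g := cotCoord e) (contMDiffAt_cotCoord he hz).continuousAt continuousAt_snd
    exact h2.fst.prodMk (continuousAt_fst.smul h2.snd)
  have h3 : ContinuousAt (cotParam e) (dilL n r (cotCoord e z)) :=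
    (contMDiffAt_cotParam he (e.map_source hz)).continuousAt
  have h4 : ContinuousAt (fun p : ℝ × Cotangent n M => cotParam e (dilL n p.1 (cotCoord e p.2)))
    (r, z) := ContinuousAt.comp (g := cotParam e)
      (f := fun p : ℝ × Cotangent n M => dilL n p.1 (cotCoord e p.2)) h3 h1
  refine h4.congr ?_
  filter_upwards [((isOpen_proj_preimage e.open_source).preimage continuous_snd).mem_nhds hz]
    with p hp
  rw [cotParam_dilL, cotParam_cotCoord he hp]

theorem extChartAt_dil (r : ℝ) (z : Cotangent n M) :
    extChartAt (cotModel n) (dil r z) = extChartAt (cotModel n) z := by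
  rw [FiberBundle.extChartAt, FiberBundle.extChartAt]
  rfl

theorem hasMFDerivAt_dil_comp (r : ℝ) {γ : ℝ → Cotangent n M} {t : ℝ} {w : Phase n}
    (hγ : HasMFDerivAt 𝓘(ℝ, ℝ) (cotModel n) γ t
      ((1 : ℝ →L[ℝ] ℝ).smulRight (w : TangentSpace (cotModel n) (γ t)))) :
    HasMFDerivAt 𝓘(ℝ, ℝ) (cotModel n) (fun s => dil r (γ s)) t
      ((1 : ℝ →L[ℝ] ℝ).smulRight (dilL n r w : TangentSpace (cotModel n) (dil r (γ t)))) := by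
  obtain ⟨hc, hd⟩ := hasMFDerivAt_curve_iff.1 hγ
  refine hasMFDerivAt_curve_iff.2 ⟨?_, ?_⟩
  · exact ContinuousAt.comp (f := fun s => (r, γ s)) continuous_dil.continuousAt
      (continuousAt_const.prodMk hc)
  · have h := (dilL n r).hasFDerivAt.comp_hasDerivAt t hd
    refine h.congr_of_eventuallyEq ?_
    filter_upwards [hc.preimage_mem_nhds ((isOpen_proj_preimage
      (chartAt (Eucl n) (γ t).proj).open_source).mem_nhds (mem_chart_source _ _))] with s hs
    simp only [Function.comp_apply]
    rw [extChartAt_dil, extChartAt_cotangent (by exact hs), extChartAt_cotangent (by exact hs),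
      cotCoord_dil]

/-- The symbol is homogeneous of degree one in `ξ`, so its `ξ`-derivatives have degree zero and its
`x`-derivatives degree one, which is how the two components of `dilL` scale. -/
theorem hamiltonField_dil {r : ℝ} (hr : 0 < r) (z : Cotangent n M) :
    (hamiltonField g (dil r z) : Phase n) = dilL n r (hamiltonField g z : Phase n) := by
  let L : Phase n ≃L[ℝ] Phase n :=
    (ContinuousLinearEquiv.refl ℝ (Eucl n)).prodCongr
      (ContinuousLinearEquiv.smulLeft (Units.mk0 r hr.ne'))
  have hL : ∀ u, L u = dilL n r u := fun u => rfl
  set F := fun u : Phase n => symbol g ((extChartAt (cotModel n) z).symm u) with hF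
  set u₀ := extChartAt (cotModel n) z z with hu₀
  have hu : extChartAt (cotModel n) z (dil r z) = L u₀ := by
    rw [hu₀, extChartAt_cotangent (mem_chart_source _ _),
      extChartAt_cotangent (z₀ := z) (z := dil r z) (mem_chart_source _ _), cotCoord_dil, hL]
  have h1 : (fderiv ℝ F (L u₀)).comp (L : Phase n →L[ℝ] Phase n) = r • fderiv ℝ F u₀ := by
    rw [← L.comp_right_fderiv]
    have h2 : F ∘ L =ᶠ[𝓝 u₀] fun u => r • F u := by
      filter_upwards [(isOpen_extChartAt_target z).mem_nhds (mem_extChartAt_target z)] with u hu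
      have hu' := mem_extChartAt_cotangent_target.1 hu
      simp only [hF, Function.comp_apply]
      rw [extChartAt_cotangent_symm hu', extChartAt_cotangent_symm (u := L u) hu', hL,
        cotParam_dilL, symbol_dil g hr.le, smul_eq_mul]
    rw [h2.fderiv_eq]
    exact congrFun (fderiv_const_smul_field (𝕜 := ℝ) (f := F) r) u₀
  have h3 : ∀ a b, fderiv ℝ F (L u₀) (a, r • b) = r * fderiv ℝ F u₀ (a, b) := fun a b =>
    congrArg (fun D : Phase n →L[ℝ] ℝ => D (a, b)) h1
  have h4 : (hamiltonField g (dil r z) : Phase n) = sharp (fderiv ℝ F (L u₀)) := by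
    rw [hamiltonField_eq_sharp, extChartAt_dil, hu]
  have h5 : (hamiltonField g z : Phase n) = sharp (fderiv ℝ F u₀) := rfl
  rw [h4, h5]
  refine Prod.ext ?_ ?_
  · ext j
    have h6 := h3 0 (r⁻¹ • dualCoord j)
    rw [smul_smul, mul_inv_cancel₀ hr.ne', one_smul] at h6
    have h7 : ((0, r⁻¹ • dualCoord j) : Phase n) = r⁻¹ • ((0, dualCoord j) : Phase n) := by
      simp
    rw [h7, map_smul, smul_eq_mul, ← mul_assoc, mul_inv_cancel₀ hr.ne', one_mul] at h6
    exact h6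
  · ext v
    have h6 := h3 v 0
    rw [smul_zero] at h6
    simp only [sharp, dilL_apply]
    simp [h6]

theorem isMIntegralCurve_dil {r : ℝ} (hr : 0 < r) {γ : ℝ → Cotangent n M}
    (hγ : IsMIntegralCurve γ (hamiltonField g)) :
    IsMIntegralCurve (fun s => dil r (γ s)) (hamiltonField g) := by
  intro t
  have h := hasMFDerivAt_dil_comp r (w := hamiltonField g (γ t)) (hγ t)
  rw [← hamiltonField_dil g hr] at h
  exact h

/-! ### Compactness -/

theorem continuous_symbolSq : Continuous (symbolSq g) := by
  rw [continuous_iff_continuousAt]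
  intro z
  have he := IsManifold.chart_mem_maximalAtlas (I := 𝓡 n) (n := ∞) z.proj
  have hz := mem_chart_source (Eucl n) z.proj
  have h1 := (contDiffAt_symbolSq_cotParam g he (u := cotCoord _ z)
    ((chartAt (Eucl n) z.proj).map_source hz)).continuousAt
  have h2 := ContinuousAt.comp (f := cotCoord (chartAt (Eucl n) z.proj)) h1
    (contMDiffAt_cotCoord he hz).continuousAt
  refine h2.congr ?_
  filter_upwards [(isOpen_proj_preimage (chartAt (Eucl n) z.proj).open_source).mem_nhds hz]
    with w hw
  simp only [Function.comp_apply]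
  rw [cotParam_cotCoord he hw]

theorem continuous_symbol : Continuous (symbol g) := (continuous_symbolSq g).sqrt

/-- By homogeneity of degree two it is enough to bound `symbolSq` below on unit covectors over `K`,
a compact set on which it is continuous and positive. -/
theorem exists_symbolSq_cotParam_ge {e : OpenPartialHomeomorph M (Eucl n)}
    (he : e ∈ IsManifold.maximalAtlas (𝓡 n) ∞ M) {K : Set (Eucl n)} (hK : IsCompact K)
    (hKe : K ⊆ e.target) :
    ∃ δ > (0 : ℝ), ∀ u : Phase n, u.1 ∈ K → δ * ‖u.2‖ ^ 2 ≤ symbolSq g (cotParam e u) := by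
  have hcont : ContinuousOn (fun u : Phase n => symbolSq g (cotParam e u))
      (K ×ˢ Metric.sphere 0 1) := fun u hu =>
    (contDiffAt_symbolSq_cotParam g he (hKe hu.1)).continuousAt.continuousWithinAt
  have hpos : ∀ u : Phase n, u ∈ K ×ˢ Metric.sphere (0 : Eucl n →L[ℝ] ℝ) 1 →
      0 < symbolSq g (cotParam e u) := by
    rintro ⟨x, ξ⟩ ⟨hx, hξ⟩
    rw [symbolSq_pos_iff]
    intro h0
    have h1 := cotCoord_cotParam he (u := (x, ξ)) (hKe hx)
    have h2 : ξ = 0 := by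
      have := congrArg Prod.snd h1
      simp only [cotCoord, h0, ContinuousLinearMap.zero_comp] at this
      exact this.symm
    simp [h2] at hξ
  have hδ : ∃ δ > (0 : ℝ), ∀ u : Phase n, u ∈ K ×ˢ Metric.sphere (0 : Eucl n →L[ℝ] ℝ) 1 →
      δ ≤ symbolSq g (cotParam e u) := by
    rcases (K ×ˢ Metric.sphere (0 : Eucl n →L[ℝ] ℝ) 1).eq_empty_or_nonempty with h | h
    · exact ⟨1, one_pos, by simp [h]⟩
    · obtain ⟨u, hu, hmin⟩ := (hK.prod (isCompact_sphere _ _)).exists_isMinOn h hcont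
      exact ⟨_, hpos u hu, fun v hv => hmin hv⟩
  obtain ⟨δ, hδ0, hδ⟩ := hδ
  refine ⟨δ, hδ0, fun u hu => ?_⟩
  by_cases h0 : u.2 = 0
  · rw [h0]
    simpa using symbolSq_nonneg g _
  · have hn : 0 < ‖u.2‖ := norm_pos_iff.2 h0
    have h1 : u = dilL n ‖u.2‖ (u.1, ‖u.2‖⁻¹ • u.2) := by
      refine Prod.ext rfl ?_
      simp [smul_smul, mul_inv_cancel₀ hn.ne']
    have h2 := hδ (u.1, ‖u.2‖⁻¹ • u.2) ⟨hu, by simp [norm_smul, inv_mul_cancel₀ hn.ne']⟩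
    conv_rhs => rw [h1, cotParam_dilL, symbolSq_dil]
    nlinarith [sq_nonneg ‖u.2‖]

theorem isCompact_symbolSq_le_chart {e : OpenPartialHomeomorph M (Eucl n)}
    (he : e ∈ IsManifold.maximalAtlas (𝓡 n) ∞ M) {K : Set (Eucl n)} (hK : IsCompact K)
    (hKe : K ⊆ e.target) (c : ℝ) :
    IsCompact {u : Phase n | u.1 ∈ K ∧ symbolSq g (cotParam e u) ≤ c} := by
  obtain ⟨δ, hδ, h⟩ := exists_symbolSq_cotParam_ge g he hK hKe
  -- The radius `1 + c / δ` avoids a square root: `‖ξ‖² ≤ c / δ` implies `‖ξ‖ ≤ 1 + c / δ`.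
  have hcont : ContinuousOn (fun u : Phase n => symbolSq g (cotParam e u))
      (K ×ˢ Metric.closedBall 0 (1 + c / δ)) := fun u hu =>
    (contDiffAt_symbolSq_cotParam g he (hKe hu.1)).continuousAt.continuousWithinAt
  have hcl := hcont.preimage_isClosed_of_isClosed
    (hK.isClosed.prod Metric.isClosed_closedBall) (isClosed_Iic (a := c))
  have heq : {u : Phase n | u.1 ∈ K ∧ symbolSq g (cotParam e u) ≤ c} =
      K ×ˢ Metric.closedBall 0 (1 + c / δ) ∩
        (fun u : Phase n => symbolSq g (cotParam e u)) ⁻¹' Iic c := by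
    ext u
    refine ⟨fun hu => ⟨⟨hu.1, ?_⟩, hu.2⟩, fun hu => ⟨hu.1.1, hu.2⟩⟩
    have h1 := (h u hu.1).trans hu.2
    rw [mem_closedBall_zero_iff]
    have h2 : ‖u.2‖ ^ 2 ≤ c / δ := by
      rw [le_div_iff₀ hδ]
      linarith
    nlinarith [sq_nonneg (‖u.2‖ - 1), norm_nonneg u.2]
  rw [heq]
  exact (hK.prod (isCompact_closedBall (0 : Eucl n →L[ℝ] ℝ) (1 + c / δ))).of_isClosed_subset
    hcl inter_subset_left

variable [CompactSpace M] [T2Space M]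

theorem isCompact_symbolSq_le (c : ℝ) : IsCompact {z : Cotangent n M | symbolSq g z ≤ c} := by
  have key : ∃ C, IsCompact C ∧ {z : Cotangent n M | z.proj ∈ (univ : Set M) ∧ symbolSq g z ≤ c} ⊆ C := by
    refine (isCompact_univ (X := M)).induction_on
      (p := fun s => ∃ C, IsCompact C ∧ {z : Cotangent n M | z.proj ∈ s ∧ symbolSq g z ≤ c} ⊆ C)
      ⟨∅, isCompact_empty, by simp⟩ ?_ ?_ ?_
    · rintro s t hst ⟨C, hC, h⟩
      exact ⟨C, hC, fun z hz => h ⟨hst hz.1, hz.2⟩⟩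
    · rintro s t ⟨C, hC, h⟩ ⟨C', hC', h'⟩
      refine ⟨C ∪ C', hC.union hC', fun z hz => ?_⟩
      rcases hz.1 with h1 | h1
      · exact Or.inl (h ⟨h1, hz.2⟩)
      · exact Or.inr (h' ⟨h1, hz.2⟩)
    · intro x _
      have he := IsManifold.chart_mem_maximalAtlas (I := 𝓡 n) (n := ∞) x
      set e := chartAt (Eucl n) x
      obtain ⟨K, hK, hKe, hKc⟩ := local_compact_nhds (e.open_source.mem_nhds (mem_chart_source _ x))
      have hK' : IsCompact (e '' K) := hKc.image_of_continuousOn (e.continuousOn.mono hKe)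
      have hKt : e '' K ⊆ e.target := by
        rintro _ ⟨y, hy, rfl⟩
        exact e.map_source (hKe hy)
      refine ⟨K, mem_nhdsWithin_of_mem_nhds hK, cotParam e '' _,
        (isCompact_symbolSq_le_chart g he hK' hKt c).image_of_continuousOn fun u hu =>
          (contMDiffAt_cotParam he (hKt hu.1)).continuousAt.continuousWithinAt, ?_⟩
      rintro z ⟨hz, hzc⟩
      refine ⟨cotCoord e z, ⟨⟨z.proj, hz, rfl⟩, ?_⟩, cotParam_cotCoord he (hKe hz)⟩
      rw [cotParam_cotCoord he (hKe hz)]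
      exact hzc
  obtain ⟨C, hC, h⟩ := key
  exact hC.of_isClosed_subset (isClosed_le (continuous_symbolSq g) continuous_const)
    fun z hz => h ⟨mem_univ _, hz⟩

end Kuznecov

namespace Kuznecov

variable {n : ℕ} {M : Type*} [TopologicalSpace M] [ChartedSpace (Eucl n) M]
  [IsManifold (𝓡 n) ∞ M]

variable (g : Metric n M)

/-! ### The geodesic flow -/

theorem symbol_eq_of_isMIntegralCurve {γ : ℝ → Cotangent n M}
    (hγ : IsMIntegralCurve γ (hamiltonField g)) (t : ℝ) : symbol g (γ t) = symbol g (γ 0) := by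
  rw [symbol_eq_sqrt, symbol_eq_sqrt, symbolSq_eq_of_isMIntegralCurve g hγ t]

theorem isMIntegralCurve_spray_of_symbol {γ : ℝ → Cotangent n M}
    (hγ : IsMIntegralCurve γ (hamiltonField g)) (h : symbol g (γ 0) = 1) :
    IsMIntegralCurve γ (spray g) := fun t => by
  rw [← hamiltonField_eq_spray g ((symbol_eq_of_isMIntegralCurve g hγ t).trans h)]
  exact hγ t

theorem isInvariantUnder_spray (c : ℝ) :
    IsInvariantUnder (I := cotModel n) (spray g) {z : Cotangent n M | symbol g z = c} := by
  intro γ a ha h0 hγ t ht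
  have h := symbolSq_eq_of_isMIntegralCurveOn g ha hγ ht
  change symbol g (γ t) = c
  rw [symbol_eq_sqrt, h, ← symbol_eq_sqrt]
  exact h0

section

variable [CompactSpace M] [T2Space M]

theorem isCompact_cosphere : IsCompact {z : Cotangent n M | symbol g z = 1} :=
  (isCompact_symbolSq_le g 1).of_isClosed_subset
    (isClosed_eq (continuous_symbol g) continuous_const) fun z (hz : symbol g z = 1) => by
      change symbolSq g z ≤ 1
      rw [← symbol_sq, hz, one_pow]

/-- On the compact level `p = 1` the spray is complete and equals `H_p`. The curve through the
normalized covector is scaled back, which is legitimate because `H_p` is homogeneous. -/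
theorem exists_isMIntegralCurve_hamiltonField {z : Cotangent n M} (hz : cov z ≠ 0) :
    ∃ γ : ℝ → Cotangent n M, γ 0 = z ∧ IsMIntegralCurve (I := cotModel n) γ (hamiltonField g) := by
  obtain ⟨γ, h0, hγ⟩ := exists_isMIntegralCurve_of_isCompact (I := cotModel n) (v := spray g)
    (contMDiff_spray g) (isCompact_cosphere g) (isInvariantUnder_spray g 1)
    (x := normalize g z) (symbol_normalize g hz)
  have hs : ∀ t, symbol g (γ t) = 1 := by
    intro t
    refine isInvariantUnder_spray g 1 γ (|t| + 1) (by positivity) ?_ (hγ.isMIntegralCurveOn _) t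
      (abs_lt.1 (lt_add_one _))
    rw [h0]
    exact symbol_normalize g hz
  refine ⟨fun t => dil (symbol g z) (γ t), ?_, ?_⟩
  · simp only [h0]
    exact dil_symbol_normalize g hz
  · refine isMIntegralCurve_dil g ((symbol_pos_iff g).2 hz) fun t => ?_
    rw [hamiltonField_eq_spray g (hs t)]
    exact hγ t

end

/-- `H_p` need not be regular at the zero section, so the general uniqueness theorem does not apply
to it. Both curves are scaled to `p = 1`, where they are integral curves of the smooth spray. -/
theorem isMIntegralCurve_hamiltonField_unique [T2Space M] {γ γ' : ℝ → Cotangent n M}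
    (hγ : IsMIntegralCurve γ (hamiltonField g)) (hγ' : IsMIntegralCurve γ' (hamiltonField g))
    (h : γ 0 = γ' 0) (h0 : cov (γ 0) ≠ 0) : γ = γ' := by
  have hr := (symbol_pos_iff g).2 h0
  set r := symbol g (γ 0) with hr_def
  have h1 := isMIntegralCurve_dil g (inv_pos.2 hr) hγ
  have h2 := isMIntegralCurve_dil g (inv_pos.2 hr) hγ'
  have h3 : (fun s => dil r⁻¹ (γ s)) = fun s => dil r⁻¹ (γ' s) :=
    isMIntegralCurve_Ioo_eq_of_contMDiff_boundaryless (t₀ := 0) (contMDiff_spray g)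
      (isMIntegralCurve_spray_of_symbol g h1 (symbol_normalize g h0))
      (isMIntegralCurve_spray_of_symbol g h2 (by
        simp only [← h]
        exact symbol_normalize g h0)) (by simp only [h])
  funext s
  have h4 := congrArg (dil r) (congrFun h3 s)
  simpa only [dil_dil, mul_inv_cancel₀ hr.ne', dil_one] using h4

variable [CompactSpace M] [T2Space M]

theorem geodesicFlow_spec {z : Cotangent n M} (hz : cov z ≠ 0) :
    geodesicFlow g 0 z = z ∧
      IsMIntegralCurve (I := cotModel n) (fun t => geodesicFlow g t z) (hamiltonField g) := by
  have h := exists_isMIntegralCurve_hamiltonField g hz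
  have h1 : (fun t => geodesicFlow g t z) = h.choose := by
    funext t
    simp only [geodesicFlow, dif_pos h]
  exact ⟨(congrFun h1 0).trans h.choose_spec.1, h1 ▸ h.choose_spec.2⟩

theorem geodesicFlow_zero {z : Cotangent n M} (hz : cov z ≠ 0) : geodesicFlow g 0 z = z :=
  (geodesicFlow_spec g hz).1

theorem symbol_geodesicFlow {z : Cotangent n M} (hz : cov z ≠ 0) (t : ℝ) :
    symbol g (geodesicFlow g t z) = symbol g z := by
  have h := symbol_eq_of_isMIntegralCurve g (geodesicFlow_spec g hz).2 t
  simp only [geodesicFlow_zero g hz] at h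
  exact h

theorem cov_geodesicFlow_ne_zero {z : Cotangent n M} (hz : cov z ≠ 0) (t : ℝ) :
    cov (geodesicFlow g t z) ≠ 0 := by
  rw [← symbol_pos_iff g, symbol_geodesicFlow g hz]
  exact (symbol_pos_iff g).2 hz

theorem geodesicFlow_eq {γ : ℝ → Cotangent n M} (hγ : IsMIntegralCurve γ (hamiltonField g))
    (h0 : cov (γ 0) ≠ 0) (t : ℝ) : geodesicFlow g t (γ 0) = γ t :=
  congrFun (isMIntegralCurve_hamiltonField_unique g (geodesicFlow_spec g h0).2 hγ
    (geodesicFlow_zero g h0) (by simpa only [geodesicFlow_zero g h0] using h0)) t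

theorem geodesicFlow_add {z : Cotangent n M} (hz : cov z ≠ 0) (s t : ℝ) :
    geodesicFlow g t (geodesicFlow g s z) = geodesicFlow g (s + t) z := by
  have h := (geodesicFlow_spec g hz).2.comp_add s
  have h1 := geodesicFlow_eq g h (by
    simpa only [Function.comp_apply, zero_add] using cov_geodesicFlow_ne_zero g hz s) t
  simpa only [Function.comp_apply, zero_add, add_comm t s] using h1

theorem geodesicFlow_neg {z : Cotangent n M} (hz : cov z ≠ 0) (t : ℝ) :
    geodesicFlow g (-t) (geodesicFlow g t z) = z := by
  rw [geodesicFlow_add g hz, add_neg_cancel, geodesicFlow_zero g hz]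

theorem cov_dil_ne_zero {r : ℝ} (hr : 0 < r) {z : Cotangent n M} (hz : cov z ≠ 0) :
    cov (dil r z) ≠ 0 := by
  rw [cov_dil]
  exact smul_ne_zero hr.ne' hz

theorem geodesicFlow_dil {r : ℝ} (hr : 0 < r) {z : Cotangent n M} (hz : cov z ≠ 0) (t : ℝ) :
    geodesicFlow g t (dil r z) = dil r (geodesicFlow g t z) := by
  have h1 := geodesicFlow_eq g (isMIntegralCurve_dil g hr (geodesicFlow_spec g hz).2)
    (by simpa only [geodesicFlow_zero g hz] using cov_dil_ne_zero hr hz) t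
  simpa only [geodesicFlow_zero g hz] using h1

theorem continuousOn_geodesicFlow_cosphere :
    ContinuousOn (fun p : ℝ × Cotangent n M => geodesicFlow g p.1 p.2)
      (univ ×ˢ {z : Cotangent n M | symbol g z = 1}) := by
  have h0 : ∀ z ∈ {z : Cotangent n M | symbol g z = 1}, cov z ≠ 0 := fun z hz =>
    (symbol_pos_iff g).1 (by rw [show symbol g z = 1 from hz]; norm_num)
  refine continuousOn_flow_of_isCompact (contMDiff_spray g) (isCompact_cosphere g)
    (fun z hz => geodesicFlow_zero g (h0 z hz)) (fun z hz => ?_)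
    fun z hz t => (symbol_geodesicFlow g (h0 z hz) t).trans hz
  refine isMIntegralCurve_spray_of_symbol g (geodesicFlow_spec g (h0 z hz)).2 ?_
  simp only [geodesicFlow_zero g (h0 z hz)]
  exact hz

theorem isOpen_cov_ne_zero (g : Metric n M) : IsOpen {z : Cotangent n M | cov z ≠ 0} := by
  have h : {z : Cotangent n M | cov z ≠ 0} = {z | 0 < symbol g z} := by
    ext z
    exact (symbol_pos_iff g).symm
  rw [h]
  exact isOpen_lt continuous_const (continuous_symbol g)

theorem continuousOn_normalize : ContinuousOn (normalize g) {z : Cotangent n M | cov z ≠ 0} := by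
  intro z hz
  have h : ContinuousAt (fun z : Cotangent n M => ((symbol g z)⁻¹, z)) z :=
    ((continuous_symbol g).continuousAt.inv₀ ((symbol_pos_iff g).2 hz).ne').prodMk continuousAt_id
  exact (ContinuousAt.comp (f := fun z : Cotangent n M => ((symbol g z)⁻¹, z))
    continuous_dil.continuousAt h).continuousWithinAt

/-- The flow of `z` is the flow of its normalization, dilated by `p(z)`, so continuity on the
cosphere bundle suffices. -/
theorem continuousOn_geodesicFlow :
    ContinuousOn (fun p : ℝ × Cotangent n M => geodesicFlow g p.1 p.2)
      (univ ×ˢ {z : Cotangent n M | cov z ≠ 0}) := by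
  have h1 : ContinuousOn (fun p : ℝ × Cotangent n M =>
      geodesicFlow g p.1 (normalize g p.2)) (univ ×ˢ {z : Cotangent n M | cov z ≠ 0}) :=
    (continuousOn_geodesicFlow_cosphere g).comp (f := fun p : ℝ × Cotangent n M =>
      (p.1, normalize g p.2)) (continuousOn_fst.prodMk
        ((continuousOn_normalize g).comp continuousOn_snd fun p hp => hp.2))
      fun p hp => ⟨mem_univ _, symbol_normalize g hp.2⟩
  have h2 : ContinuousOn (fun p : ℝ × Cotangent n M => dil (symbol g p.2)
      (geodesicFlow g p.1 (normalize g p.2))) (univ ×ˢ {z : Cotangent n M | cov z ≠ 0}) :=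
    continuous_dil.comp_continuousOn
      ((((continuous_symbol g).comp continuous_snd).continuousOn).prodMk h1)
  refine h2.congr fun p hp => ?_
  have h3 := (symbol_pos_iff g).2 hp.2
  simp only
  rw [normalize_eq_dil, geodesicFlow_dil g (inv_pos.2 h3) hp.2, dil_dil,
    mul_inv_cancel₀ h3.ne', dil_one]

theorem continuousOn_geodesicFlow_left (t : ℝ) :
    ContinuousOn (geodesicFlow g t) {z : Cotangent n M | cov z ≠ 0} :=
  (continuousOn_geodesicFlow g).comp (f := fun z => (t, z))
    (Continuous.prodMk_right t).continuousOn fun _ hz => ⟨mem_univ _, hz⟩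

theorem sigmaCompactSpace_cotangent (g : Metric n M) : SigmaCompactSpace (Cotangent n M) := by
  refine ⟨⟨fun k : ℕ => {z | symbolSq g z ≤ k}, fun k => isCompact_symbolSq_le g k, ?_⟩⟩
  refine eq_univ_of_forall fun z => mem_iUnion.2 ?_
  exact exists_nat_ge (symbolSq g z)

theorem secondCountableTopology_cotangent (g : Metric n M) : SecondCountableTopology (Cotangent n M) := by
  have := sigmaCompactSpace_cotangent g
  have : SecondCountableTopology (ModelProd (Eucl n) (Eucl n →L[ℝ] ℝ)) :=
    inferInstanceAs (SecondCountableTopology (Phase n))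
  exact ChartedSpace.secondCountable_of_sigmaCompact
    (ModelProd (Eucl n) (Eucl n →L[ℝ] ℝ)) (Cotangent n M)

theorem locallyCompactSpace_cotangent : LocallyCompactSpace (Cotangent n M) :=
  have : LocallyCompactSpace (ModelProd (Eucl n) (Eucl n →L[ℝ] ℝ)) :=
    inferInstanceAs (LocallyCompactSpace (Phase n))
  ChartedSpace.locallyCompactSpace (ModelProd (Eucl n) (Eucl n →L[ℝ] ℝ)) (Cotangent n M)

end Kuznecov

namespace Kuznecov

variable {n : ℕ} {M : Type*} [TopologicalSpace M] [ChartedSpace (Eucl n) M]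
  [IsManifold (𝓡 n) ∞ M]

/-! ### Tangent spaces of subsets -/

section TangentOf

variable {E B X : Type*} [NormedAddCommGroup E] [NormedSpace ℝ E] [TopologicalSpace B]
  {I : ModelWithCorners ℝ E B} [TopologicalSpace X] [ChartedSpace B X] {S : Set X}

/-- `tangentOf` requires curves that lie in `S` for all times. A curve that is in `S` only near time
`0` is made constant at the times when it is outside, without changing its germ. -/
theorem mem_tangentOf_of_eventually {γ : ℝ → X} (v : TangentSpace I (γ 0))
    (hS : ∀ᶠ s in 𝓝 0, γ s ∈ S)
    (hγ : HasMFDerivAt 𝓘(ℝ, ℝ) I γ 0 ((1 : ℝ →L[ℝ] ℝ).smulRight v)) :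
    v ∈ tangentOf I S (γ 0) := by
  classical
  let γ' : ℝ → X := fun s => if γ s ∈ S then γ s else γ 0
  have h0 : γ' 0 = γ 0 := by simp [γ']
  have hev : γ' =ᶠ[𝓝 0] γ := by
    filter_upwards [hS] with s hs
    simp [γ', hs]
  refine Submodule.subset_span ⟨γ', h0, fun s => ?_, ?_⟩
  · by_cases h : γ s ∈ S
    · simp [γ', h]
    · simpa [γ', h] using hS.self_of_nhds
  · exact hγ.congr_of_eventuallyEq hev

/-- Along a curve in `S` the two functions coincide near time `0`, so their derivatives agree on its
velocity, and then on the span of such velocities. -/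
theorem mfderiv_eq_of_mem_tangentOf {F : Type*} [NormedAddCommGroup F] [NormedSpace ℝ F]
    {f f' : X → F} {x : X} (hf : MDifferentiableAt I 𝓘(ℝ, F) f x)
    (hf' : MDifferentiableAt I 𝓘(ℝ, F) f' x) (h : ∀ᶠ y in 𝓝 x, y ∈ S → f y = f' y)
    {v : TangentSpace I x} (hv : v ∈ tangentOf I S x) :
    (mfderiv I 𝓘(ℝ, F) f x v : F) = mfderiv I 𝓘(ℝ, F) f' x v := by
  induction hv using Submodule.span_induction with
  | mem v hv =>
    obtain ⟨γ, rfl, hS, hγ⟩ := hv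
    have h1 := HasMFDerivAt.comp 0 hf.hasMFDerivAt hγ
    have h2 := HasMFDerivAt.comp 0 hf'.hasMFDerivAt hγ
    have h3 : f ∘ γ =ᶠ[𝓝 0] f' ∘ γ := by
      filter_upwards [hγ.continuousAt.eventually h] with s hs
      exact hs (hS s)
    have h4 := hasMFDerivAt_unique h1 (h2.congr_of_eventuallyEq h3)
    have h5 : ∀ A A' : TangentSpace I (γ 0) →L[ℝ] F,
        A.comp ((1 : ℝ →L[ℝ] ℝ).smulRight v) = A'.comp ((1 : ℝ →L[ℝ] ℝ).smulRight v) →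
          A v = A' v := fun A A' h => by
      simpa using congrArg (fun L : ℝ →L[ℝ] F => L 1) h
    exact h5 _ _ h4
  | zero =>
    rw [map_zero, map_zero]
    rfl
  | add v w _ _ hv hw =>
    rw [map_add, map_add]
    exact congrArg₂ (· + ·) hv hw
  | smul c v _ hv =>
    rw [map_smul, map_smul]
    exact congrArg (c • ·) hv

end TangentOf

/-! ### Linear coordinates on the conormal bundle of a subspace -/

/-- `w = (x', ξ'') ↦ ((x', 0), (0, ξ''))`. -/
def conormalEmb (n d : ℕ) : Eucl n →L[ℝ] Phase n :=
  LinearMap.toContinuousLinearMap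
    { toFun := fun w => (basePart d w, fiberPart d w)
      map_add' := fun v w => by
        refine Prod.ext ?_ ?_
        · ext i
          by_cases h : i.val < d <;> simp [basePart, h]
        · simp only [fiberPart, Prod.snd_add, ← Finset.sum_add_distrib, ← add_smul]
          refine Finset.sum_congr rfl fun i _ => ?_
          by_cases h : i.val < d <;> simp [h]
      map_smul' := fun c w => by
        refine Prod.ext ?_ ?_
        · ext i
          by_cases h : i.val < d <;> simp [basePart, h]
        · simp only [fiberPart, Prod.smul_snd, Finset.smul_sum, smul_smul, RingHom.id_apply]
          refine Finset.sum_congr rfl fun i _ => ?_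
          by_cases h : i.val < d <;> simp [h] }

/-- `(x, ξ) ↦ (x', ξ'')`. -/
def conormalPr (n d : ℕ) : Phase n →L[ℝ] Eucl n :=
  LinearMap.toContinuousLinearMap
    { toFun := fun u => WithLp.toLp 2 fun i => if i.val < d then u.1 i else comps u.2 i
      map_add' := fun v w => by
        ext i
        by_cases h : i.val < d <;> simp [h, comps]
      map_smul' := fun c w => by
        ext i
        by_cases h : i.val < d <;> simp [h, comps] }

theorem conormalEmb_apply (d : ℕ) (w : Eucl n) :
    conormalEmb n d w = (basePart d w, fiberPart d w) := rfl

theorem conormalPr_apply (d : ℕ) (u : Phase n) (i : Fin n) :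
    conormalPr n d u i = if i.val < d then u.1 i else comps u.2 i := rfl

theorem comps_fiberPart (d : ℕ) (w : Eucl n) (i : Fin n) :
    comps (fiberPart d w) i = if i.val < d then 0 else w i := by
  simp only [comps, fiberPart, _root_.sum_apply, _root_.smul_apply, smul_eq_mul, dualCoord]
  rw [Finset.sum_eq_single i]
  · simp
  · intro j _ hj
    simp [hj]
  · simp

theorem basePart_apply (d : ℕ) (w : Eucl n) (i : Fin n) :
    basePart d w i = if i.val < d then w i else 0 := rfl

theorem conormalPr_conormalEmb (d : ℕ) (w : Eucl n) : conormalPr n d (conormalEmb n d w) = w := by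
  ext i
  rw [conormalPr_apply, conormalEmb_apply]
  by_cases h : i.val < d
  · simp [h, basePart]
  · simp only [if_neg h, comps_fiberPart]

theorem comps_injective : Function.Injective (comps : (Eucl n →L[ℝ] ℝ) → Fin n → ℝ) := by
  intro ξ η h
  rw [covector_eq_sum ξ, covector_eq_sum η, h]

theorem conormalEmb_conormalPr {d : ℕ} {u : Phase n} (h1 : ∀ i : Fin n, d ≤ i.val → u.1 i = 0)
    (h2 : ∀ i : Fin n, i.val < d → comps u.2 i = 0) : conormalEmb n d (conormalPr n d u) = u := by
  refine Prod.ext ?_ (comps_injective ?_)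
  · ext i
    simp only [conormalEmb_apply, basePart_apply, conormalPr_apply]
    by_cases h : i.val < d
    · simp [h]
    · simp [h, h1 i (not_lt.1 h)]
  · ext i
    simp only [conormalEmb_apply, comps_fiberPart, conormalPr_apply]
    by_cases h : i.val < d
    · simp [h, h2 i h]
    · simp [h]

theorem conormalParam_eq (d : ℕ) (φ : OpenPartialHomeomorph M (Eucl n)) (w : Eucl n) :
    conormalParam d φ w = cotParam φ (conormalEmb n d w) := rfl

theorem conormalCoord_eq (d : ℕ) (φ : OpenPartialHomeomorph M (Eucl n)) (z : Cotangent n M) :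
    conormalCoord d φ z = conormalPr n d (cotCoord φ z) := rfl

/-! ### The conormal bundle in adapted coordinates -/

section Adapted

variable {d : ℕ} {H : Set M} {φ : OpenPartialHomeomorph M (Eucl n)}

theorem coordVec_mem_tangentOf (hφ : IsAdapted d H φ) {x : M} (hx : x ∈ φ.source) (hxH : x ∈ H)
    {i : Fin n} (hi : i.val < d) : coordVec φ x i ∈ tangentOf (𝓡 n) H x := by
  set γ : ℝ → M := fun s => φ.symm (φ x + s • EuclideanSpace.single i (1 : ℝ)) with hγ
  have h0 : γ 0 = x := by simp [hγ, φ.left_inv hx]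
  have hline : HasDerivAt (fun s : ℝ => φ x + s • (EuclideanSpace.single i (1 : ℝ) : Eucl n))
      (EuclideanSpace.single i (1 : ℝ)) 0 := by
    simpa using ((hasDerivAt_id (0 : ℝ)).smul_const
      (EuclideanSpace.single i (1 : ℝ) : Eucl n)).const_add (φ x)
  have hl0 : φ x + (0 : ℝ) • (EuclideanSpace.single i (1 : ℝ) : Eucl n) = φ x := by simp
  have hd : HasMFDerivAt 𝓘(ℝ, ℝ) (𝓡 n) γ 0 ((1 : ℝ →L[ℝ] ℝ).smulRight (coordVec φ x i)) := by
    have h1 : HasMFDerivAt (𝓡 n) (𝓡 n) φ.symm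
        ((fun s : ℝ => φ x + s • (EuclideanSpace.single i (1 : ℝ) : Eucl n)) 0)
        (mfderiv (𝓡 n) (𝓡 n) φ.symm (φ x)) := by
      have h2 : (fun s : ℝ => φ x + s • (EuclideanSpace.single i (1 : ℝ) : Eucl n)) 0 = φ x := hl0
      rw [h2]
      exact ((mdifferentiable_of_mem_maximalAtlas hφ.1).mdifferentiableAt_symm
        (φ.map_source hx)).hasMFDerivAt
    have h2 := HasMFDerivAt.comp (0 : ℝ) h1 hline.hasFDerivAt.hasMFDerivAt
    refine h2.congr_mfderiv ?_
    ext
    have h3 := mfderiv_chart_symm hφ.1 hx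
    have h4 : ∀ L : Eucl n →L[ℝ] Eucl n, L = (dchart φ x).inverse →
        (L.comp (ContinuousLinearMap.toSpanSingleton ℝ (EuclideanSpace.single i (1 : ℝ) : Eucl n)))
          1 = ((1 : ℝ →L[ℝ] ℝ).smulRight
            ((dchart φ x).inverse (EuclideanSpace.single i (1 : ℝ)))) 1 := by
      rintro L rfl
      simp
    exact h4 _ h3
  have hev : ∀ᶠ s in 𝓝 (0 : ℝ), γ s ∈ H := by
    have h1 : ∀ᶠ s in 𝓝 (0 : ℝ), φ x + s • (EuclideanSpace.single i (1 : ℝ) : Eucl n) ∈ φ.target := by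
      refine hline.continuousAt.eventually (p := (· ∈ φ.target)) ?_
      have h2 : (fun s : ℝ => φ x + s • (EuclideanSpace.single i (1 : ℝ) : Eucl n)) 0 = φ x := hl0
      rw [h2]
      exact φ.open_target.mem_nhds (φ.map_source hx)
    filter_upwards [h1] with s hs
    refine (hφ.2 _ (φ.map_target hs)).2 fun j hj => ?_
    rw [φ.right_inv hs]
    have h2 : j ≠ i := fun h => by rw [h] at hj; omega
    simp [(hφ.2 x hx).1 hxH j hj, h2]
  have := mem_tangentOf_of_eventually (I := 𝓡 n) (S := H) (γ := γ)
    (v := (coordVec φ x i : Eucl n)) hev hd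
  rwa [h0] at this

theorem dchart_apply_eq_zero (hφ : IsAdapted d H φ) {x : M} (hx : x ∈ φ.source)
    {v : TangentSpace (𝓡 n) x} (hv : v ∈ tangentOf (𝓡 n) H x) {i : Fin n} (hi : d ≤ i.val) :
    (dchart φ x v : Eucl n) i = 0 := by
  have h1 := (mdifferentiable_of_mem_maximalAtlas hφ.1).mdifferentiableAt hx
  have h2 : HasMFDerivAt (𝓡 n) 𝓘(ℝ, ℝ) (fun y => dualCoord i (φ y)) x
      ((dualCoord i).comp (dchart φ x)) :=
    HasMFDerivAt.comp x (dualCoord i).hasFDerivAt.hasMFDerivAt h1.hasMFDerivAt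
  have h3 := mfderiv_eq_of_mem_tangentOf (I := 𝓡 n) (S := H) (f := fun y => dualCoord i (φ y))
    (f' := fun _ => (0 : ℝ)) h2.mdifferentiableAt mdifferentiableAt_const (by
      filter_upwards [φ.open_source.mem_nhds hx] with y hy hyH
      exact (hφ.2 y hy).1 hyH i hi) hv
  rw [h2.mfderiv, mfderiv_const] at h3
  exact h3

theorem comps_cotCoord_eq (z : Cotangent n M) (i : Fin n) :
    comps (cotCoord φ z).2 i = z.2 (coordVec φ z.proj i) := rfl

/-- In adapted coordinates the tangent space of `H` is the space of the first `d` directions, so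
conormality means `x'' = 0` and `ξ' = 0`: the coordinates are recovered from `(x', ξ'')`. Unlike the
definition through curves, this form is closed and smooth in `z`. -/
theorem mem_conormal_iff (hφ : IsAdapted d H φ) {z : Cotangent n M} (hz : z.proj ∈ φ.source) :
    z ∈ conormal H ↔ cov z ≠ 0 ∧ conormalEmb n d (conormalCoord d φ z) = cotCoord φ z := by
  rw [conormalCoord_eq]
  constructor
  · rintro ⟨h1, h2, h3⟩
    refine ⟨h2, ?_⟩
    rw [conormalEmb_conormalPr]
    · exact (hφ.2 _ hz).1 h1
    · intro i hi
      rw [comps_cotCoord_eq]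
      exact h3 _ (coordVec_mem_tangentOf hφ hz h1 hi)
  · rintro ⟨h1, h2⟩
    refine ⟨(hφ.2 _ hz).2 fun i hi => ?_, h1, fun v hv => ?_⟩
    · have h3 := congrArg (fun u : Phase n => u.1 i) h2
      simp only [conormalEmb_apply, basePart_apply, if_neg (not_lt.2 hi)] at h3
      exact h3.symm
    · have h3 : ∀ w : Eucl n, cov z w = (cotCoord φ z).2 (dchart φ z.proj w) := fun w => by
        have h4 := congrArg (fun L : Eucl n →L[ℝ] Eucl n => cov z (L w))
          (isInvertible_dchart hφ.1 hz).inverse_comp_self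
        exact h4.symm
      refine (h3 v).trans ?_
      rw [covector_eq_sum (cotCoord φ z).2, _root_.sum_apply]
      refine Finset.sum_eq_zero fun i _ => ?_
      by_cases hi : i.val < d
      · have h5 : comps (cotCoord φ z).2 i = 0 := by
          rw [← h2, conormalEmb_apply]
          simp only [comps_fiberPart, if_pos hi]
        rw [h5, zero_smul, _root_.zero_apply]
      · have h5 := dchart_apply_eq_zero hφ hz hv (not_lt.1 hi)
        have h6 : dualCoord i (dchart φ z.proj v : Eucl n) = 0 := h5
        have h7 : ∀ (c : ℝ) (y : Eucl n), dualCoord i y = 0 → (c • dualCoord i) y = 0 :=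
          fun c y hy => by rw [_root_.smul_apply, hy, smul_zero]
        exact h7 _ _ h6

theorem conormalParam_conormalCoord (hφ : IsAdapted d H φ) {z : Cotangent n M}
    (hz : z.proj ∈ φ.source) (hzc : z ∈ conormal H) :
    conormalParam d φ (conormalCoord d φ z) = z := by
  rw [conormalParam_eq, ((mem_conormal_iff hφ hz).1 hzc).2, cotParam_cotCoord hφ.1 hz]

theorem cotCoord_snd_ne_zero (hφ : IsAdapted d H φ) {z : Cotangent n M}
    (hz : z.proj ∈ φ.source) (h0 : cov z ≠ 0) : (cotCoord φ z).2 ≠ 0 := by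
  intro h
  apply h0
  rw [← cotParam_cotCoord hφ.1 hz]
  simp [cotParam, h]

theorem cov_cotParam_ne_zero (hφ : IsAdapted d H φ) {u : Phase n}
    (hu : u.1 ∈ φ.target) (h0 : u.2 ≠ 0) : cov (cotParam φ u) ≠ 0 := by
  intro h
  apply h0
  have h1 := congrArg Prod.snd (cotCoord_cotParam hφ.1 hu)
  rw [← h1]
  simp [cotCoord, h]

theorem conormalCoord_mem_conormalDomain (hφ : IsAdapted d H φ) {z : Cotangent n M}
    (hz : z.proj ∈ φ.source) (hzc : z ∈ conormal H) :
    conormalCoord d φ z ∈ conormalDomain d φ := by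
  have h := ((mem_conormal_iff hφ hz).1 hzc).2
  have h1 : basePart d (conormalCoord d φ z) = φ z.proj := congrArg Prod.fst h
  have h2 : fiberPart d (conormalCoord d φ z) = (cotCoord φ z).2 := congrArg Prod.snd h
  refine ⟨?_, ?_⟩
  · rw [h1]
    exact φ.map_source hz
  · rw [h2]
    exact cotCoord_snd_ne_zero hφ hz hzc.2.1

theorem proj_conormalParam_mem {w : Eucl n} (hw : w ∈ conormalDomain d φ) :
    (conormalParam d φ w).proj ∈ φ.source := φ.map_target hw.1

theorem cotCoord_conormalParam (hφ : IsAdapted d H φ) {w : Eucl n} (hw : w ∈ conormalDomain d φ) :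
    cotCoord φ (conormalParam d φ w) = conormalEmb n d w := by
  rw [conormalParam_eq, cotCoord_cotParam hφ.1 hw.1]

theorem conormalCoord_conormalParam (hφ : IsAdapted d H φ) {w : Eucl n}
    (hw : w ∈ conormalDomain d φ) : conormalCoord d φ (conormalParam d φ w) = w := by
  rw [conormalCoord_eq, cotCoord_conormalParam hφ hw, conormalPr_conormalEmb]

theorem conormalParam_mem_conormal (hφ : IsAdapted d H φ) {w : Eucl n}
    (hw : w ∈ conormalDomain d φ) : conormalParam d φ w ∈ conormal H := by
  refine (mem_conormal_iff hφ (proj_conormalParam_mem hw)).2 ⟨?_, ?_⟩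
  · exact cov_cotParam_ne_zero hφ (u := conormalEmb n d w) hw.1 hw.2
  · rw [conormalCoord_conormalParam hφ hw, cotCoord_conormalParam hφ hw]

theorem isOpen_conormalDomain : IsOpen (conormalDomain d φ) := by
  refine (φ.open_target.preimage (continuous_fst.comp (conormalEmb n d).continuous)).inter ?_
  exact isOpen_ne.preimage (continuous_snd.comp (conormalEmb n d).continuous)

theorem contMDiffAt_conormalParam (hφ : IsAdapted d H φ) {w : Eucl n}
    (hw : basePart d w ∈ φ.target) :
    ContMDiffAt 𝓘(ℝ, Eucl n) (cotModel n) ∞ (conormalParam d φ) w :=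
  ContMDiffAt.comp (g := cotParam φ) (f := conormalEmb n d) w
    (contMDiffAt_cotParam hφ.1 (u := conormalEmb n d w) hw)
    (conormalEmb n d).contDiff.contMDiff.contMDiffAt

theorem contMDiffAt_conormalCoord (hφ : IsAdapted d H φ) {z : Cotangent n M}
    (hz : z.proj ∈ φ.source) :
    ContMDiffAt (cotModel n) 𝓘(ℝ, Eucl n) ∞ (conormalCoord d φ) z :=
  ContMDiffAt.comp (g := conormalPr n d) (f := cotCoord φ) z
    (conormalPr n d).contDiff.contMDiff.contMDiffAt (contMDiffAt_cotCoord hφ.1 hz)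

theorem mfderiv_conormalParam_mem_tangentOf (hφ : IsAdapted d H φ) {w : Eucl n}
    (hw : w ∈ conormalDomain d φ) (v : Eucl n) :
    mfderiv 𝓘(ℝ, Eucl n) (cotModel n) (conormalParam d φ) w v ∈
      tangentOf (cotModel n) (conormal H) (conormalParam d φ w) := by
  have hline : HasDerivAt (fun s : ℝ => w + s • v) v 0 := by
    simpa using ((hasDerivAt_id (0 : ℝ)).smul_const v).const_add w
  have h0 : (fun s : ℝ => w + s • v) 0 = w := by simp
  have h1 := ((contMDiffAt_conormalParam hφ hw.1).mdifferentiableAt (by simp)).hasMFDerivAt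
  have h1' : HasMFDerivAt 𝓘(ℝ, Eucl n) (cotModel n) (conormalParam d φ)
      ((fun s : ℝ => w + s • v) 0) (mfderiv 𝓘(ℝ, Eucl n) (cotModel n) (conormalParam d φ) w) := by
    rw [h0]
    exact h1
  have h2 := HasMFDerivAt.comp (0 : ℝ) h1' hline.hasFDerivAt.hasMFDerivAt
  have h3 : ∀ᶠ s in 𝓝 (0 : ℝ), (conormalParam d φ ∘ fun s : ℝ => w + s • v) s ∈ conormal H := by
    have h4 : ∀ᶠ s in 𝓝 (0 : ℝ), w + s • v ∈ conormalDomain d φ := by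
      refine hline.continuousAt.eventually (p := (· ∈ conormalDomain d φ)) ?_
      rw [h0]
      exact isOpen_conormalDomain.mem_nhds hw
    filter_upwards [h4] with s hs
    exact conormalParam_mem_conormal hφ hs
  have h5 := mem_tangentOf_of_eventually (I := cotModel n) (S := conormal H)
    (γ := conormalParam d φ ∘ fun s : ℝ => w + s • v)
    (v := (mfderiv 𝓘(ℝ, Eucl n) (cotModel n) (conormalParam d φ) w v : Phase n)) h3 (by
      refine h2.congr_mfderiv ?_
      ext1
      have h6 : ∀ L : Eucl n →L[ℝ] Phase n,
          (L.comp (ContinuousLinearMap.toSpanSingleton ℝ v)) 1 =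
            ((1 : ℝ →L[ℝ] ℝ).smulRight (L v)) 1 := fun L => by simp
      exact h6 _)
  have h7 : (conormalParam d φ ∘ fun s : ℝ => w + s • v) 0 = conormalParam d φ w := by simp
  rwa [h7] at h5

/-- A left inverse for the derivative of the parametrization; it shows that the tangent space of
`Ṅ^*H` is nonzero when `n > 0`. -/
theorem fderiv_conormalCoord_comp (hφ : IsAdapted d H φ) {w : Eucl n}
    (hw : w ∈ conormalDomain d φ) (v : Eucl n) :
    (mfderiv (cotModel n) 𝓘(ℝ, Eucl n) (conormalCoord d φ) (conormalParam d φ w)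
      (mfderiv 𝓘(ℝ, Eucl n) (cotModel n) (conormalParam d φ) w v) : Eucl n) = v := by
  have h1 := ((contMDiffAt_conormalParam hφ hw.1).mdifferentiableAt (by simp)).hasMFDerivAt
  have h2 := ((contMDiffAt_conormalCoord (d := d) hφ (proj_conormalParam_mem hw)).mdifferentiableAt
    (by simp)).hasMFDerivAt
  have h3 := HasMFDerivAt.comp w h2 h1
  have h4 : HasMFDerivAt 𝓘(ℝ, Eucl n) 𝓘(ℝ, Eucl n) (conormalCoord d φ ∘ conormalParam d φ) w
      (ContinuousLinearMap.id ℝ (Eucl n)) := by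
    refine (hasMFDerivAt_id w).congr_of_eventuallyEq ?_
    filter_upwards [isOpen_conormalDomain.mem_nhds hw] with y hy
    exact conormalCoord_conormalParam hφ hy
  have h5 := hasMFDerivAt_unique h3 h4
  exact congrArg (fun L : Eucl n →L[ℝ] Eucl n => L v) h5

end Adapted

end Kuznecov

/-! ### Separation of return times and compactness of the unit conormal bundle -/

namespace Kuznecov

variable {n : ℕ} {M : Type*} [TopologicalSpace M] [ChartedSpace (Eucl n) M]
  [IsManifold (𝓡 n) ∞ M]

variable (g : Metric n M)

/-! ### The Hamilton equations in a chart -/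

section HamiltonEquations

variable {e : OpenPartialHomeomorph M (Eucl n)}

theorem mfderiv_cotCoord (he : e ∈ IsManifold.maximalAtlas (𝓡 n) ∞ M) {z : Cotangent n M}
    (hz : z.proj ∈ e.source) :
    (mfderiv (cotModel n) 𝓘(ℝ, Phase n) (cotCoord e) z : Phase n →L[ℝ] Phase n) =
      fderiv ℝ (cotTrans (e ∘ (chartAt (Eucl n) z.proj).symm)) (extChartAt (cotModel n) z z) := by
  have he' := IsManifold.chart_mem_maximalAtlas (I := 𝓡 n) (n := ∞) z.proj
  have hz' := mem_chart_source (Eucl n) z.proj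
  have hmem : (extChartAt (cotModel n) z z).1 ∈
      ((chartAt (Eucl n) z.proj).symm.trans e).source := by
    rw [extChartAt_cotangent hz']
    simp [cotCoord, hz]
  have hev : ∀ᶠ u in 𝓝 (extChartAt (cotModel n) z z),
      u.1 ∈ ((chartAt (Eucl n) z.proj).symm.trans e).source :=
    (((chartAt (Eucl n) z.proj).symm.trans e).open_source.preimage continuous_fst).mem_nhds hmem
  rw [((contMDiffAt_cotCoord he hz).mdifferentiableAt (by simp)).mfderiv,
    ModelWithCorners.range_eq_univ, fderivWithin_univ]
  refine Filter.EventuallyEq.fderiv_eq ?_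
  filter_upwards [hev] with u hu
  simp only [writtenInExtChartAt, extChartAt_model_space_eq_id, PartialEquiv.refl_coe,
    Function.comp_apply, id_eq]
  rw [extChartAt_cotangent_symm hu.1]
  have h := cotCoord_eq_cotTrans he' he (z := cotParam (chartAt (Eucl n) z.proj) u)
    ((chartAt (Eucl n) z.proj).map_target hu.1) hu.2
  rwa [cotCoord_cotParam he' hu.1] at h

theorem mfderiv_cotCoord_spray (he : e ∈ IsManifold.maximalAtlas (𝓡 n) ∞ M) {z : Cotangent n M}
    (hz : z.proj ∈ e.source) :
    (mfderiv (cotModel n) 𝓘(ℝ, Phase n) (cotCoord e) z (spray g z) : Phase n) =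
      sharp (fderiv ℝ (fun u => symbolSq g (cotParam e u) / 2) (cotCoord e z)) := by
  have he' := IsManifold.chart_mem_maximalAtlas (I := 𝓡 n) (n := ∞) z.proj
  have hz' := mem_chart_source (Eucl n) z.proj
  have hmem : (extChartAt (cotModel n) z z).1 ∈
      ((chartAt (Eucl n) z.proj).symm.trans e).source := by
    rw [extChartAt_cotangent hz']
    simp [cotCoord, hz]
  have hev : ∀ᶠ u in 𝓝 (extChartAt (cotModel n) z z),
      u.1 ∈ ((chartAt (Eucl n) z.proj).symm.trans e).source :=
    (((chartAt (Eucl n) z.proj).symm.trans e).open_source.preimage continuous_fst).mem_nhds hmem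
  have hT : cotTrans (e ∘ (chartAt (Eucl n) z.proj).symm) (extChartAt (cotModel n) z z) =
      cotCoord e z := by
    rw [extChartAt_cotangent hz', cotCoord_eq_cotTrans he' he hz' hz]
  have hp : DifferentiableAt ℝ (fun u => symbolSq g (cotParam e u) / 2)
      (cotTrans (e ∘ (chartAt (Eucl n) z.proj).symm) (extChartAt (cotModel n) z z)) := by
    rw [hT]
    exact ((contDiffAt_symbolSq_cotParam g he (e.map_source hz)).div_const 2).differentiableAt
      (by simp)
  have h2 := fderiv_cotTrans_sharp ((chartAt (Eucl n) z.proj).symm.trans e).open_source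
    (contDiffOn_transition he' he) (fun x hx => by
      have h := isInvertible_fderiv_transition he' he
        ((chartAt (Eucl n) z.proj).map_target hx.1) hx.2
      rwa [(chartAt (Eucl n) z.proj).right_inv hx.1] at h) hmem hp
    (p' := fun u => symbolSq g ((extChartAt (cotModel n) z).symm u) / 2) (by
      filter_upwards [hev] with u hu
      have h := cotCoord_eq_cotTrans he' he (z := cotParam (chartAt (Eucl n) z.proj) u)
        ((chartAt (Eucl n) z.proj).map_target hu.1) hu.2
      rw [cotCoord_cotParam he' hu.1] at h
      rw [Function.comp_apply, extChartAt_cotangent_symm hu.1, ← h,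
        cotParam_cotCoord he (by exact hu.2)])
  rw [hT] at h2
  rw [mfderiv_cotCoord he hz]
  exact h2

theorem hasDerivAt_cotCoord_comp (he : e ∈ IsManifold.maximalAtlas (𝓡 n) ∞ M)
    {γ : ℝ → Cotangent n M} (hγ : IsMIntegralCurve γ (spray g)) {t : ℝ}
    (hz : (γ t).proj ∈ e.source) :
    HasDerivAt (cotCoord e ∘ γ)
      (sharp (fderiv ℝ (fun u => symbolSq g (cotParam e u) / 2) (cotCoord e (γ t)))) t := by
  have h1 := ((contMDiffAt_cotCoord he hz).mdifferentiableAt (by simp)).hasMFDerivAt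
  have h2 := (HasMFDerivAt.comp t h1 (hγ t)).hasFDerivAt
  rw [hasDerivAt_iff_hasFDerivAt]
  refine h2.congr_fderiv ?_
  ext1
  rw [← mfderiv_cotCoord_spray g he hz]
  have h3 : ∀ (L : Phase n →L[ℝ] Phase n) (v : Phase n),
      (L.comp ((1 : ℝ →L[ℝ] ℝ).smulRight v)) 1 =
        (ContinuousLinearMap.toSpanSingleton ℝ (L v)) 1 := fun L v => by simp
  exact h3 _ _

/-- Euler's identity for a function of degree two in `ξ`, applied to `p²/2`. -/
theorem fderiv_symbolSq_cotParam_radial (he : e ∈ IsManifold.maximalAtlas (𝓡 n) ∞ M)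
    {z : Cotangent n M} (hz : z.proj ∈ e.source) :
    fderiv ℝ (fun u => symbolSq g (cotParam e u) / 2) (cotCoord e z) (0, (cotCoord e z).2) =
      symbolSq g z := by
  have h1 := ((contDiffAt_symbolSq_cotParam g he (u := cotCoord e z)
    (e.map_source hz)).div_const 2).differentiableAt (by simp)
  have hone : dilL n 1 (cotCoord e z) = cotCoord e z := by simp
  have h2 : HasDerivAt (fun r : ℝ => dilL n r (cotCoord e z)) (0, (cotCoord e z).2) 1 := by
    have := (hasDerivAt_const (1 : ℝ) (cotCoord e z).1).prodMk
      ((hasDerivAt_id (1 : ℝ)).smul_const (cotCoord e z).2)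
    simpa using this
  have h3 := HasFDerivAt.comp_hasDerivAt (1 : ℝ)
    (l := fun u => symbolSq g (cotParam e u) / 2) (f := fun r : ℝ => dilL n r (cotCoord e z))
    (by rw [hone]; exact h1.hasFDerivAt) h2
  have h4 : ((fun u => symbolSq g (cotParam e u) / 2) ∘ fun r : ℝ => dilL n r (cotCoord e z)) =
      fun r : ℝ => r ^ 2 * (symbolSq g z / 2) := by
    funext r
    simp only [Function.comp_apply]
    rw [cotParam_dilL, symbolSq_dil, cotParam_cotCoord he hz]
    ring
  rw [h4] at h3
  have h5 := h3.unique ((hasDerivAt_pow 2 (1 : ℝ)).mul_const (symbolSq g z / 2))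
  rw [h5]
  norm_num
  ring

theorem apply_sharp_fst (D : Phase n →L[ℝ] ℝ) (ξ : Eucl n →L[ℝ] ℝ) :
    ξ (sharp D).1 = D (0, ξ) := by
  have h := sympl_sharp D (0, ξ)
  simp only [sympl, map_zero] at h
  linarith

end HamiltonEquations

/-! ### The unit conormal bundle -/

variable [CompactSpace M] [T2Space M] {d : ℕ} {H : Set M}

theorem cov_ne_zero_of_symbol_eq_one {z : Cotangent n M} (hz : symbol g z = 1) : cov z ≠ 0 :=
  (symbol_pos_iff g).1 (by rw [hz]; exact one_pos)

/-- `Ṅ^*H` is not closed, since it omits the zero section, but `p = 1` keeps away from it. A limit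
of unit conormal covectors lies over the closed set `H`, and the equation in `mem_conormal_iff`
passes to the limit. -/
theorem isCompact_unitConormal (hH : IsEmbeddedSubmanifold (n := n) d H) (hHc : IsCompact H) :
    IsCompact (unitConormal g H) := by
  refine (isCompact_cosphere g).of_isClosed_subset ?_ fun z hz => hz.2
  refine isClosed_of_closure_subset fun z hz => ?_
  have hs : symbol g z = 1 := by
    have h1 : closure (unitConormal g H) ⊆ {z | symbol g z = 1} :=
      closure_minimal (fun z hz => hz.2) (isClosed_eq (continuous_symbol g) continuous_const)
    exact h1 hz
  have hp : z.proj ∈ H := by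
    have h1 : closure (unitConormal g H) ⊆ {z | z.proj ∈ H} :=
      closure_minimal (fun z hz => hz.1.1) (hHc.isClosed.preimage continuous_proj_cotangent)
    exact h1 hz
  obtain ⟨φ, hφ, hx⟩ := hH.2 _ hp
  refine ⟨(mem_conormal_iff hφ hx).2 ⟨cov_ne_zero_of_symbol_eq_one g hs, ?_⟩, hs⟩
  by_contra hne
  have hc1 : ContinuousAt (fun w => conormalEmb n d (conormalCoord d φ w)) z :=
    ContinuousAt.comp (g := conormalEmb n d) (f := conormalCoord d φ)
      (conormalEmb n d).continuous.continuousAt (contMDiffAt_conormalCoord hφ hx).continuousAt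
  have hc2 : ContinuousAt (cotCoord φ) z := (contMDiffAt_cotCoord hφ.1 hx).continuousAt
  have h1 := (hc1.ne_iff_eventually_ne hc2).1 hne
  obtain ⟨w, hw, hwS⟩ := mem_closure_iff_nhds.1 hz _
    (inter_mem h1 ((isOpen_proj_preimage φ.open_source).mem_nhds hx))
  exact hw.1 ((mem_conormal_iff hφ hw.2).1 hwS.1).2

/-- Geodesics leave `H` transversally in conormal directions. The covector `ξ` of `z₀`, read as a
linear function of the base coordinates, vanishes on `H` in an adapted chart. Its derivative along
the flow at `z₀` is `p² = 1` by Euler's identity, hence it stays positive for nearby points and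
short times. If `G^t z` were conormal, the function would vanish at times `0` and `t`, against
Rolle's theorem. -/
theorem eventually_forall_notMem_conormal (hH : IsEmbeddedSubmanifold (n := n) d H)
    {z₀ : Cotangent n M} (hz₀ : z₀ ∈ unitConormal g H) :
    ∃ ε > (0 : ℝ), ∃ U ∈ 𝓝 z₀, ∀ z ∈ U ∩ unitConormal g H, ∀ t : ℝ, t ≠ 0 → |t| < ε →
      geodesicFlow g t z ∉ conormal H := by
  obtain ⟨φ, hφ, hx⟩ := hH.2 _ hz₀.1.1
  set F : Phase n → ℝ := fun u => symbolSq g (cotParam φ u) / 2 with hF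
  set ξ := (cotCoord φ z₀).2 with hξ
  have hcd : ContDiffAt ℝ ∞ F (cotCoord φ z₀) :=
    (contDiffAt_symbolSq_cotParam g hφ.1 (u := cotCoord φ z₀) (φ.map_source hx)).div_const 2
  have hk : ContinuousAt (fun z => fderiv ℝ F (cotCoord φ z) (0, ξ)) z₀ := by
    have h1 : ContinuousAt (fun u => fderiv ℝ F u (0, ξ)) (cotCoord φ z₀) :=
      (hcd.fderiv_right (m := ∞) (by simp)).continuousAt.clm_apply continuousAt_const
    exact ContinuousAt.comp (g := fun u => fderiv ℝ F u (0, ξ)) (f := cotCoord φ) h1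
      (contMDiffAt_cotCoord hφ.1 hx).continuousAt
  have hk0 : fderiv ℝ F (cotCoord φ z₀) (0, ξ) = 1 := by
    rw [hF, hξ, fderiv_symbolSq_cotParam_radial g hφ.1 hx, ← symbol_sq, hz₀.2, one_pow]
  have hW : {z : Cotangent n M | z.proj ∈ φ.source ∧ 0 < fderiv ℝ F (cotCoord φ z) (0, ξ)} ∈
      𝓝 z₀ := by
    refine inter_mem ((isOpen_proj_preimage φ.open_source).mem_nhds hx) ?_
    exact hk.eventually (lt_mem_nhds (by simp only [hk0]; exact one_pos))
  have hG : ContinuousAt (fun p : ℝ × Cotangent n M => geodesicFlow g p.1 p.2) (0, z₀) :=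
    (continuousOn_geodesicFlow g).continuousAt
      ((isOpen_univ.prod (isOpen_cov_ne_zero g)).mem_nhds ⟨mem_univ _, hz₀.1.2.1⟩)
  have hG0 : geodesicFlow g 0 z₀ = z₀ := geodesicFlow_zero g hz₀.1.2.1
  have hpre := hG.preimage_mem_nhds (by simp only [hG0]; exact hW)
  obtain ⟨V, hV, U, hU, hVU⟩ := mem_nhds_prod_iff.1 hpre
  obtain ⟨ε, hε, hεV⟩ := Metric.mem_nhds_iff.1 hV
  refine ⟨ε, hε, U, hU, ?_⟩
  rintro z ⟨hzU, hz⟩ t ht0 htε htc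
  have hcurve : IsMIntegralCurve (I := cotModel n) (fun s => geodesicFlow g s z) (spray g) := by
    refine isMIntegralCurve_spray_of_symbol g (geodesicFlow_spec g hz.1.2.1).2 ?_
    rw [geodesicFlow_zero g hz.1.2.1]
    exact hz.2
  have hin : ∀ s, |s| < ε → (geodesicFlow g s z).proj ∈ φ.source ∧
      0 < fderiv ℝ F (cotCoord φ (geodesicFlow g s z)) (0, ξ) := by
    intro s hs
    have : (s, z) ∈ V ×ˢ U := ⟨hεV (by simpa using hs), hzU⟩
    exact hVU this
  have hderiv : ∀ s, |s| < ε → HasDerivAt (fun s => ξ (cotCoord φ (geodesicFlow g s z)).1)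
      (fderiv ℝ F (cotCoord φ (geodesicFlow g s z)) (0, ξ)) s := by
    intro s hs
    have h1 := hasDerivAt_cotCoord_comp g hφ.1 hcurve (hin s hs).1
    have h2 := (ξ.comp (ContinuousLinearMap.fst ℝ (Eucl n) (Eucl n →L[ℝ] ℝ))).hasFDerivAt
      |>.comp_hasDerivAt s h1
    rw [← apply_sharp_fst]
    exact h2
  -- `ξ` has only components with index at least `d`, and a point of `H` only coordinates with index
  -- below `d`.
  have hzero : ∀ w ∈ conormal H, w.proj ∈ φ.source → ξ (cotCoord φ w).1 = 0 := by
    intro w hw hwφ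
    have h1 := ((mem_conormal_iff hφ hwφ).1 hw).2
    have h2 := ((mem_conormal_iff hφ hx).1 hz₀.1).2
    rw [hξ, ← h1, ← h2, covector_eq_sum (conormalEmb n d (conormalCoord d φ z₀)).2,
      _root_.sum_apply]
    refine Finset.sum_eq_zero fun i _ => ?_
    rw [_root_.smul_apply]
    simp only [conormalEmb_apply, comps_fiberPart]
    by_cases hi : i.val < d
    · simp [hi]
    · have : dualCoord i (basePart d (conormalCoord d φ w)) = 0 := by
        simp [dualCoord, basePart_apply, hi]
      rw [this, smul_zero]
  have hf0 : ξ (cotCoord φ (geodesicFlow g 0 z)).1 = 0 := by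
    refine hzero _ ?_ (hin 0 (by simpa using hε)).1
    rw [geodesicFlow_zero g hz.1.2.1]
    exact hz.1
  have hft : ξ (cotCoord φ (geodesicFlow g t z)).1 = 0 := hzero _ htc (hin t htε).1
  have hlt : min 0 t < max 0 t := min_lt_max.2 ht0.symm
  have habs : ∀ s ∈ Icc (min 0 t) (max 0 t), |s| < ε := by
    intro s hs
    refine lt_of_le_of_lt ?_ htε
    rcases le_total 0 t with h | h
    · rw [min_eq_left h, max_eq_right h] at hs
      rw [abs_of_nonneg hs.1, abs_of_nonneg h]
      exact hs.2
    · rw [min_eq_right h, max_eq_left h] at hs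
      rw [abs_of_nonpos hs.2, abs_of_nonpos h]
      linarith [hs.1]
  obtain ⟨s, hs, hs0⟩ := exists_hasDerivAt_eq_zero hlt
    (f := fun s => ξ (cotCoord φ (geodesicFlow g s z)).1)
    (f' := fun s => fderiv ℝ F (cotCoord φ (geodesicFlow g s z)) (0, ξ))
    (fun s hs => (hderiv s (habs s hs)).continuousAt.continuousWithinAt)
    (by rcases le_total 0 t with h | h <;> simp [h, hf0, hft])
    fun s hs => hderiv s (habs s (Ioo_subset_Icc_self hs))
  exact (hin s (habs s (Ioo_subset_Icc_self hs))).2.ne' hs0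

theorem exists_forall_notMem_conormal (hH : IsEmbeddedSubmanifold (n := n) d H)
    (hHc : IsCompact H) :
    ∃ ε > (0 : ℝ), ∀ z ∈ unitConormal g H, ∀ t : ℝ, t ≠ 0 → |t| < ε →
      geodesicFlow g t z ∉ conormal H := by
  refine (isCompact_unitConormal g hH hHc).induction_on (p := fun s => ∃ ε > (0 : ℝ), ∀ z ∈ s,
    ∀ t : ℝ, t ≠ 0 → |t| < ε → geodesicFlow g t z ∉ conormal H) ⟨1, one_pos, by simp⟩ ?_ ?_ ?_
  · rintro s s' hs ⟨ε, hε, h⟩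
    exact ⟨ε, hε, fun z hz => h z (hs hz)⟩
  · rintro s s' ⟨ε, hε, h⟩ ⟨ε', hε', h'⟩
    refine ⟨min ε ε', lt_min hε hε', fun z hz t ht htε => ?_⟩
    rcases hz with hz | hz
    · exact h z hz t ht (htε.trans_le (min_le_left _ _))
    · exact h' z hz t ht (htε.trans_le (min_le_right _ _))
  · intro z hz
    obtain ⟨ε, hε, U, hU, h⟩ := eventually_forall_notMem_conormal g hH hz
    exact ⟨U ∩ unitConormal g H, inter_mem (mem_nhdsWithin_of_mem_nhds hU) self_mem_nhdsWithin, ε, hε, h⟩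

end Kuznecov

namespace Kuznecov

variable {n : ℕ} {M : Type*} [TopologicalSpace M] [ChartedSpace (Eucl n) M]
  [IsManifold (𝓡 n) ∞ M]

/-! ### Change of adapted charts -/

/-- With `T` block upper triangular and `R` its inverse, the last diagonal block of `R` inverts that
of `T`. `S` has the first block of `T` and the transposed last block of `R` on its diagonal; its
block below the diagonal is irrelevant. -/
theorem det_mul_det_of_block {ι : Type*} [Fintype ι] [DecidableEq ι] (p : ι → Prop)
    [DecidablePred p] {T R S : Matrix ι ι ℝ} (hT : ∀ i, ¬p i → ∀ j, p j → T i j = 0)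
    (hTR : T * R = 1) (h1 : ∀ i, p i → ∀ j, ¬p j → S i j = 0)
    (h2 : ∀ i, p i → ∀ j, p j → S i j = T i j) (h3 : ∀ i, ¬p i → ∀ j, ¬p j → S i j = R j i) :
    S.det * (T.toSquareBlockProp fun i => ¬p i).det = (T.toSquareBlockProp p).det := by
  rw [Matrix.twoBlockTriangular_det' S p h1]
  have e1 : S.toSquareBlockProp p = T.toSquareBlockProp p := by
    ext i j
    exact h2 i i.2 j j.2
  have e2 : (S.toSquareBlockProp fun i => ¬p i) = (R.toSquareBlockProp fun i => ¬p i).transpose := by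
    ext i j
    exact h3 i i.2 j j.2
  have e3 : (T.toSquareBlockProp fun i => ¬p i) * (R.toSquareBlockProp fun i => ¬p i) = 1 := by
    have h := Matrix.toBlock_mul_eq_add (fun i => ¬p i) p (fun i => ¬p i) T R
    have h0 : T.toBlock (fun i => ¬p i) p = 0 := by
      ext i j
      exact hT i i.2 j j.2
    rw [h0, Matrix.zero_mul, zero_add, hTR] at h
    refine h.symm.trans ?_
    ext i j
    simp [Matrix.toBlock, Matrix.one_apply, Subtype.ext_iff]
  have e4 := congrArg Matrix.det e3
  rw [Matrix.det_mul, Matrix.det_one] at e4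
  rw [e1, e2, Matrix.det_transpose, mul_assoc, mul_comm (Matrix.det _) (Matrix.det _), e4, mul_one]

theorem det_toSquareBlockProp_conj {ι : Type*} [Fintype ι] [DecidableEq ι] (p : ι → Prop)
    [DecidablePred p] {T G : Matrix ι ι ℝ} (hT : ∀ i, ¬p i → ∀ j, p j → T i j = 0) :
    ((T.transpose * G * T).toSquareBlockProp p).det =
      (T.toSquareBlockProp p).det ^ 2 * (G.toSquareBlockProp p).det := by
  have h0 : T.toBlock (fun i => ¬p i) p = 0 := by
    ext i j
    exact hT i i.2 j j.2
  have h0' : T.transpose.toBlock p (fun i => ¬p i) = 0 := by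
    ext i j
    exact hT j j.2 i i.2
  have h1 := Matrix.toBlock_mul_eq_add p p p (T.transpose * G) T
  rw [h0, Matrix.toBlock_mul_eq_add p p p T.transpose G, h0', Matrix.zero_mul,
    Matrix.mul_zero, add_zero, add_zero] at h1
  have h2 : (T.transpose * G * T).toSquareBlockProp p =
      (T.toSquareBlockProp p).transpose * G.toSquareBlockProp p * T.toSquareBlockProp p := h1
  rw [h2, Matrix.det_mul, Matrix.det_mul, Matrix.det_transpose]
  ring

theorem det_eq_det_matrix (L : Eucl n →L[ℝ] Eucl n) :
    L.det = (Matrix.of fun k i => L (EuclideanSpace.single i (1 : ℝ)) k).det := by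
  have h : (Matrix.of fun k i => L (EuclideanSpace.single i (1 : ℝ)) k) =
      LinearMap.toMatrix (EuclideanSpace.basisFun (Fin n) ℝ).toBasis
        (EuclideanSpace.basisFun (Fin n) ℝ).toBasis L.toLinearMap := by
    ext k i
    simp [LinearMap.toMatrix_apply]
  rw [h, LinearMap.det_toMatrix]

section Adapted

variable (g : Metric n M) {d : ℕ} {H : Set M} {φ ψ : OpenPartialHomeomorph M (Eucl n)}

theorem densityCoeff_pos (hφ : IsAdapted d H φ) {x : M} (hx : x ∈ φ.source) :
    0 < densityCoeff g d φ x := by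
  have h := gram_posDef g hφ.1 hx
  refine div_pos ?_ (Real.sqrt_pos.2 h.det_pos)
  exact (h.submatrix (e := fun i : {i : Fin n // i.val < d} => (i : Fin n))
    Subtype.val_injective).det_pos

theorem transMatrix_eq_zero (hφ : IsAdapted d H φ) (hψ : IsAdapted d H ψ) {x : M}
    (hx : x ∈ φ.source) (hx' : x ∈ ψ.source) (hxH : x ∈ H) {i j : Fin n} (hi : ¬i.val < d)
    (hj : j.val < d) : transMatrix φ ψ x i j = 0 := by
  have h1 := dchart_apply_eq_zero hψ hx' (coordVec_mem_tangentOf hφ hx hxH hj) (not_lt.1 hi)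
  have h2 : (dchart ψ x (coordVec φ x j) : Eucl n) =
      fderiv ℝ (ψ ∘ φ.symm) (φ x) (EuclideanSpace.single j (1 : ℝ)) := by
    rw [dchart_eq_comp hφ.1 hψ.1 hx hx']
    have h3 := congrArg (fun L : Eucl n →L[ℝ] Eucl n => L (EuclideanSpace.single j (1 : ℝ)))
      (isInvertible_dchart hφ.1 hx).self_comp_inverse
    exact congrArg _ h3
  exact (congrArg (fun v : Eucl n => v i) h2).symm.trans h1

theorem conormalCoord_comp_conormalParam_eventuallyEq (hφ : IsAdapted d H φ) (hψ : IsAdapted d H ψ)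
    {w : Eucl n} (hw : w ∈ conormalDomain d φ) (hwψ : (conormalParam d φ w).proj ∈ ψ.source) :
    conormalCoord d ψ ∘ conormalParam d φ =ᶠ[𝓝 w]
      fun y => conormalPr n d (cotTrans (ψ ∘ φ.symm) (conormalEmb n d y)) := by
  have h1 : ∀ᶠ y in 𝓝 w, (conormalParam d φ y).proj ∈ ψ.source :=
    (contMDiffAt_conormalParam hφ hw.1).continuousAt.preimage_mem_nhds
      ((isOpen_proj_preimage ψ.open_source).mem_nhds hwψ)
  filter_upwards [h1, isOpen_conormalDomain.mem_nhds hw] with y hy hyd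
  rw [Function.comp_apply, conormalCoord_eq,
    cotCoord_eq_cotTrans hφ.1 hψ.1 (proj_conormalParam_mem hyd) hy, cotCoord_conormalParam hφ hyd]

theorem contDiffAt_conormalCoord_comp_conormalParam (hφ : IsAdapted d H φ) (hψ : IsAdapted d H ψ)
    {w : Eucl n} (hw : w ∈ conormalDomain d φ) (hwψ : (conormalParam d φ w).proj ∈ ψ.source) :
    ContDiffAt ℝ ∞ (conormalCoord d ψ ∘ conormalParam d φ) w :=
  (ContMDiffAt.comp w (contMDiffAt_conormalCoord hψ hwψ)
    (contMDiffAt_conormalParam hφ hw.1)).contDiffAt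

/-- At a point of `H` the Jacobian `T` of the change of base coordinates is block triangular with
diagonal blocks of determinants `A` and `D`. The coordinates `x'` change by the first block and
`ξ''` by the inverse transpose of the second, so `(x', ξ'')` has Jacobian `|A|/|D|`. The coefficient
`|g_H| / |g|^{1/2}` picks up `A² / |A D|`, which is the same factor. -/
theorem abs_det_mul_densityCoeff (hφ : IsAdapted d H φ) (hψ : IsAdapted d H ψ)
    {w : Eucl n} (hw : w ∈ conormalDomain d φ) (hwψ : (conormalParam d φ w).proj ∈ ψ.source) :
    |(fderiv ℝ (conormalCoord d ψ ∘ conormalParam d φ) w).det| *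
        densityCoeff g d ψ (conormalParam d φ w).proj =
      densityCoeff g d φ (conormalParam d φ w).proj := by
  set x := (conormalParam d φ w).proj with hx_def
  have hx : x ∈ φ.source := proj_conormalParam_mem hw
  have hxH : x ∈ H := (conormalParam_mem_conormal hφ hw).1
  have hφx : φ x = basePart d w := φ.right_inv hw.1
  set L := fderiv ℝ (ψ ∘ φ.symm) (φ x) with hL
  have hLinv : L.IsInvertible := isInvertible_fderiv_transition hφ.1 hψ.1 hx hwψ
  set T := transMatrix φ ψ x with hT
  set R : Matrix (Fin n) (Fin n) ℝ :=
    Matrix.of fun k i => L.inverse (EuclideanSpace.single i (1 : ℝ)) k with hR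
  set F := fun y => conormalPr n d (cotTrans (ψ ∘ φ.symm) (conormalEmb n d y)) with hF
  have hFev := conormalCoord_comp_conormalParam_eventuallyEq hφ hψ hw hwψ
  have hFd : DifferentiableAt ℝ F w :=
    ((contDiffAt_conormalCoord_comp_conormalParam hφ hψ hw hwψ).congr_of_eventuallyEq
      hFev.symm).differentiableAt (by simp)
  set S : Matrix (Fin n) (Fin n) ℝ :=
    Matrix.of fun k i => fderiv ℝ F w (EuclideanSpace.single i (1 : ℝ)) k with hS
  have hline : ∀ j : Fin n, HasDerivAt (fun s : ℝ => w + s • (EuclideanSpace.single j (1 : ℝ) :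
      Eucl n)) (EuclideanSpace.single j (1 : ℝ)) 0 := fun j => by
    simpa using ((hasDerivAt_id (0 : ℝ)).smul_const
      (EuclideanSpace.single j (1 : ℝ) : Eucl n)).const_add w
  have hSd : ∀ i j, HasDerivAt (fun s : ℝ => F (w + s • (EuclideanSpace.single j (1 : ℝ) :
      Eucl n)) i) (S i j) 0 := by
    intro i j
    have h0 : w = w + (0 : ℝ) • (EuclideanSpace.single j (1 : ℝ) : Eucl n) := by simp
    have h1 : HasFDerivAt F (fderiv ℝ F w) (w + (0 : ℝ) • (EuclideanSpace.single j (1 : ℝ) :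
      Eucl n)) := by
      rw [← h0]
      exact hFd.hasFDerivAt
    have h2 := HasFDerivAt.comp_hasDerivAt (0 : ℝ) h1 (hline j)
    exact (dualCoord i).hasFDerivAt.comp_hasDerivAt (0 : ℝ) h2
  have hTR : T * R = 1 := by
    ext i j
    have h1 := congrArg (fun A : Eucl n →L[ℝ] Eucl n => A (EuclideanSpace.single j (1 : ℝ)) i)
      hLinv.self_comp_inverse
    simp only [ContinuousLinearMap.comp_apply] at h1
    rw [eucl_eq_sum (L.inverse _), map_sum] at h1
    simp only [map_smul] at h1
    rw [Matrix.mul_apply]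
    simp only [hT, hR, transMatrix, Matrix.of_apply, Matrix.one_apply]
    rw [WithLp.ofLp_sum, Finset.sum_apply] at h1
    simp only [PiLp.smul_apply, smul_eq_mul] at h1
    refine (Finset.sum_congr rfl fun k _ => mul_comm _ _).trans (h1.trans ?_)
    simp
  have hTd : DifferentiableAt ℝ (ψ ∘ φ.symm) (basePart d w) :=
    ((contDiffOn_transition hφ.1 hψ.1).contDiffAt ((φ.symm.trans ψ).open_source.mem_nhds
      ⟨hw.1, hwψ⟩)).differentiableAt (by simp)
  -- The new `x'` depends only on the old base point, so these rows see the base part of the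
  -- direction alone, which is zero for the fiber directions.
  have hSlow : ∀ i j : Fin n, i.val < d → S i j = L (basePart d (EuclideanSpace.single j 1)) i := by
    intro i j hi
    have hb : HasDerivAt (fun s : ℝ => (conormalEmb n d (w + s • EuclideanSpace.single j 1)).1)
        (basePart d (EuclideanSpace.single j 1)) 0 :=
      ((ContinuousLinearMap.fst ℝ (Eucl n) (Eucl n →L[ℝ] ℝ)).comp (conormalEmb n d)).hasFDerivAt
        |>.comp_hasDerivAt (0 : ℝ) (hline j)
    have h1 : HasFDerivAt (ψ ∘ φ.symm) L
        (conormalEmb n d (w + (0 : ℝ) • EuclideanSpace.single j 1)).1 := by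
      rw [zero_smul, add_zero, hL, hφx]
      exact hTd.hasFDerivAt
    have h2 := HasFDerivAt.comp_hasDerivAt (0 : ℝ) h1 hb
    have h3 := (dualCoord i).hasFDerivAt.comp_hasDerivAt (0 : ℝ) h2
    refine (hSd i j).unique (h3.congr_of_eventuallyEq (Filter.Eventually.of_forall fun s => ?_))
    simp only [hF, conormalPr_apply, if_pos hi]
    rfl
  have hbase : ∀ j : Fin n, ¬j.val < d → basePart d (EuclideanSpace.single j (1 : ℝ)) = 0 := by
    intro j hj
    ext k
    rw [basePart_apply]
    by_cases hk : k.val < d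
    · have : k ≠ j := fun h => hj (h ▸ hk)
      simp [hk, this]
    · simp [hk]
  have hfib : ∀ j : Fin n, ¬j.val < d → fiberPart d (EuclideanSpace.single j (1 : ℝ)) =
      dualCoord j := by
    intro j hj
    refine comps_injective ?_
    ext k
    rw [comps_fiberPart]
    by_cases hk : k.val < d
    · have : j ≠ k := fun h => hj (h ▸ hk)
      simp [hk, comps, dualCoord, this]
    · simp [hk, comps, dualCoord, eq_comm]
  have hblock := det_mul_det_of_block (fun i : Fin n => i.val < d) (T := T) (R := R) (S := S)
    (fun i hi j hj => transMatrix_eq_zero hφ hψ hx hwψ hxH hi hj) hTR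
    (fun i hi j hj => by
      rw [hSlow i j hi, hbase j hj, map_zero]
      rfl)
    (fun i hi j hj => by
      rw [hSlow i j hi]
      have : basePart d (EuclideanSpace.single j (1 : ℝ)) = EuclideanSpace.single j 1 := by
        ext k
        rw [basePart_apply]
        by_cases hk : k.val < d
        · simp [hk]
        · have : k ≠ j := fun h => hk (h ▸ hj)
          simp [hk, this]
      rw [this]
      rfl)
    (fun i hi j hj => by
      refine (hSd i j).unique ?_
      -- Along a fiber direction the base point is fixed and the covector varies affinely, so the
      -- derivative is an entry of the inverse of `L`.
      have h1 : (fun s : ℝ => F (w + s • (EuclideanSpace.single j (1 : ℝ) : Eucl n)) i) =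
          fun s : ℝ => fiberPart d w (L.inverse (EuclideanSpace.single i 1)) + s * R j i := by
        funext s
        simp only [hF, conormalPr_apply, if_neg hi]
        have h2 : conormalEmb n d (w + s • EuclideanSpace.single j (1 : ℝ)) =
            (φ x, fiberPart d w + s • dualCoord j) := by
          rw [map_add, map_smul, conormalEmb_apply, conormalEmb_apply, hbase j hj, hfib j hj, hφx]
          simp
        rw [h2]
        simp only [cotTrans, comps, ← hL, ContinuousLinearMap.comp_apply, _root_.add_apply,
          _root_.smul_apply, smul_eq_mul]
        rfl
      rw [h1]
      simpa using ((hasDerivAt_id (0 : ℝ)).mul_const (R j i)).const_add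
        (fiberPart d w (L.inverse (EuclideanSpace.single i 1))))
  have hTdet := Matrix.twoBlockTriangular_det T (fun i : Fin n => i.val < d)
    (fun i hi j hj => transMatrix_eq_zero hφ hψ hx hwψ hxH hi hj)
  have hTne : T.det ≠ 0 := (isUnit_det_transMatrix hφ.1 hψ.1 hx hwψ).ne_zero
  have hgram := gram_eq_mul g hφ.1 hψ.1 hx hwψ
  have hGb := det_toSquareBlockProp_conj (fun i : Fin n => i.val < d) (T := T) (G := gram g ψ x)
    (fun i hi j hj => transMatrix_eq_zero hφ hψ hx hwψ hxH hi hj)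
  rw [← hgram] at hGb
  have hGd : (gram g φ x).det = T.det ^ 2 * (gram g ψ x).det := by
    rw [hgram, Matrix.det_mul, Matrix.det_mul, Matrix.det_transpose]
    ring
  rw [hFev.fderiv_eq, det_eq_det_matrix, ← hS]
  unfold densityCoeff
  rw [hGb, hGd, Real.sqrt_mul (sq_nonneg _), Real.sqrt_sq_eq_abs, hTdet, abs_mul]
  rw [hTdet] at hTne
  set A := (T.toSquareBlockProp fun i : Fin n => i.val < d).det
  set D := (T.toSquareBlockProp fun i : Fin n => ¬i.val < d).det
  have hA : A ≠ 0 := left_ne_zero_of_mul hTne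
  have hD : D ≠ 0 := right_ne_zero_of_mul hTne
  have hpos : Real.sqrt (gram g ψ x).det ≠ 0 :=
    (Real.sqrt_pos.2 (gram_posDef g hψ.1 hwψ).det_pos).ne'
  have h5 : |S.det| * |D| = |A| := by rw [← abs_mul, hblock]
  have h6 : |S.det| = |A| / |D| := by rw [eq_div_iff (abs_ne_zero.2 hD), h5]
  rw [h6, ← sq_abs A]
  have := abs_ne_zero.2 hA
  have := abs_ne_zero.2 hD
  field_simp

end Adapted

end Kuznecov

namespace Kuznecov

variable {n : ℕ} {M : Type*} [TopologicalSpace M] [ChartedSpace (Eucl n) M]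
  [IsManifold (𝓡 n) ∞ M]

/-! ### Natural volumes in adapted charts -/

theorem measurableSet_inter_preimage_of_continuousOn {X Y : Type*} [TopologicalSpace X]
    [MeasurableSpace X] [BorelSpace X] [TopologicalSpace Y] [MeasurableSpace Y] [BorelSpace Y]
    {f : X → Y} {s : Set X} {t : Set Y} (hf : ContinuousOn f s) (hs : MeasurableSet s)
    (ht : MeasurableSet t) : MeasurableSet (s ∩ f ⁻¹' t) := by
  have h1 : MeasurableSet (s.domRestrict f ⁻¹' t) :=
    (continuousOn_iff_continuous_domRestrict.1 hf).measurable ht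
  have h2 := hs.subtype_image h1
  convert! h2 using 1
  ext x
  simp [Set.domRestrict, and_comm]

theorem measurable_indicator_of_subtype {X Z : Type*} [MeasurableSpace X] [MeasurableSpace Z]
    [Zero Z] {f : X → Z} {s : Set X} (hs : MeasurableSet s)
    (hf : Measurable fun x : s => f x) : Measurable (s.indicator f) := by
  intro t ht
  have h1 : s.indicator f ⁻¹' t =
      Subtype.val '' ((fun x : s => f x) ⁻¹' t) ∪ (sᶜ ∩ (fun _ => (0 : Z)) ⁻¹' t) := by
    ext x
    by_cases hx : x ∈ s <;> simp [hx]
  rw [h1]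
  exact (hs.subtype_image (hf ht)).union (hs.compl.inter (measurable_const ht))

section Adapted

variable (g : Metric n M) {d : ℕ} {H : Set M} {φ ψ : OpenPartialHomeomorph M (Eucl n)}

theorem continuousOn_densityCoeff (hφ : IsAdapted d H φ) :
    ContinuousOn (densityCoeff g d φ) φ.source := by
  intro x hx
  refine ContinuousAt.continuousWithinAt ?_
  have hg : ContinuousAt (fun y => gram g φ y) x :=
    continuousAt_pi.2 fun i => continuousAt_pi.2 fun j =>
      (contMDiffAt_gram g hφ.1 hx i j).continuousAt
  have h1 : ContinuousAt (fun y => (gram g φ y).det) x :=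
    ContinuousAt.comp (g := fun A : Matrix (Fin n) (Fin n) ℝ => A.det) (f := fun y => gram g φ y)
      (continuous_id.matrix_det).continuousAt hg
  have h2 : Continuous fun A : Matrix (Fin n) (Fin n) ℝ =>
      (A.toSquareBlockProp fun i : Fin n => i.val < d).det :=
    Continuous.matrix_det (continuous_pi fun i => continuous_pi fun j =>
      (continuous_apply (j : Fin n)).comp (continuous_apply (i : Fin n)))
  have h3 : ContinuousAt (fun y => ((gram g φ y).toSquareBlockProp fun i : Fin n =>
      i.val < d).det) x :=
    ContinuousAt.comp (f := fun y => gram g φ y) h2.continuousAt hg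
  exact h3.div (Real.continuous_sqrt.continuousAt.comp h1)
    (Real.sqrt_pos.2 (gram_posDef g hφ.1 hx).det_pos).ne'

theorem continuousOn_conormalParam (hφ : IsAdapted d H φ) :
    ContinuousOn (conormalParam d φ) {w | basePart d w ∈ φ.target} := fun _ hw =>
  (contMDiffAt_conormalParam hφ hw).continuousAt.continuousWithinAt

theorem continuousOn_conormalCoord (hφ : IsAdapted d H φ) :
    ContinuousOn (conormalCoord d φ) {z | z.proj ∈ φ.source} := fun _ hz =>
  (contMDiffAt_conormalCoord hφ hz).continuousAt.continuousWithinAt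

theorem conormalDomain_subset : conormalDomain d φ ⊆ {w | basePart d w ∈ φ.target} :=
  fun _ hw => hw.1

theorem continuousOn_densityCoeff_comp (hφ : IsAdapted d H φ) :
    ContinuousOn (fun w => densityCoeff g d φ (φ.symm (basePart d w)))
      {w | basePart d w ∈ φ.target} :=
  (continuousOn_densityCoeff g hφ).comp
    (continuous_proj_cotangent.comp_continuousOn (continuousOn_conormalParam hφ))
    fun _ hw => φ.map_target hw

theorem aemeasurable_conormalParam (hφ : IsAdapted d H φ) :
    AEMeasurable (conormalParam d φ) (((volume : Measure (Eucl n)).restrict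
      (conormalDomain d φ)).withDensity
      fun w => ENNReal.ofReal (densityCoeff g d φ (φ.symm (basePart d w)))) :=
  (((continuousOn_conormalParam hφ).mono conormalDomain_subset).aemeasurable
    isOpen_conormalDomain.measurableSet).mono_ac (withDensity_absolutelyContinuous _ _)

theorem aemeasurable_densityCoeff_comp (hφ : IsAdapted d H φ) :
    AEMeasurable (fun w => ENNReal.ofReal (densityCoeff g d φ (φ.symm (basePart d w))))
      ((volume : Measure (Eucl n)).restrict (conormalDomain d φ)) :=
  (((continuousOn_densityCoeff_comp g hφ).mono conormalDomain_subset).aemeasurable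
    isOpen_conormalDomain.measurableSet).ennreal_ofReal

theorem localVolume_apply (hφ : IsAdapted d H φ) {A : Set (Cotangent n M)} (hA : MeasurableSet A) :
    localVolume g d φ A = ∫⁻ w in conormalDomain d φ ∩ conormalParam d φ ⁻¹' A,
      ENNReal.ofReal (densityCoeff g d φ (φ.symm (basePart d w))) := by
  have hX : MeasurableSet (conormalDomain d φ ∩ conormalParam d φ ⁻¹' A) :=
    measurableSet_inter_preimage_of_continuousOn
      ((continuousOn_conormalParam hφ).mono conormalDomain_subset)
      isOpen_conormalDomain.measurableSet hA
  rw [localVolume, Measure.map_apply_of_aemeasurable (aemeasurable_conormalParam g hφ) hA]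
  have h1 : ∀ ν : Measure (Eucl n), ν (conormalDomain d φ)ᶜ = 0 →
      ν (conormalParam d φ ⁻¹' A) = ν (conormalDomain d φ ∩ conormalParam d φ ⁻¹' A) := by
    intro ν hν
    refine le_antisymm ?_ (measure_mono inter_subset_right)
    calc ν (conormalParam d φ ⁻¹' A)
        ≤ ν (conormalDomain d φ ∩ conormalParam d φ ⁻¹' A ∪ (conormalDomain d φ)ᶜ) :=
          measure_mono fun w hw => by
            by_cases h : w ∈ conormalDomain d φ
            · exact Or.inl ⟨h, hw⟩
            · exact Or.inr h
      _ ≤ _ := measure_union_le _ _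
      _ = _ := by rw [hν, add_zero]
  rw [h1, withDensity_apply _ hX, Measure.restrict_restrict hX, inter_assoc, inter_comm,
    inter_assoc, inter_self, inter_comm]
  refine withDensity_absolutelyContinuous _ _ ?_
  rw [Measure.restrict_apply isOpen_conormalDomain.measurableSet.compl, compl_inter_self,
    measure_empty]

/-- Only an inequality, since `f` is arbitrary; upper bounds are all that the argument uses, and
they require no measurability of the integrand. -/
theorem lintegral_localVolume_le (hφ : IsAdapted d H φ) {A : Set (Cotangent n M)}
    (hA : MeasurableSet A) (f : Cotangent n M → ℝ≥0∞) :
    ∫⁻ z in A, f z ∂(localVolume g d φ) ≤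
      ∫⁻ w in conormalDomain d φ ∩ conormalParam d φ ⁻¹' A,
        ENNReal.ofReal (densityCoeff g d φ (φ.symm (basePart d w))) * f (conormalParam d φ w) := by
  have hX : MeasurableSet (conormalDomain d φ ∩ conormalParam d φ ⁻¹' A) :=
    measurableSet_inter_preimage_of_continuousOn
      ((continuousOn_conormalParam hφ).mono conormalDomain_subset)
      isOpen_conormalDomain.measurableSet hA
  rw [← lintegral_indicator hA]
  refine (lintegral_map_le _ _).trans ?_
  have hae := aemeasurable_densityCoeff_comp g hφ
  rw [withDensity_congr_ae hae.ae_eq_mk]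
  refine (lintegral_withDensity_le_lintegral_mul _ hae.measurable_mk _).trans ?_
  have hcongr : ∀ᵐ w ∂(volume : Measure (Eucl n)).restrict (conormalDomain d φ),
      (hae.mk _ * fun w => A.indicator (fun z => f z) (conormalParam d φ w)) w =
        ENNReal.ofReal (densityCoeff g d φ (φ.symm (basePart d w))) *
          A.indicator (fun z => f z) (conormalParam d φ w) := by
    filter_upwards [hae.ae_eq_mk] with w hw
    rw [Pi.mul_apply, ← hw]
  rw [lintegral_congr_ae hcongr]
  rw [← lintegral_indicator isOpen_conormalDomain.measurableSet, ← lintegral_indicator hX]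
  refine lintegral_mono fun w => ?_
  by_cases h1 : w ∈ conormalDomain d φ
  · by_cases h2 : conormalParam d φ w ∈ A
    · simp [h1, h2]
    · simp [h1, h2]
  · simp [h1]

theorem localVolume_compl_conormal (hφ : IsAdapted d H φ) {A : Set (Cotangent n M)}
    (hA : MeasurableSet A) (h : ∀ z ∈ conormal H, z.proj ∈ φ.source → z ∉ A) :
    localVolume g d φ A = 0 := by
  rw [localVolume_apply g hφ hA]
  have : conormalDomain d φ ∩ conormalParam d φ ⁻¹' A = ∅ := by
    refine eq_empty_of_forall_notMem ?_
    rintro w ⟨hw, hwA⟩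
    exact h _ (conormalParam_mem_conormal hφ hw) (proj_conormalParam_mem hw) hwA
  rw [this, setLIntegral_empty]

/-- The Jacobian of a map `Φ` of conormal bundles with respect to the natural volumes, computed
in the adapted charts `φ` and `ψ`. -/
def volRatio (g : Metric n M) (d : ℕ) (φ ψ : OpenPartialHomeomorph M (Eucl n))
    (Φ : Cotangent n M → Cotangent n M) (z : Cotangent n M) : ℝ :=
  |(fderiv ℝ (fun w => conormalCoord d ψ (Φ (conormalParam d φ w))) (conormalCoord d φ z)).det|
    * densityCoeff g d ψ (Φ z).proj / densityCoeff g d φ z.proj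

/-- The default derivative `0` has determinant `0` only if `n > 0`; for `n = 0` the determinant
would be `1`, but then every map is differentiable. -/
theorem det_fderiv_eq_zero {F : Eucl n → Eucl n} {w : Eucl n} (h : ¬DifferentiableAt ℝ F w) :
    (fderiv ℝ F w).det = 0 := by
  rcases Nat.eq_zero_or_pos n with rfl | hn
  · exact absurd (hasFDerivAt_of_subsingleton F w).differentiableAt h
  · rw [fderiv_zero_of_not_differentiableAt h, det_eq_det_matrix]
    have : Nonempty (Fin n) := ⟨⟨0, hn⟩⟩
    have h0 : (Matrix.of fun (k i : Fin n) =>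
        (0 : Eucl n →L[ℝ] Eucl n) (EuclideanSpace.single i (1 : ℝ)) k) = 0 := by
      ext k i
      rfl
    rw [h0, Matrix.det_zero]

/-- Injective change of variables in coordinates. It is carried out on the measurable set of points
where the coordinate map `F` is differentiable; the remaining points contribute nothing because
their Jacobian is zero by convention. So no regularity of `Φ` is assumed. -/
theorem lintegral_volRatio_le (hφ : IsAdapted d H φ) (hψ : IsAdapted d H ψ)
    {Φ : Cotangent n M → Cotangent n M} {A B : Set (Cotangent n M)} (hA : MeasurableSet A)
    (hB : MeasurableSet B)
    (hAψ : ∀ z ∈ A, Φ z ∈ conormal H ∧ (Φ z).proj ∈ ψ.source) (hinj : InjOn Φ A)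
    (hmaps : MapsTo Φ A B) :
    ∫⁻ z in A, ENNReal.ofReal (volRatio g d φ ψ Φ z) ∂(localVolume g d φ) ≤
      localVolume g d ψ B := by
  set F : Eucl n → Eucl n := fun w => conormalCoord d ψ (Φ (conormalParam d φ w)) with hF
  set X := conormalDomain d φ ∩ conormalParam d φ ⁻¹' A with hX_def
  have hX : MeasurableSet X :=
    measurableSet_inter_preimage_of_continuousOn
      ((continuousOn_conormalParam hφ).mono conormalDomain_subset)
      isOpen_conormalDomain.measurableSet hA
  set Y := X ∩ {w | DifferentiableAt ℝ F w} with hY_def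
  have hY : MeasurableSet Y := hX.inter (measurableSet_of_differentiableAt ℝ F)
  have hparam : ∀ w ∈ X, conormalParam d ψ (F w) = Φ (conormalParam d φ w) := fun w hw =>
    conormalParam_conormalCoord hψ (hAψ _ hw.2).2 (hAψ _ hw.2).1
  have hFinj : InjOn F X := by
    intro w hw w' hw' h
    have h1 : Φ (conormalParam d φ w) = Φ (conormalParam d φ w') := by
      rw [← hparam w hw, ← hparam w' hw', h]
    rw [← conormalCoord_conormalParam hφ hw.1, hinj hw.2 hw'.2 h1,
      conormalCoord_conormalParam hφ hw'.1]
  refine (lintegral_localVolume_le g hφ hA _).trans ?_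
  calc ∫⁻ w in X, ENNReal.ofReal (densityCoeff g d φ (φ.symm (basePart d w))) *
          ENNReal.ofReal (volRatio g d φ ψ Φ (conormalParam d φ w))
      = ∫⁻ w in X, ENNReal.ofReal |(fderiv ℝ F w).det| *
          ENNReal.ofReal (densityCoeff g d ψ (ψ.symm (basePart d (F w)))) := by
        refine setLIntegral_congr_fun hX fun w hw => ?_
        have hpos := densityCoeff_pos g hφ (proj_conormalParam_mem hw.1)
        have h1 : ψ.symm (basePart d (F w)) = (Φ (conormalParam d φ w)).proj := by
          rw [← hparam w hw]
          rfl
        change ENNReal.ofReal (densityCoeff g d φ (conormalParam d φ w).proj) * _ = _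
        rw [← ENNReal.ofReal_mul hpos.le, ← ENNReal.ofReal_mul (abs_nonneg _), h1, volRatio,
          conormalCoord_conormalParam hφ hw.1]
        congr 1
        field_simp
        rw [mul_comm, hF]
    _ = ∫⁻ w in Y, ENNReal.ofReal |(fderiv ℝ F w).det| *
          ENNReal.ofReal (densityCoeff g d ψ (ψ.symm (basePart d (F w)))) := by
        rw [← lintegral_indicator hX, ← lintegral_indicator hY]
        refine lintegral_congr fun w => ?_
        by_cases h1 : w ∈ X
        · by_cases h2 : DifferentiableAt ℝ F w
          · rw [indicator_of_mem h1, indicator_of_mem (show w ∈ Y from ⟨h1, h2⟩)]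
          · rw [indicator_of_mem h1, indicator_of_notMem fun h => h2 h.2, det_fderiv_eq_zero h2]
            simp
        · rw [indicator_of_notMem h1, indicator_of_notMem fun h => h1 h.1]
    _ = ∫⁻ y in F '' Y, ENNReal.ofReal (densityCoeff g d ψ (ψ.symm (basePart d y))) :=
        (lintegral_image_eq_lintegral_abs_det_fderiv_mul volume hY
          (fun w hw => hw.2.hasFDerivAt.hasFDerivWithinAt) (hFinj.mono inter_subset_left)
          fun y => ENNReal.ofReal (densityCoeff g d ψ (ψ.symm (basePart d y)))).symm
    _ ≤ localVolume g d ψ B := by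
        rw [localVolume_apply g hψ hB]
        refine lintegral_mono_set ?_
        rintro _ ⟨w, hw, rfl⟩
        refine ⟨conormalCoord_mem_conormalDomain hψ (hAψ _ hw.1.2).2 (hAψ _ hw.1.2).1, ?_⟩
        rw [mem_preimage, hparam w hw.1]
        exact hmaps hw.1.2

theorem volRatio_id (hφ : IsAdapted d H φ) (hψ : IsAdapted d H ψ) {z : Cotangent n M}
    (hz : z ∈ conormal H) (hzφ : z.proj ∈ φ.source) (hzψ : z.proj ∈ ψ.source) :
    volRatio g d φ ψ id z = 1 := by
  have hw := conormalCoord_mem_conormalDomain hφ hzφ hz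
  have hp := conormalParam_conormalCoord hφ hzφ hz
  have h := abs_det_mul_densityCoeff g hφ hψ hw (by rw [hp]; exact hzψ)
  rw [hp] at h
  change |(fderiv ℝ (conormalCoord d ψ ∘ conormalParam d φ) (conormalCoord d φ z)).det| *
    densityCoeff g d ψ z.proj / densityCoeff g d φ z.proj = 1
  rw [h, div_self (densityCoeff_pos g hφ hzφ).ne']

/-- The change of variables for `Φ = id`, whose volume ratio is `1` on the conormal bundle; the rest
of `A` has no mass for the chart `φ`. -/
theorem localVolume_le_localVolume (hφ : IsAdapted d H φ) (hψ : IsAdapted d H ψ)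
    (hN : MeasurableSet (conormal H : Set (Cotangent n M))) {A : Set (Cotangent n M)} (hA : MeasurableSet A)
    (hAψ : ∀ z ∈ A, z.proj ∈ ψ.source) : localVolume g d φ A ≤ localVolume g d ψ A := by
  set A' := A ∩ (conormal H ∩ {z | z.proj ∈ φ.source}) with hA'_def
  have hN' : MeasurableSet (conormal H ∩ {z | z.proj ∈ φ.source}) :=
    hN.inter (isOpen_proj_preimage φ.open_source).measurableSet
  have hA' : MeasurableSet A' := hA.inter hN'
  have h1 := lintegral_volRatio_le g hφ hψ (Φ := id) hA' hA
    (fun z hz => ⟨hz.2.1, hAψ z hz.1⟩) (injOn_id _) fun z hz => hz.1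
  have h2 : ∫⁻ z in A', ENNReal.ofReal (volRatio g d φ ψ id z) ∂(localVolume g d φ) =
      localVolume g d φ A' := by
    rw [← setLIntegral_one]
    refine setLIntegral_congr_fun hA' fun z hz => ?_
    rw [volRatio_id g hφ hψ hz.2.1 hz.2.2 (hAψ z hz.1), ENNReal.ofReal_one]
  have h3 : localVolume g d φ (A \ (conormal H ∩ {z | z.proj ∈ φ.source})) = 0 :=
    localVolume_compl_conormal g hφ (hA.diff hN') fun z hz hzφ hzA => hzA.2 ⟨hz, hzφ⟩
  rw [← measure_inter_add_sdiff A hN', h3, add_zero, ← h2]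
  exact h1

theorem localVolume_le_conormalVolume (hφ : IsAdapted d H φ) :
    localVolume g d φ ≤ conormalVolume g d H :=
  le_iSup₂ (f := fun φ (_ : IsAdapted d H φ) => localVolume g d φ) φ hφ

theorem conormalVolume_restrict_le (hψ : IsAdapted d H ψ) (hN : MeasurableSet (conormal H : Set (Cotangent n M))) :
    (conormalVolume g d H).restrict {z | z.proj ∈ ψ.source} ≤ localVolume g d ψ := by
  have hs : MeasurableSet {z : Cotangent n M | z.proj ∈ ψ.source} :=
    (isOpen_proj_preimage ψ.open_source).measurableSet
  set s := {z : Cotangent n M | z.proj ∈ ψ.source}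
  -- A supremum of measures is hard to evaluate but is the least upper bound. Every local volume
  -- lies below the right side, hence so does the supremum, and on `s` the second summand
  -- disappears.
  have h1 : conormalVolume g d H ≤ localVolume g d ψ + (conormalVolume g d H).restrict sᶜ := by
    refine iSup₂_le fun φ hφ => ?_
    refine Measure.le_iff.2 fun A hA => ?_
    rw [← measure_inter_add_sdiff A hs, Measure.add_apply, Measure.restrict_apply hA, sdiff_eq]
    refine add_le_add ?_ ?_
    · exact (localVolume_le_localVolume g hφ hψ hN (hA.inter hs) fun z hz => hz.2).trans
        (measure_mono inter_subset_left)
    · exact localVolume_le_conormalVolume g hφ _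
  refine Measure.le_iff.2 fun A hA => ?_
  rw [Measure.restrict_apply hA]
  refine (h1 _).trans ?_
  rw [Measure.add_apply, Measure.restrict_apply (hA.inter hs), inter_assoc, inter_compl_self,
    inter_empty, measure_empty, add_zero]
  exact measure_mono inter_subset_left

end Adapted

end Kuznecov

namespace Kuznecov

variable {n : ℕ} {M : Type*} [TopologicalSpace M] [ChartedSpace (Eucl n) M]
  [IsManifold (𝓡 n) ∞ M]

/-! ### Dilations in adapted coordinates -/

theorem dil_mem_conormal_iff {H : Set M} {r : ℝ} (hr : r ≠ 0) {z : Cotangent n M} :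
    dil r z ∈ conormal H ↔ z ∈ conormal H := by
  have key : ∀ (r : ℝ) (z : Cotangent n M), r ≠ 0 → z ∈ conormal H → dil r z ∈ conormal H := by
    rintro r z hr ⟨h1, h2, h3⟩
    refine ⟨h1, smul_ne_zero hr h2, fun v hv => ?_⟩
    have h4 : (dil r z).2 v = r * z.2 v := rfl
    rw [h4, h3 v hv, mul_zero]
  refine ⟨fun h => ?_, key r z hr⟩
  have := key r⁻¹ _ (inv_ne_zero hr) h
  rwa [dil_dil, inv_mul_cancel₀ hr, dil_one] at this

/-- The dilation `(x', ξ'') ↦ (x', r ξ'')`. -/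
def conormalDil (n d : ℕ) (r : ℝ) : Eucl n →L[ℝ] Eucl n :=
  (conormalPr n d).comp ((dilL n r).comp (conormalEmb n d))

theorem conormalDil_apply (d : ℕ) (r : ℝ) (w : Eucl n) (i : Fin n) :
    conormalDil n d r w i = if i.val < d then w i else r * w i := by
  have h : conormalDil n d r w = conormalPr n d (basePart d w, r • fiberPart d w) := rfl
  rw [h, conormalPr_apply]
  by_cases hi : i.val < d
  · simp [hi, basePart_apply]
  · have h1 : comps (r • fiberPart d w) i = r * comps (fiberPart d w) i := rfl
    simp [hi, h1, comps_fiberPart]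

theorem conormalDil_conormalDil (d : ℕ) {r s : ℝ} (h : r * s = 1) (w : Eucl n) :
    conormalDil n d r (conormalDil n d s w) = w := by
  ext i
  rw [conormalDil_apply, conormalDil_apply]
  by_cases hi : i.val < d
  · simp [hi]
  · simp [hi, ← mul_assoc, h]

/-- The dilation `(x', ξ'') ↦ (x', r ξ'')` as an isomorphism. -/
def conormalDilEquiv (n d : ℕ) {r : ℝ} (hr : r ≠ 0) : Eucl n ≃L[ℝ] Eucl n :=
  ContinuousLinearEquiv.equivOfInverse (conormalDil n d r) (conormalDil n d r⁻¹)
    (conormalDil_conormalDil d (inv_mul_cancel₀ hr)) (conormalDil_conormalDil d (mul_inv_cancel₀ hr))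

theorem conormalEmb_conormalDil (d : ℕ) (r : ℝ) (w : Eucl n) :
    conormalEmb n d (conormalDil n d r w) = dilL n r (conormalEmb n d w) := by
  refine conormalEmb_conormalPr (u := dilL n r (conormalEmb n d w)) ?_ ?_
  · intro i hi
    simp [conormalEmb_apply, basePart_apply, not_lt.2 hi]
  · intro i hi
    have h1 : comps (dilL n r (conormalEmb n d w)).2 i = r * comps (fiberPart d w) i := rfl
    rw [h1, comps_fiberPart, if_pos hi, mul_zero]

theorem conormalParam_conormalDil (d : ℕ) (φ : OpenPartialHomeomorph M (Eucl n)) (r : ℝ)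
    (w : Eucl n) : conormalParam d φ (conormalDil n d r w) = dil r (conormalParam d φ w) := by
  rw [conormalParam_eq, conormalEmb_conormalDil, cotParam_dilL, conormalParam_eq]

theorem conormalCoord_dil (d : ℕ) (φ : OpenPartialHomeomorph M (Eucl n)) (r : ℝ)
    (z : Cotangent n M) : conormalCoord d φ (dil r z) = conormalDil n d r (conormalCoord d φ z) := by
  ext i
  rw [conormalDil_apply, conormalCoord_eq, conormalCoord_eq, cotCoord_dil, conormalPr_apply,
    conormalPr_apply]
  by_cases hi : i.val < d
  · simp [hi]
  · simp only [if_neg hi]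
    rfl

section Measure

variable (g : Metric n M) [CompactSpace M] [T2Space M] {d : ℕ} {H : Set M}
  {φ ψ : OpenPartialHomeomorph M (Eucl n)}

/-- The flow commutes with dilations, which act in both charts by the same linear map `δ`. Its
determinant cancels, and base points do not move. -/
theorem volRatio_dil (hφ : IsAdapted d H φ) {t : ℝ} {z : Cotangent n M} (hz : z ∈ conormal H)
    (hzφ : z.proj ∈ φ.source) {r : ℝ} (hr : 0 < r) :
    volRatio g d φ ψ (geodesicFlow g t) (dil r z) = volRatio g d φ ψ (geodesicFlow g t) z := by
  set F : Eucl n → Eucl n := fun w => conormalCoord d ψ (geodesicFlow g t (conormalParam d φ w))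
    with hF
  set w := conormalCoord d φ z with hw_def
  set δ := conormalDilEquiv n d hr.ne' with hδ
  have hδa : ∀ y, δ y = conormalDil n d r y := fun y => rfl
  have hev : F ∘ δ =ᶠ[𝓝 w] δ ∘ F := by
    filter_upwards [isOpen_conormalDomain.mem_nhds (conormalCoord_mem_conormalDomain hφ hzφ hz)]
      with y hy
    simp only [Function.comp_apply, hF, hδa]
    rw [conormalParam_conormalDil, geodesicFlow_dil g hr (conormalParam_mem_conormal hφ hy).2.1,
      conormalCoord_dil]
  have h1 : (fderiv ℝ F (δ w)).comp (δ : Eucl n →L[ℝ] Eucl n) =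
      (δ : Eucl n →L[ℝ] Eucl n).comp (fderiv ℝ F w) := by
    rw [← δ.comp_right_fderiv, hev.fderiv_eq, δ.comp_fderiv]
  have h2 : (fderiv ℝ F (δ w)).det = (fderiv ℝ F w).det := by
    have h3 : LinearMap.det ((fderiv ℝ F (δ w)).toLinearMap ∘ₗ δ.toLinearEquiv.toLinearMap) =
        LinearMap.det (δ.toLinearEquiv.toLinearMap ∘ₗ (fderiv ℝ F w).toLinearMap) :=
      congrArg (fun A : Eucl n →L[ℝ] Eucl n => LinearMap.det A.toLinearMap) h1
    rw [LinearMap.det_comp, LinearMap.det_comp, mul_comm] at h3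
    exact mul_left_cancel₀ (LinearEquiv.isUnit_det' δ.toLinearEquiv).ne_zero h3
  have h4 : conormalCoord d φ (dil r z) = δ w := conormalCoord_dil d φ r z
  have h5 : (geodesicFlow g t (dil r z)).proj = (geodesicFlow g t z).proj := by
    rw [geodesicFlow_dil g hr hz.2.1, proj_dil]
  simp only [volRatio]
  rw [h4, h5, proj_dil, h2]

/-! ### The Leray measure -/

theorem measurableSet_cone :
    MeasurableSet {z : Cotangent n M | 0 < symbol g z ∧ symbol g z < 1} :=
  ((isOpen_lt continuous_const (continuous_symbol g)).inter
    (isOpen_lt (continuous_symbol g) continuous_const)).measurableSet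

theorem measurableSet_cone_inter {B : Set (Cotangent n M)} (hB : MeasurableSet B) :
    MeasurableSet ({z : Cotangent n M | 0 < symbol g z ∧ symbol g z < 1} ∩ normalize g ⁻¹' B) :=
  measurableSet_inter_preimage_of_continuousOn ((continuousOn_normalize g).mono fun _ hz =>
    (symbol_pos_iff g).1 hz.1) (measurableSet_cone g) hB

theorem aemeasurable_normalize (ν : Measure (Cotangent n M)) :
    AEMeasurable (normalize g) (ν.restrict {z | 0 < symbol g z ∧ symbol g z < 1}) :=
  ContinuousOn.aemeasurable ((continuousOn_normalize g).mono fun _ hz =>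
    (symbol_pos_iff g).1 hz.1) (measurableSet_cone g)

theorem lerayMeasure_apply {B : Set (Cotangent n M)} (hB : MeasurableSet B) :
    lerayMeasure g d H B = ((n - d : ℕ) : ℝ≥0∞) * conormalVolume g d H
      ({z : Cotangent n M | 0 < symbol g z ∧ symbol g z < 1} ∩ normalize g ⁻¹' B) := by
  rw [lerayMeasure, Measure.smul_apply, smul_eq_mul,
    Measure.map_apply_of_aemeasurable (aemeasurable_normalize g _) hB,
    Measure.restrict_apply' (measurableSet_cone g), inter_comm]

theorem lintegral_lerayMeasure_le (f : Cotangent n M → ℝ≥0∞) :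
    ∫⁻ z, f z ∂(lerayMeasure g d H) ≤ ((n - d : ℕ) : ℝ≥0∞) *
      ∫⁻ z in {z : Cotangent n M | 0 < symbol g z ∧ symbol g z < 1},
        f (normalize g z) ∂(conormalVolume g d H) := by
  rw [lerayMeasure, lintegral_smul_measure, smul_eq_mul]
  exact mul_le_mul' le_rfl (lintegral_map_le f (normalize g))

/-- The Leray measure is a multiple of the volume of the cone with `0 < p < 1`. The flow preserves
`p` and commutes with `normalize`, so it maps the cone over `A` injectively into the cone over `B`,
and the ratio is constant along rays; the estimate on `Ṅ^*H` therefore descends. -/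
theorem lintegral_lerayMeasure_volRatio_le (hφ : IsAdapted d H φ) (hψ : IsAdapted d H ψ)
    (hN : MeasurableSet (conormal H : Set (Cotangent n M))) {t : ℝ} {A B : Set (Cotangent n M)}
    (hA : MeasurableSet A) (hB : MeasurableSet B)
    (hAφ : ∀ z ∈ A, z ∈ conormal H ∧ z.proj ∈ φ.source)
    (hAψ : ∀ z ∈ A, geodesicFlow g t z ∈ conormal H ∧ (geodesicFlow g t z).proj ∈ ψ.source)
    (hmaps : MapsTo (geodesicFlow g t) A B) :
    ∫⁻ z in A, ENNReal.ofReal (volRatio g d φ ψ (geodesicFlow g t) z) ∂(lerayMeasure g d H) ≤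
      lerayMeasure g d H B := by
  set C := {z : Cotangent n M | 0 < symbol g z ∧ symbol g z < 1} with hC_def
  have hC : MeasurableSet C := measurableSet_cone g
  set s := {z : Cotangent n M | z.proj ∈ φ.source} with hs_def
  have hCA := measurableSet_cone_inter g hA
  have hcov : ∀ z ∈ C, cov z ≠ 0 := fun z hz => (symbol_pos_iff g).1 hz.1
  have hCAc : ∀ z ∈ C ∩ normalize g ⁻¹' A, z ∈ conormal H ∧ z.proj ∈ φ.source := by
    rintro z ⟨hz, hzA⟩
    refine ⟨?_, (hAφ _ hzA).2⟩
    have := (hAφ _ hzA).1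
    rwa [normalize_eq_dil, dil_mem_conormal_iff (inv_ne_zero hz.1.ne')] at this
  have hflow : ∀ z ∈ C, geodesicFlow g t (normalize g z) = normalize g (geodesicFlow g t z) := by
    intro z hz
    rw [normalize_eq_dil, geodesicFlow_dil g (inv_pos.2 hz.1) (hcov z hz), normalize_eq_dil,
      symbol_geodesicFlow g (hcov z hz)]
  have hpos : ∀ z ∈ C, 0 < symbol g (geodesicFlow g t z) := fun z hz => by
    rw [symbol_geodesicFlow g (hcov z hz)]
    exact hz.1
  have h1 := lintegral_volRatio_le g hφ hψ (Φ := geodesicFlow g t) hCA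
    (measurableSet_cone_inter g hB) (fun z hz => by
      have h2 := hAψ _ hz.2
      rw [hflow z hz.1] at h2
      refine ⟨?_, h2.2⟩
      have := h2.1
      rwa [normalize_eq_dil, dil_mem_conormal_iff (inv_ne_zero (hpos z hz.1).ne')] at this)
    (fun z hz z' hz' h => by
      rw [← geodesicFlow_neg g (hcov z hz.1) t, h, geodesicFlow_neg g (hcov z' hz'.1) t])
    (fun z hz => by
      refine ⟨⟨hpos z hz.1, ?_⟩, ?_⟩
      · rw [symbol_geodesicFlow g (hcov z hz.1)]
        exact hz.1.2
      · rw [mem_preimage, ← hflow z hz.1]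
        exact hmaps hz.2)
  rw [lerayMeasure_apply g hB, ← lintegral_indicator hA]
  refine (lintegral_lerayMeasure_le g _).trans ?_
  gcongr
  refine le_trans ?_ (h1.trans (localVolume_le_conormalVolume g hψ _))
  calc ∫⁻ z in C, A.indicator (fun z => ENNReal.ofReal (volRatio g d φ ψ (geodesicFlow g t) z))
        (normalize g z) ∂(conormalVolume g d H)
      = ∫⁻ z in C ∩ normalize g ⁻¹' A, ENNReal.ofReal (volRatio g d φ ψ (geodesicFlow g t) z)
          ∂(conormalVolume g d H) := by
        rw [← lintegral_indicator hC, ← lintegral_indicator hCA]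
        refine lintegral_congr fun z => ?_
        by_cases hz : z ∈ C
        · by_cases hzA : normalize g z ∈ A
          · have hmem : z ∈ C ∩ normalize g ⁻¹' A := ⟨hz, hzA⟩
            rw [indicator_of_mem hz, indicator_of_mem hzA, indicator_of_mem hmem, normalize_eq_dil,
              volRatio_dil g hφ (hCAc z hmem).1 (hCAc z hmem).2 (inv_pos.2 hz.1)]
          · rw [indicator_of_mem hz, indicator_of_notMem hzA, indicator_of_notMem fun h => hzA h.2]
        · rw [indicator_of_notMem hz, indicator_of_notMem fun h => hz h.1]
    _ ≤ ∫⁻ z in C ∩ normalize g ⁻¹' A, ENNReal.ofReal (volRatio g d φ ψ (geodesicFlow g t) z)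
          ∂(localVolume g d φ) := by
        have h3 : (conormalVolume g d H).restrict (C ∩ normalize g ⁻¹' A) ≤
            (localVolume g d φ).restrict (C ∩ normalize g ⁻¹' A) := by
          have h4 : C ∩ normalize g ⁻¹' A = (C ∩ normalize g ⁻¹' A) ∩ s :=
            (inter_eq_left.2 fun z hz => (hCAc z hz).2).symm
          have h5 : (conormalVolume g d H).restrict (C ∩ normalize g ⁻¹' A) =
              ((conormalVolume g d H).restrict s).restrict (C ∩ normalize g ⁻¹' A) := by
            rw [Measure.restrict_restrict hCA, ← h4]
          rw [h5]
          exact Measure.restrict_mono le_rfl (conormalVolume_restrict_le g hφ hN)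
        exact lintegral_mono' h3 le_rfl

/-- Off the zero section the conormal bundle is the preimage of the compact set `SN^*H` under the
continuous map `normalize`. -/
theorem measurableSet_conormal (g : Metric n M) (hH : IsEmbeddedSubmanifold (n := n) d H)
    (hHc : IsCompact H) : MeasurableSet (conormal H : Set (Cotangent n M)) := by
  have h1 := measurableSet_inter_preimage_of_continuousOn (continuousOn_normalize g)
    (isOpen_cov_ne_zero g).measurableSet (isCompact_unitConormal g hH hHc).measurableSet
  convert! h1 using 1
  ext z
  constructor
  · intro hz
    refine ⟨hz.2.1, ?_, symbol_normalize g hz.2.1⟩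
    rw [normalize_eq_dil, dil_mem_conormal_iff (inv_ne_zero ((symbol_pos_iff g).2 hz.2.1).ne')]
    exact hz
  · rintro ⟨hz, hzS⟩
    have h2 := hzS.1
    rwa [normalize_eq_dil,
      dil_mem_conormal_iff (inv_ne_zero ((symbol_pos_iff g).2 hz).ne')] at h2

theorem localVolume_lt_top (hφ : IsAdapted d H φ) {K : Set M} (hK : IsCompact K)
    (hKφ : K ⊆ φ.source) :
    localVolume g d φ {z : Cotangent n M | z.proj ∈ K ∧ symbol g z < 1} < (⊤ : ℝ≥0∞) := by
  have hA : MeasurableSet {z : Cotangent n M | z.proj ∈ K ∧ symbol g z < 1} :=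
    (hK.isClosed.preimage continuous_proj_cotangent).measurableSet.inter
      (isOpen_lt (continuous_symbol g) continuous_const).measurableSet
  have hK' : IsCompact (φ '' K) := hK.image_of_continuousOn (φ.continuousOn.mono hKφ)
  have hKt : φ '' K ⊆ φ.target := by
    rintro _ ⟨y, hy, rfl⟩
    exact φ.map_source (hKφ hy)
  have hC := isCompact_symbolSq_le_chart g hφ.1 hK' hKt 1
  set C := {u : Phase n | u.1 ∈ φ '' K ∧ symbolSq g (cotParam φ u) ≤ 1} with hC_def
  have hE : IsCompact (conormalEmb n d ⁻¹' C) := by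
    refine (hC.image (conormalPr n d).continuous).of_isClosed_subset
      (hC.isClosed.preimage (conormalEmb n d).continuous) fun w hw => ?_
    exact ⟨_, hw, conormalPr_conormalEmb d w⟩
  have hcont : ContinuousOn (fun w => densityCoeff g d φ (φ.symm (basePart d w)))
      (conormalEmb n d ⁻¹' C) :=
    (continuousOn_densityCoeff_comp g hφ).mono fun w hw => hKt hw.1
  obtain ⟨c, hc⟩ := hE.exists_bound_of_continuousOn hcont
  rw [localVolume_apply g hφ hA]
  refine lt_of_le_of_lt (lintegral_mono_set (t := conormalEmb n d ⁻¹' C) ?_) ?_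
  · rintro w ⟨hw, hwK, hw1⟩
    refine ⟨⟨_, hwK, ?_⟩, ?_⟩
    · exact φ.right_inv hw.1
    · change symbolSq g (conormalParam d φ w) ≤ 1
      rw [← symbol_sq]
      exact pow_le_one₀ (Real.sqrt_nonneg _) hw1.le
  · refine lt_of_le_of_lt (setLIntegral_mono' (g := fun _ => ENNReal.ofReal c) hE.measurableSet
      fun w hw => ENNReal.ofReal_le_ofReal ((le_abs_self _).trans (hc w hw))) ?_
    rw [setLIntegral_const]
    exact ENNReal.mul_lt_top ENNReal.ofReal_lt_top hE.measure_lt_top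

theorem conormalVolume_le_restrict (hHc : IsCompact H) :
    conormalVolume g d H ≤ (conormalVolume g d H).restrict {z | z.proj ∈ H} := by
  have hs : MeasurableSet {z : Cotangent n M | z.proj ∈ H} :=
    (hHc.isClosed.preimage continuous_proj_cotangent).measurableSet
  refine iSup₂_le fun φ hφ => Measure.le_iff.2 fun A hA => ?_
  rw [Measure.restrict_apply hA, ← measure_inter_add_sdiff A hs,
    localVolume_compl_conormal g hφ (hA.diff hs) fun z hz _ hzA => hzA.2 hz.1, add_zero]
  exact localVolume_le_conormalVolume g hφ _

/-- The part of `Ṅ^*H` with `p < 1` has finite volume over a compact piece of one chart, because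
covectors with `p < 1` are bounded there; finitely many pieces cover `H`. -/
theorem isFiniteMeasure_lerayMeasure (hH : IsEmbeddedSubmanifold (n := n) d H)
    (hHc : IsCompact H) : IsFiniteMeasure (lerayMeasure g d H) := by
  have hN := measurableSet_conormal g hH hHc
  have h1 : conormalVolume g d H {z | z.proj ∈ H ∧ symbol g z < 1} < (⊤ : ℝ≥0∞) := by
    refine hHc.induction_on (p := fun s => conormalVolume g d H
      {z | z.proj ∈ s ∧ symbol g z < 1} < (⊤ : ℝ≥0∞)) (by simp) ?_ ?_ ?_
    · intro s t hst ht
      have h2 : {z : Cotangent n M | z.proj ∈ s ∧ symbol g z < 1} ⊆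
          {z | z.proj ∈ t ∧ symbol g z < 1} := fun z hz => ⟨hst hz.1, hz.2⟩
      exact lt_of_le_of_lt (measure_mono h2) ht
    · intro s t hs ht
      have h2 : {z : Cotangent n M | z.proj ∈ s ∪ t ∧ symbol g z < 1} ⊆
          {z | z.proj ∈ s ∧ symbol g z < 1} ∪ {z | z.proj ∈ t ∧ symbol g z < 1} := by
        rintro z ⟨hz | hz, hz1⟩
        · exact Or.inl ⟨hz, hz1⟩
        · exact Or.inr ⟨hz, hz1⟩
      exact lt_of_le_of_lt ((measure_mono h2).trans (measure_union_le _ _))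
        (ENNReal.add_lt_top.2 ⟨hs, ht⟩)
    · intro x hx
      obtain ⟨φ, hφ, hxφ⟩ := hH.2 x hx
      obtain ⟨K, hK, hKφ, hKc⟩ := local_compact_nhds (φ.open_source.mem_nhds hxφ)
      refine ⟨K, mem_nhdsWithin_of_mem_nhds hK, ?_⟩
      have h2 := localVolume_lt_top g hφ hKc hKφ
      refine lt_of_le_of_lt ?_ h2
      refine le_trans ?_ (conormalVolume_restrict_le g hφ hN _)
      rw [Measure.restrict_apply' (isOpen_proj_preimage φ.open_source).measurableSet]
      have h3 : {z : Cotangent n M | z.proj ∈ K ∧ symbol g z < 1} ⊆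
          {z | z.proj ∈ K ∧ symbol g z < 1} ∩ {z | z.proj ∈ φ.source} :=
        fun z hz => ⟨hz, hKφ hz.1⟩
      exact measure_mono h3
  refine ⟨?_⟩
  rw [lerayMeasure_apply g MeasurableSet.univ]
  refine ENNReal.mul_lt_top (ENNReal.natCast_lt_top _) (lt_of_le_of_lt ?_ h1)
  refine (conormalVolume_le_restrict g hHc _).trans ?_
  have hs : MeasurableSet {z : Cotangent n M | z.proj ∈ H} :=
    (hHc.isClosed.preimage continuous_proj_cotangent).measurableSet
  rw [Measure.restrict_apply' hs]
  exact measure_mono fun z hz => ⟨hz.2, hz.1.1.2⟩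

theorem lerayMeasure_compl_unitConormal (hH : IsEmbeddedSubmanifold (n := n) d H)
    (hHc : IsCompact H) : lerayMeasure g d H (unitConormal g H)ᶜ = 0 := by
  have hN := measurableSet_conormal g hH hHc
  rw [lerayMeasure_apply g (isCompact_unitConormal g hH hHc).measurableSet.compl]
  have h1 : conormalVolume g d H ≤ (conormalVolume g d H).restrict (conormal H) := by
    refine iSup₂_le fun φ hφ => Measure.le_iff.2 fun A hA => ?_
    rw [Measure.restrict_apply hA, ← measure_inter_add_sdiff A hN,
      localVolume_compl_conormal g hφ (hA.diff hN) fun z hz _ hzA => hzA.2 hz, add_zero]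
    exact localVolume_le_conormalVolume g hφ _
  refine mul_eq_zero_of_right _ (le_antisymm ((h1 _).trans ?_) bot_le)
  rw [Measure.restrict_apply' hN]
  refine le_of_eq ?_
  have : {z : Cotangent n M | 0 < symbol g z ∧ symbol g z < 1} ∩
      normalize g ⁻¹' (unitConormal g H)ᶜ ∩ conormal H = ∅ := by
    refine eq_empty_of_forall_notMem ?_
    rintro z ⟨⟨hz, hzn⟩, hzc⟩
    refine hzn ⟨?_, symbol_normalize g hzc.2.1⟩
    rwa [normalize_eq_dil, dil_mem_conormal_iff (inv_ne_zero hz.1.ne')]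
  rw [this, measure_empty]

end Measure

end Kuznecov

namespace Kuznecov

variable {n : ℕ} {M : Type*} [TopologicalSpace M] [ChartedSpace (Eucl n) M]
  [IsManifold (𝓡 n) ∞ M]

/-! ### Independence of the Jacobian from the charts -/

section ChartIndependence

variable (g : Metric n M) {d : ℕ} {H : Set M} {φ φ' ψ ψ' : OpenPartialHomeomorph M (Eucl n)}

/-- Differentiability is hidden in the isomorphism condition: the default `mfderiv` is zero, and
zero is not injective on the tangent space of `Ṅ^*H`, which is nontrivial as a nonzero covector
forces `n > 0`. -/
theorem mdifferentiableAt_geodesicFlow_of_mem_unitLooping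
    (hH : IsEmbeddedSubmanifold (n := n) d H) {t : ℝ} {z : Cotangent n M}
    (hz : z ∈ unitLooping g H t) :
    MDifferentiableAt (cotModel n) (cotModel n) (geodesicFlow g t) z := by
  by_contra hnot
  have hzc : z ∈ conormal H := hz.1.1
  obtain ⟨φ, hφ, hx⟩ := hH.2 _ hzc.1
  have hw := conormalCoord_mem_conormalDomain hφ hx hzc
  have hp := conormalParam_conormalCoord hφ hx hzc
  have hn : Nonempty (Fin n) := by
    by_contra hempty
    rw [not_nonempty_iff] at hempty
    refine hzc.2.1 ?_
    have h0 : cov z = 0 := by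
      rw [covector_eq_sum (cov z)]
      simp
    exact h0
  obtain ⟨i⟩ := hn
  set v : Eucl n := EuclideanSpace.single i (1 : ℝ) with hv
  set w := conormalCoord d φ z
  have h1 := mfderiv_conormalParam_mem_tangentOf hφ hw v
  have h2 := fderiv_conormalCoord_comp hφ hw v
  have hinj := hz.2.2.injOn
  rw [mfderiv_zero_of_not_mdifferentiableAt hnot] at hinj
  rw [← hp] at hinj
  have h3 := hinj h1 (Submodule.zero_mem _) rfl
  rw [h3] at h2
  have h6 : ∀ L : Phase n →L[ℝ] Eucl n, L 0 = v → (0 : Eucl n) = v := fun L hL => by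
    rwa [map_zero] at hL
  have h4 : (0 : Eucl n) = v := h6 _ h2
  have h5 := congrArg (fun y : Eucl n => y i) h4
  simp [hv] at h5

theorem contMDiffAt_transition_conormalCoord (hψ : IsAdapted d H ψ) (hψ' : IsAdapted d H ψ')
    {y : Cotangent n M} (hy : y ∈ conormal H) (hyψ : y.proj ∈ ψ.source)
    (hyψ' : y.proj ∈ ψ'.source) :
    ContDiffAt ℝ ∞ (conormalCoord d ψ' ∘ conormalParam d ψ) (conormalCoord d ψ y) :=
  contDiffAt_conormalCoord_comp_conormalParam hψ hψ'
    (conormalCoord_mem_conormalDomain hψ hyψ hy)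
    (by rw [conormalParam_conormalCoord hψ hyψ hy]; exact hyψ')

/-- Near the given point `Φ` may leave `Ṅ^*H`, where the two coordinate systems on the target are
not related by the transition map. They are related on `Ṅ^*H`, so their derivatives agree on its
tangent vectors, and `hmaps` guarantees that only such vectors occur. -/
theorem fderiv_conormalCoord_change (hφ : IsAdapted d H φ) (hψ : IsAdapted d H ψ)
    (hψ' : IsAdapted d H ψ') {Φ : Cotangent n M → Cotangent n M} {w : Eucl n}
    (hw : w ∈ conormalDomain d φ)
    (hΦ : MDifferentiableAt (cotModel n) (cotModel n) Φ (conormalParam d φ w))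
    (hmaps : MapsTo (mfderiv (cotModel n) (cotModel n) Φ (conormalParam d φ w))
      (tangentOf (cotModel n) (conormal H) (conormalParam d φ w) :
        Set (TangentSpace (cotModel n) (conormalParam d φ w)))
      (tangentOf (cotModel n) (conormal H) (Φ (conormalParam d φ w)) :
        Set (TangentSpace (cotModel n) (Φ (conormalParam d φ w)))))
    (hΦc : Φ (conormalParam d φ w) ∈ conormal H)
    (hΦψ : (Φ (conormalParam d φ w)).proj ∈ ψ.source)
    (hΦψ' : (Φ (conormalParam d φ w)).proj ∈ ψ'.source) :
    DifferentiableAt ℝ (fun y => conormalCoord d ψ (Φ (conormalParam d φ y))) w ∧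
    fderiv ℝ (fun y => conormalCoord d ψ' (Φ (conormalParam d φ y))) w =
      (fderiv ℝ (conormalCoord d ψ' ∘ conormalParam d ψ)
        (conormalCoord d ψ (Φ (conormalParam d φ w)))).comp
      (fderiv ℝ (fun y => conormalCoord d ψ (Φ (conormalParam d φ y))) w) := by
  have h1 := ((contMDiffAt_conormalParam hφ hw.1).mdifferentiableAt (by simp)).hasMFDerivAt
  have h2 := HasMFDerivAt.comp w hΦ.hasMFDerivAt h1
  have hC := (contMDiffAt_conormalCoord (d := d) hψ hΦψ).mdifferentiableAt (by simp)
  have hC' := (contMDiffAt_conormalCoord (d := d) hψ' hΦψ').mdifferentiableAt (by simp)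
  have hτ := ((contMDiffAt_transition_conormalCoord hψ hψ' hΦc hΦψ hΦψ').differentiableAt
    (by simp)).hasFDerivAt.hasMFDerivAt
  have hcomp := HasMFDerivAt.comp _ hτ hC.hasMFDerivAt
  have h3 := HasMFDerivAt.comp w hC.hasMFDerivAt h2
  have h4 := HasMFDerivAt.comp w hC'.hasMFDerivAt h2
  have h5 : (fderiv ℝ (fun y => conormalCoord d ψ (Φ (conormalParam d φ y))) w :
      Eucl n →L[ℝ] Eucl n) = _ := mfderiv_eq_fderiv.symm.trans h3.mfderiv
  have h6 : (fderiv ℝ (fun y => conormalCoord d ψ' (Φ (conormalParam d φ y))) w :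
      Eucl n →L[ℝ] Eucl n) = _ := mfderiv_eq_fderiv.symm.trans h4.mfderiv
  refine ⟨h3.mdifferentiableAt.differentiableAt, ?_⟩
  rw [h5, h6]
  ext1 v
  have hmem := hmaps (mfderiv_conormalParam_mem_tangentOf hφ hw v)
  have h7 := mfderiv_eq_of_mem_tangentOf hC' hcomp.mdifferentiableAt (by
    filter_upwards [(isOpen_proj_preimage ψ.open_source).mem_nhds hΦψ] with y hy hyc
    simp only [Function.comp_apply]
    rw [conormalParam_conormalCoord hψ hy hyc]) hmem
  rw [hcomp.mfderiv] at h7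
  exact h7

/-- On the source side the two parametrizations differ by a genuine change of coordinates, so the
chain rule applies directly; on the target side it holds to first order by
`fderiv_conormalCoord_change`. Both Jacobians are absorbed by the density coefficients. -/
theorem volRatio_eq_volRatio (hφ : IsAdapted d H φ) (hφ' : IsAdapted d H φ')
    (hψ : IsAdapted d H ψ) (hψ' : IsAdapted d H ψ')
    (hH : IsEmbeddedSubmanifold (n := n) d H) {t : ℝ} {z : Cotangent n M}
    (hz : z ∈ unitLooping g H t) (hzφ : z.proj ∈ φ.source) (hzφ' : z.proj ∈ φ'.source)
    (hzψ : (geodesicFlow g t z).proj ∈ ψ.source) (hzψ' : (geodesicFlow g t z).proj ∈ ψ'.source) :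
    volRatio g d φ' ψ' (geodesicFlow g t) z = volRatio g d φ ψ (geodesicFlow g t) z := by
  have hd := mdifferentiableAt_geodesicFlow_of_mem_unitLooping g hH hz
  have hzc : z ∈ conormal H := hz.1.1
  have hw := conormalCoord_mem_conormalDomain hφ hzφ hzc
  have hp := conormalParam_conormalCoord hφ hzφ hzc
  have hw' := conormalCoord_mem_conormalDomain hφ' hzφ' hzc
  have hp' := conormalParam_conormalCoord hφ' hzφ' hzc
  set w := conormalCoord d φ z with hw_def
  set w' := conormalCoord d φ' z with hw'_def
  have hτ := abs_det_mul_densityCoeff g hψ hψ' (conormalCoord_mem_conormalDomain hψ hzψ hz.2.1)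
    (by rw [conormalParam_conormalCoord hψ hzψ hz.2.1]; exact hzψ')
  rw [conormalParam_conormalCoord hψ hzψ hz.2.1] at hτ
  have hσ := abs_det_mul_densityCoeff g hφ' hφ hw' (by rw [hp']; exact hzφ)
  rw [hp'] at hσ
  obtain ⟨hF, hFF'⟩ := fderiv_conormalCoord_change hφ hψ hψ' hw (Φ := geodesicFlow g t)
    (by rw [hp]; exact hd) (by rw [hp]; exact hz.2.2.mapsTo) (by rw [hp]; exact hz.2.1)
    (by rw [hp]; exact hzψ) (by rw [hp]; exact hzψ')
  obtain ⟨hF', -⟩ := fderiv_conormalCoord_change hφ hψ' hψ hw (Φ := geodesicFlow g t)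
    (by rw [hp]; exact hd) (by rw [hp]; exact hz.2.2.mapsTo) (by rw [hp]; exact hz.2.1)
    (by rw [hp]; exact hzψ') (by rw [hp]; exact hzψ)
  rw [hp] at hFF'
  set σ := conormalCoord d φ ∘ conormalParam d φ' with hσ_def
  have hσw : σ w' = w := by rw [hσ_def, Function.comp_apply, hp']
  have hσd : DifferentiableAt ℝ σ w' :=
    (contDiffAt_conormalCoord_comp_conormalParam hφ' hφ hw' (by rw [hp']; exact hzφ)).differentiableAt
      (by simp)
  have hev : (fun y => conormalCoord d ψ' (geodesicFlow g t (conormalParam d φ' y))) =ᶠ[𝓝 w']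
      (fun y => conormalCoord d ψ' (geodesicFlow g t (conormalParam d φ y))) ∘ σ := by
    have h1 : ∀ᶠ y in 𝓝 w', (conormalParam d φ' y).proj ∈ φ.source :=
      (contMDiffAt_conormalParam hφ' hw'.1).continuousAt.preimage_mem_nhds
        ((isOpen_proj_preimage φ.open_source).mem_nhds (by rw [hp']; exact hzφ))
    filter_upwards [h1, isOpen_conormalDomain.mem_nhds hw'] with y hy hyd
    simp only [Function.comp_apply, hσ_def]
    rw [conormalParam_conormalCoord hφ hy (conormalParam_mem_conormal hφ' hyd)]
  have hchain : fderiv ℝ (fun y => conormalCoord d ψ' (geodesicFlow g t (conormalParam d φ' y))) w' =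
      (fderiv ℝ (fun y => conormalCoord d ψ' (geodesicFlow g t (conormalParam d φ y))) w).comp
        (fderiv ℝ σ w') := by
    rw [hev.fderiv_eq]
    have := fderiv_comp w' (by rw [hσw]; exact hF') hσd
    rwa [hσw] at this
  have hdet : ∀ A B : Eucl n →L[ℝ] Eucl n, (A.comp B).det = A.det * B.det := fun A B =>
    LinearMap.det_comp A.toLinearMap B.toLinearMap
  have hpos := densityCoeff_pos g hφ hzφ
  have hpos' := densityCoeff_pos g hφ' hzφ'
  simp only [volRatio]
  rw [← hw_def, ← hw'_def, hchain, hFF', hdet, hdet, abs_mul, abs_mul, ← hτ,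
    div_eq_div_iff hpos'.ne' hpos.ne', ← hσ]
  ring

theorem adaptedChart_spec (hH : IsEmbeddedSubmanifold (n := n) d H) {x : M} (hx : x ∈ H) :
    IsAdapted d H (adaptedChart (n := n) d H x) ∧ x ∈ (adaptedChart (n := n) d H x).source := by
  have h := hH.2 x hx
  rw [adaptedChart, dif_pos h]
  exact h.choose_spec

theorem jacobian_eq_volRatio (hφ : IsAdapted d H φ) (hψ : IsAdapted d H ψ)
    (hH : IsEmbeddedSubmanifold (n := n) d H) {t : ℝ} {z : Cotangent n M}
    (hz : z ∈ unitLooping g H t) (hzφ : z.proj ∈ φ.source)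
    (hzψ : (geodesicFlow g t z).proj ∈ ψ.source) :
    jacobian g d H t z = volRatio g d φ ψ (geodesicFlow g t) z := by
  obtain ⟨h1, h2⟩ := adaptedChart_spec hH hz.1.1.1
  obtain ⟨h3, h4⟩ := adaptedChart_spec hH hz.2.1.1
  exact volRatio_eq_volRatio g hφ h1 hψ h3 hH hz hzφ h2 hzψ h4

end ChartIndependence

end Kuznecov

namespace Kuznecov

variable {n : ℕ} {M : Type*} [TopologicalSpace M] [ChartedSpace (Eucl n) M]
  [IsManifold (𝓡 n) ∞ M]

/-! ### An averaging lemma for partially defined flows -/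

section Averaging

variable {Ω : Type*} [MeasurableSpace Ω] {μ : Measure Ω}

/-- Integrate the number of sets that contain `z`. -/
theorem sum_measure_le_mul {ι : Type*} (F : Finset ι) {X : ι → Set Ω}
    (hX : ∀ t ∈ F, MeasurableSet (X t)) {c : ℝ≥0∞}
    (h : ∀ z, ∀ F' ⊆ F, (∀ t ∈ F', z ∈ X t) → (F'.card : ℝ≥0∞) ≤ c) :
    ∑ t ∈ F, μ (X t) ≤ c * μ univ := by
  classical
  calc ∑ t ∈ F, μ (X t) = ∑ t ∈ F, ∫⁻ z, (X t).indicator 1 z ∂μ :=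
        Finset.sum_congr rfl fun t ht => (lintegral_indicator_one (hX t ht)).symm
    _ = ∫⁻ z, ∑ t ∈ F, (X t).indicator 1 z ∂μ :=
        (lintegral_finsetSum' F fun t ht =>
          (measurable_one.indicator (hX t ht)).aemeasurable).symm
    _ ≤ ∫⁻ _, c ∂μ := by
        refine lintegral_mono fun z => ?_
        have h1 : ∑ t ∈ F, (X t).indicator (1 : Ω → ℝ≥0∞) z = ((F.filter (z ∈ X ·)).card : ℝ≥0∞) := by
          rw [Finset.card_filter, Nat.cast_sum]
          refine Finset.sum_congr rfl fun t _ => ?_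
          by_cases hz : z ∈ X t <;> simp [hz]
        simp only
        rw [h1]
        exact h z _ (Finset.filter_subset _ _) fun t ht => (Finset.mem_filter.1 ht).2
    _ = c * μ univ := by rw [lintegral_const]

theorem tendsto_inv_mul_of_le {f : ℝ → ℝ≥0∞} {c : ℝ≥0∞} (hc : c ≠ ⊤)
    (h : ∀ δ : ℝ, 0 < δ → ∃ D : ℝ≥0∞, D ≠ ⊤ ∧ ∀ T : ℝ, 1 ≤ T →
      f T ≤ D + ENNReal.ofReal δ * c * ENNReal.ofReal T) :
    Tendsto (fun T : ℝ => (ENNReal.ofReal T)⁻¹ * f T) atTop (𝓝 0) := by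
  rw [ENNReal.tendsto_nhds_zero]
  intro ε hε
  have hδ : ∃ δ : ℝ, 0 < δ ∧ ENNReal.ofReal δ * c ≤ ε / 2 := by
    have h1 : Tendsto (fun δ : ℝ => ENNReal.ofReal δ * c) (𝓝[>] 0) (𝓝 0) := by
      have h2 : Tendsto (fun δ : ℝ => ENNReal.ofReal δ) (𝓝[>] 0) (𝓝 0) := by
        have := (ENNReal.continuous_ofReal.tendsto (0 : ℝ)).mono_left
          (nhdsWithin_le_nhds (s := Ioi 0))
        rwa [ENNReal.ofReal_zero] at this
      simpa using ENNReal.Tendsto.mul_const h2 (Or.inr hc)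
    obtain ⟨δ, hδ, hδ0⟩ := ((ENNReal.tendsto_nhds_zero.1 h1 (ε / 2)
      (ENNReal.half_pos hε.ne')).and self_mem_nhdsWithin).exists
    exact ⟨δ, hδ0, hδ⟩
  obtain ⟨δ, hδ0, hδ⟩ := hδ
  obtain ⟨D, hD, hfD⟩ := h δ hδ0
  have h3 : Tendsto (fun T : ℝ => (ENNReal.ofReal T)⁻¹ * D) atTop (𝓝 0) := by
    have h4 : Tendsto (fun T : ℝ => (ENNReal.ofReal T)⁻¹) atTop (𝓝 0) := by
      have := ENNReal.tendsto_ofReal_atTop.inv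
      rwa [ENNReal.inv_top] at this
    simpa using ENNReal.Tendsto.mul_const h4 (Or.inr hD)
  filter_upwards [ENNReal.tendsto_nhds_zero.1 h3 (ε / 2) (ENNReal.half_pos hε.ne'),
    eventually_ge_atTop 1] with T hT hT1
  have hT0 : ENNReal.ofReal T ≠ 0 := (ENNReal.ofReal_pos.2 (by linarith)).ne'
  calc (ENNReal.ofReal T)⁻¹ * f T
      ≤ (ENNReal.ofReal T)⁻¹ * (D + ENNReal.ofReal δ * c * ENNReal.ofReal T) := by
        gcongr
        exact hfD T hT1
    _ = (ENNReal.ofReal T)⁻¹ * D + ENNReal.ofReal δ * c := by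
        rw [mul_add, mul_comm (ENNReal.ofReal δ * c), ← mul_assoc,
          ENNReal.inv_mul_cancel hT0 ENNReal.ofReal_ne_top, one_mul]
    _ ≤ ε / 2 + ε / 2 := add_le_add hT hδ
    _ = ε := ENNReal.add_halves ε

variable [IsFiniteMeasure μ] {G : ℝ → Ω → Ω} {S : ℝ → Set Ω} {a K : ℝ → Ω → ℝ≥0∞}

theorem setLIntegral_le_of_le_add {t : ℝ} (ht : t ≠ 0) {B : Set Ω} (hB : MeasurableSet B)
    (ha : ∀ z, ∀ r : ℝ, 0 < r → a t z ≤ ENNReal.ofReal r + ENNReal.ofReal r⁻¹ * K t z)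
    (hK : ∀ t, t ≠ 0 → ∀ B, MeasurableSet B →
      ∫⁻ z in S t ∩ G t ⁻¹' B, K t z ∂μ ≤ μ (S (-t) ∩ B)) {r : ℝ} (hr : 0 < r) :
    ∫⁻ z in S t ∩ G t ⁻¹' B, a t z ∂μ ≤
      ENNReal.ofReal r * μ (S t ∩ G t ⁻¹' B) + ENNReal.ofReal r⁻¹ * μ (S (-t) ∩ B) := by
  calc ∫⁻ z in S t ∩ G t ⁻¹' B, a t z ∂μ
      ≤ ∫⁻ z in S t ∩ G t ⁻¹' B, (ENNReal.ofReal r + ENNReal.ofReal r⁻¹ * K t z) ∂μ :=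
        lintegral_mono fun z => ha z r hr
    _ = ENNReal.ofReal r * μ (S t ∩ G t ⁻¹' B) +
          ENNReal.ofReal r⁻¹ * ∫⁻ z in S t ∩ G t ⁻¹' B, K t z ∂μ := by
        rw [lintegral_add_left measurable_const, setLIntegral_const,
          lintegral_const_mul' _ _ ENNReal.ofReal_ne_top]
    _ ≤ _ := by
        gcongr
        exact hK t ht B hB

/-- Trade the integral of `a t` for measures, with a parameter `r` that depends on where `G t z`
lands. Landing in finitely many of the `A i` is rare along each orbit, so the sum of those measures
is bounded in `T` and may carry a large factor; the complement is small, so its measure may carry a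
large factor as well. -/
theorem tendsto_average_of_le {L : Set ℝ} {A : ℕ → Set Ω} {C : ℝ} (hC : 0 ≤ C) (hL : ∀ t ∈ L, t ≠ 0)
    (hSm : ∀ t, MeasurableSet (S t))
    (hS : ∀ t B, MeasurableSet B → MeasurableSet (S t ∩ G t ⁻¹' B))
    (hA : ∀ i, MeasurableSet (A i)) (hAμ : μ (⋃ i, A i)ᶜ = 0)
    (hAS : ∀ i z t t', z ∈ S t → z ∈ S t' → G t z ∈ A i → G t' z ∈ A i → t = t')
    (hcount : ∀ T : ℝ, 1 ≤ T → ∀ z, ∀ F : Finset ℝ,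
      (∀ t ∈ F, t ≠ 0 ∧ t ∈ Icc (-T) T ∧ z ∈ S t) → (F.card : ℝ) ≤ C * T)
    (ha : ∀ t z, ∀ r : ℝ, 0 < r → a t z ≤ ENNReal.ofReal r + ENNReal.ofReal r⁻¹ * K t z)
    (hK : ∀ t, t ≠ 0 → ∀ B, MeasurableSet B →
      ∫⁻ z in S t ∩ G t ⁻¹' B, K t z ∂μ ≤ μ (S (-t) ∩ B)) :
    Tendsto (fun T : ℝ => (ENNReal.ofReal T)⁻¹ *
      ∑' t : ↥(L ∩ Icc (-T) T), ∫⁻ z in S t, a t z ∂μ) atTop (𝓝 0) := by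
  classical
  -- Three sums are of order `δ T`: two bounded by `C μ(univ)` and one by `C`, which gives this
  -- constant.
  refine tendsto_inv_mul_of_le (c := ENNReal.ofReal C * (2 * μ univ + 1))
    (ENNReal.mul_ne_top ENNReal.ofReal_ne_top (by finiteness)) fun δ hδ => ?_
  -- The square compensates for the factor `δ⁻¹` in front of this measure, leaving `δ`.
  obtain ⟨N, hN⟩ : ∃ N : ℕ, μ (⋃ i ∈ Finset.range N, A i)ᶜ ≤ ENNReal.ofReal (δ ^ 2) := by
    have h1 : Tendsto (fun N : ℕ => μ (⋃ i ∈ Finset.range N, A i)ᶜ) atTop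
        (𝓝 (μ (⋂ N : ℕ, (⋃ i ∈ Finset.range N, A i)ᶜ))) := by
      refine tendsto_measure_iInter_atTop (fun N => ?_) ?_ ⟨0, measure_ne_top _ _⟩
      · exact (Finset.measurableSet_biUnion _ fun i _ => hA i).compl.nullMeasurableSet
      · intro N N' hNN'
        refine compl_subset_compl.2 (biUnion_subset_biUnion_left fun i hi => ?_)
        exact Finset.mem_range.2 ((Finset.mem_range.1 hi).trans_le hNN')
    have h2 : ⋂ N : ℕ, (⋃ i ∈ Finset.range N, A i)ᶜ = (⋃ i, A i)ᶜ := by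
      rw [← compl_iUnion]
      congr 1
      ext z
      simp only [mem_iUnion, Finset.mem_range, exists_prop]
      exact ⟨fun ⟨_, i, _, hi⟩ => ⟨i, hi⟩, fun ⟨i, hi⟩ => ⟨i + 1, i, Nat.lt_succ_self i, hi⟩⟩
    rw [h2, hAμ] at h1
    exact (ENNReal.tendsto_nhds_zero.1 h1 _ (ENNReal.ofReal_pos.2 (by positivity))).exists
  set E := ⋃ i ∈ Finset.range N, A i with hE_def
  have hE : MeasurableSet E := Finset.measurableSet_biUnion _ fun i _ => hA i
  -- Each of the `N` sets is visited at most once by the orbit of `z`, so assigning to a visit the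
  -- set visited is injective.
  have hEcard : ∀ z, ∀ F : Finset ℝ, (∀ t ∈ F, z ∈ S t ∩ G t ⁻¹' E) → F.card ≤ N := by
    intro z F hF
    have h1 : ∀ t ∈ F, ∃ i, i < N ∧ G t z ∈ A i := fun t ht => by
      have := (hF t ht).2
      simp only [hE_def, mem_preimage, mem_iUnion, Finset.mem_range, exists_prop] at this
      exact this
    choose! ι hι using h1
    have := Finset.card_le_card_of_injOn (s := F) (t := Finset.range N) ι
      (fun t ht => Finset.mem_coe.2 (Finset.mem_range.2 (hι t ht).1)) fun t ht t' ht' h =>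
        hAS (ι t) z t t' (hF t ht).1 (hF t' ht').1 (hι t ht).2 (h ▸ (hι t' ht').2)
    rwa [Finset.card_range] at this
  refine ⟨ENNReal.ofReal δ⁻¹ * (N * μ univ), by finiteness, fun T hT => ?_⟩
  rw [ENNReal.tsum_eq_iSup_sum]
  refine iSup_le fun F₀ => ?_
  set F : Finset ℝ := F₀.map (Function.Embedding.subtype _) with hF_def
  have hF : ∀ t ∈ F, t ≠ 0 ∧ t ∈ Icc (-T) T := by
    intro t ht
    obtain ⟨s, -, rfl⟩ := Finset.mem_map.1 ht
    exact ⟨hL _ s.2.1, s.2.2⟩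
  have hsum : ∑ t ∈ F₀, ∫⁻ z in S t, a t z ∂μ = ∑ t ∈ F, ∫⁻ z in S t, a t z ∂μ := by
    rw [hF_def, Finset.sum_map]
    rfl
  have hcT : ∀ z, ∀ F' ⊆ F, (∀ t ∈ F', z ∈ S t) → (F'.card : ℝ≥0∞) ≤ ENNReal.ofReal (C * T) := by
    intro z F' hF' hz
    rw [← ENNReal.ofReal_natCast]
    exact ENNReal.ofReal_le_ofReal (hcount T hT z F' fun t ht =>
      ⟨(hF t (hF' ht)).1, (hF t (hF' ht)).2, hz t ht⟩)
  have hcT' : ∀ z, ∀ F' ⊆ F, (∀ t ∈ F', z ∈ S (-t)) →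
      (F'.card : ℝ≥0∞) ≤ ENNReal.ofReal (C * T) := by
    intro z F' hF' hz
    rw [← ENNReal.ofReal_natCast, ← Finset.card_image_of_injective F' neg_injective]
    refine ENNReal.ofReal_le_ofReal (hcount T hT z _ fun t ht => ?_)
    obtain ⟨s, hs, rfl⟩ := Finset.mem_image.1 ht
    have h1 := hF s (hF' hs)
    exact ⟨neg_ne_zero.2 h1.1, ⟨neg_le_neg h1.2.2, by linarith [h1.2.1]⟩, hz s hs⟩
  have e1 : ∑ t ∈ F, μ (S t ∩ G t ⁻¹' E) ≤ N * μ univ :=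
    sum_measure_le_mul F (fun t _ => hS t E hE) fun z F' _ hz => by exact_mod_cast hEcard z F' hz
  have e2 : ∑ t ∈ F, μ (S (-t) ∩ E) ≤ ENNReal.ofReal (C * T) * μ univ :=
    sum_measure_le_mul F (fun t _ => (hSm _).inter hE) fun z F' hF' hz =>
      hcT' z F' hF' fun t ht => (hz t ht).1
  have e3 : ∑ t ∈ F, μ (S t ∩ G t ⁻¹' Eᶜ) ≤ ENNReal.ofReal (C * T) * μ univ :=
    sum_measure_le_mul F (fun t _ => hS t _ hE.compl) fun z F' hF' hz =>
      hcT z F' hF' fun t ht => (hz t ht).1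
  have e4 : ∑ t ∈ F, μ (S (-t) ∩ Eᶜ) ≤ ENNReal.ofReal (C * T) * ENNReal.ofReal (δ ^ 2) := by
    have h1 := sum_measure_le_mul (μ := μ.restrict Eᶜ) F (X := fun t => S (-t))
      (fun t _ => hSm _) hcT'
    rw [Measure.restrict_apply_univ] at h1
    calc ∑ t ∈ F, μ (S (-t) ∩ Eᶜ) = ∑ t ∈ F, μ.restrict Eᶜ (S (-t)) :=
          Finset.sum_congr rfl fun t _ => (Measure.restrict_apply (hSm _)).symm
      _ ≤ _ := h1
      _ ≤ _ := by gcongr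
  have hsplit : ∀ t ∈ F, ∫⁻ z in S t, a t z ∂μ ≤
      (ENNReal.ofReal δ⁻¹ * μ (S t ∩ G t ⁻¹' E) + ENNReal.ofReal δ * μ (S (-t) ∩ E)) +
      (ENNReal.ofReal δ * μ (S t ∩ G t ⁻¹' Eᶜ) + ENNReal.ofReal δ⁻¹ * μ (S (-t) ∩ Eᶜ)) := by
    intro t ht
    have h1 : S t = S t ∩ G t ⁻¹' E ∪ S t ∩ G t ⁻¹' Eᶜ := by
      rw [← inter_union_distrib_left, preimage_compl, union_compl_self, inter_univ]
    calc ∫⁻ z in S t, a t z ∂μ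
        = ∫⁻ z in S t ∩ G t ⁻¹' E ∪ S t ∩ G t ⁻¹' Eᶜ, a t z ∂μ := by rw [← h1]
      _ ≤ ∫⁻ z in S t ∩ G t ⁻¹' E, a t z ∂μ + ∫⁻ z in S t ∩ G t ⁻¹' Eᶜ, a t z ∂μ :=
          lintegral_union_le _ _ _
      _ ≤ _ := by
          refine add_le_add ?_ ?_
          -- Here `r = δ⁻¹`: the factor `δ⁻¹` falls on the sets whose sum is bounded independently
          -- of `T`.
          · have := setLIntegral_le_of_le_add (hF t ht).1 hE (ha t) hK (inv_pos.2 hδ)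
            rwa [inv_inv] at this
          · exact setLIntegral_le_of_le_add (hF t ht).1 hE.compl (ha t) hK hδ
  rw [hsum]
  refine (Finset.sum_le_sum hsplit).trans ?_
  simp only [Finset.sum_add_distrib, ← Finset.mul_sum]
  have hδδ : ENNReal.ofReal δ⁻¹ * ENNReal.ofReal (δ ^ 2) = ENNReal.ofReal δ := by
    rw [← ENNReal.ofReal_mul (inv_nonneg.2 hδ.le)]
    congr 1
    field_simp
  calc _ ≤ (ENNReal.ofReal δ⁻¹ * (N * μ univ) +
          ENNReal.ofReal δ * (ENNReal.ofReal (C * T) * μ univ)) +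
        (ENNReal.ofReal δ * (ENNReal.ofReal (C * T) * μ univ) +
          ENNReal.ofReal δ⁻¹ * (ENNReal.ofReal (C * T) * ENNReal.ofReal (δ ^ 2))) := by
        gcongr
    _ = _ := by
        rw [mul_left_comm (ENNReal.ofReal δ⁻¹) (ENNReal.ofReal (C * T)), hδδ,
          ENNReal.ofReal_mul hC]
        ring

end Averaging

end Kuznecov

/-! ### Return sets, wandering sets and the averaging condition -/

namespace Kuznecov

variable {n : ℕ} {M : Type*} [TopologicalSpace M] [ChartedSpace (Eucl n) M]
  [IsManifold (𝓡 n) ∞ M]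

section Looping

variable (g : Metric n M) [CompactSpace M] [T2Space M] {d : ℕ} {H : Set M}
  {φ ψ : OpenPartialHomeomorph M (Eucl n)}

/-! ### Return times -/

/-- The unit conormal directions that are conormal again at time `t`. -/
def returnSet (g : Metric n M) (H : Set M) (t : ℝ) : Set (Cotangent n M) :=
  {z | z ∈ unitConormal g H ∧ geodesicFlow g t z ∈ conormal H}

theorem geodesicFlow_mem_unitConormal {t : ℝ} {z : Cotangent n M} (hz : z ∈ returnSet g H t) :
    geodesicFlow g t z ∈ unitConormal g H :=
  ⟨hz.2, (symbol_geodesicFlow g hz.1.1.2.1 t).trans hz.1.2⟩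

theorem geodesicFlow_mem_returnSet_neg {t : ℝ} {z : Cotangent n M} (hz : z ∈ returnSet g H t) :
    geodesicFlow g t z ∈ returnSet g H (-t) :=
  ⟨geodesicFlow_mem_unitConormal g hz, by
    rw [geodesicFlow_neg g hz.1.1.2.1]
    exact hz.1.1⟩

theorem measurableSet_returnSet_inter (hH : IsEmbeddedSubmanifold (n := n) d H)
    (hHc : IsCompact H) (t : ℝ) {B : Set (Cotangent n M)} (hB : MeasurableSet B) :
    MeasurableSet (returnSet g H t ∩ geodesicFlow g t ⁻¹' B) := by
  have hN := measurableSet_conormal g hH hHc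
  have h1 := measurableSet_inter_preimage_of_continuousOn (s := unitConormal g H)
    ((continuousOn_geodesicFlow_left g t).mono fun z hz => hz.1.2.1)
    (isCompact_unitConormal g hH hHc).measurableSet (hN.inter hB)
  rwa [preimage_inter, ← inter_assoc] at h1

theorem measurableSet_returnSet (hH : IsEmbeddedSubmanifold (n := n) d H)
    (hHc : IsCompact H) (t : ℝ) : MeasurableSet (returnSet g H t) := by
  have h := measurableSet_returnSet_inter g hH hHc t MeasurableSet.univ
  rwa [preimage_univ, inter_univ] at h

/-- Two return times less than `ε` apart would make the direction reached at the first one conormal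
again too soon. Hence each interval of length `ε` contains at most one. -/
theorem exists_card_le_mul (hH : IsEmbeddedSubmanifold (n := n) d H) (hHc : IsCompact H) :
    ∃ C : ℝ, 0 ≤ C ∧ ∀ T : ℝ, 1 ≤ T → ∀ z, ∀ F : Finset ℝ,
      (∀ t ∈ F, t ≠ 0 ∧ t ∈ Icc (-T) T ∧ z ∈ returnSet g H t) → (F.card : ℝ) ≤ C * T := by
  obtain ⟨ε, hε, hsep⟩ := exists_forall_notMem_conormal g hH hHc
  -- There are at most `2T/ε + 1` cells, and the last `1` is absorbed into `T` because `T ≥ 1`.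
  refine ⟨2 / ε + 1, by positivity, fun T hT z F hF => ?_⟩
  have hinj : InjOn (fun t : ℝ => ⌊(t + T) / ε⌋₊) (F : Set ℝ) := by
    intro t ht t' ht' h
    obtain ⟨-, ⟨h1, h2⟩, h3⟩ := hF t ht
    obtain ⟨-, ⟨h1', h2'⟩, h3'⟩ := hF t' ht'
    by_contra hne
    refine hsep _ (geodesicFlow_mem_unitConormal g h3) (t' - t)
      (sub_ne_zero.2 (Ne.symm hne)) ?_ ?_
    · have e1 := Nat.floor_le (div_nonneg (by linarith : 0 ≤ t + T) hε.le)
      have e2 := Nat.lt_floor_add_one ((t + T) / ε)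
      have e1' := Nat.floor_le (div_nonneg (by linarith : 0 ≤ t' + T) hε.le)
      have e2' := Nat.lt_floor_add_one ((t' + T) / ε)
      simp only at h
      rw [h] at e1 e2
      have h4 : |(t' + T) / ε - (t + T) / ε| < 1 := abs_sub_lt_iff.2 ⟨by linarith, by linarith⟩
      rw [← sub_div, abs_div, abs_of_pos hε, div_lt_one hε] at h4
      simpa using h4
    · rw [geodesicFlow_add g h3.1.1.2.1, add_sub_cancel]
      exact h3'.2
  have hmaps : ∀ t ∈ F, ⌊(t + T) / ε⌋₊ ∈ Finset.range (⌊2 * T / ε⌋₊ + 1) := by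
    intro t ht
    have h1 := (hF t ht).2.1
    refine Finset.mem_range.2 (Nat.lt_succ_of_le (Nat.floor_le_floor ?_))
    gcongr
    linarith [h1.2]
  have hcard := Finset.card_le_card_of_injOn (fun t : ℝ => ⌊(t + T) / ε⌋₊) hmaps hinj
  rw [Finset.card_range] at hcard
  have h1 : (F.card : ℝ) ≤ (⌊2 * T / ε⌋₊ : ℝ) + 1 := by exact_mod_cast hcard
  have h2 := Nat.floor_le (by positivity : 0 ≤ 2 * T / ε)
  have h3 : (2 / ε + 1) * T = 2 * T / ε + T := by ring
  linarith

/-! ### Wandering directions -/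

/-- The points of `K` that never return to `K`. -/
def wanderingSet (g : Metric n M) (K : Set (Cotangent n M)) : Set (Cotangent n M) :=
  {z | z ∈ K ∧ ∀ t : ℝ, t ≠ 0 → geodesicFlow g t z ∉ K}

/-- The points of `K` that return at a time with `1/(m+1) ≤ |t| ≤ m` form the projection of a
compact set, by joint continuity of the flow; the returning points are the countable union of these.
-/
theorem measurableSet_wanderingSet {K : Set (Cotangent n M)} (hK : IsCompact K)
    (hK0 : ∀ z ∈ K, cov z ≠ 0) : MeasurableSet (wanderingSet g K) := by
  let J : ℕ → Set ℝ := fun m => {t | 1 / ((m : ℝ) + 1) ≤ |t|} ∩ Metric.closedBall 0 m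
  have hJ : ∀ m, IsCompact (J m) := fun m =>
    (isCompact_closedBall _ _).inter_left (isClosed_le continuous_const continuous_abs)
  have hC : ∀ m, IsCompact (Prod.snd '' ((J m ×ˢ K) ∩
      (fun p : ℝ × Cotangent n M => geodesicFlow g p.1 p.2) ⁻¹' K)) := by
    intro m
    have h1 : ContinuousOn (fun p : ℝ × Cotangent n M => geodesicFlow g p.1 p.2) (J m ×ˢ K) :=
      (continuousOn_geodesicFlow g).mono fun p hp => ⟨mem_univ _, hK0 _ hp.2⟩
    have h2 := h1.preimage_isClosed_of_isClosed ((hJ m).prod hK).isClosed hK.isClosed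
    exact (((hJ m).prod hK).of_isClosed_subset h2 inter_subset_left).image continuous_snd
  have heq : wanderingSet g K = K \ ⋃ m, Prod.snd '' ((J m ×ˢ K) ∩
      (fun p : ℝ × Cotangent n M => geodesicFlow g p.1 p.2) ⁻¹' K) := by
    ext z
    constructor
    · rintro ⟨hz, h⟩
      refine ⟨hz, fun hmem => ?_⟩
      obtain ⟨m, ⟨t, z'⟩, ⟨⟨ht, -⟩, hG⟩, rfl⟩ := mem_iUnion.1 hmem
      have h1 : 0 < |t| := lt_of_lt_of_le (by positivity) ht.1
      exact h t (abs_pos.1 h1) hG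
    · rintro ⟨hz, h⟩
      refine ⟨hz, fun t ht hG => h ?_⟩
      obtain ⟨m₁, hm₁⟩ := exists_nat_one_div_lt (abs_pos.2 ht)
      obtain ⟨m₂, hm₂⟩ := exists_nat_ge |t|
      refine mem_iUnion.2 ⟨max m₁ m₂, (t, z), ⟨⟨⟨?_, ?_⟩, hz⟩, hG⟩, rfl⟩
      · refine le_trans ?_ hm₁.le
        refine one_div_le_one_div_of_le (by positivity) ?_
        have : (m₁ : ℝ) ≤ (max m₁ m₂ : ℕ) := by exact_mod_cast le_max_left _ _
        linarith
      · rw [mem_closedBall_zero_iff, Real.norm_eq_abs]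
        exact hm₂.trans (by exact_mod_cast le_max_right _ _)
  rw [heq]
  exact hK.measurableSet.diff (MeasurableSet.iUnion fun m => (hC m).measurableSet)

theorem eq_of_mem_wanderingSet {K : Set (Cotangent n M)} {z : Cotangent n M} (hz : cov z ≠ 0)
    {t t' : ℝ} (h : geodesicFlow g t z ∈ wanderingSet g K)
    (h' : geodesicFlow g t' z ∈ wanderingSet g K) : t = t' := by
  by_contra hne
  refine h.2 (t' - t) (sub_ne_zero.2 (Ne.symm hne)) ?_
  rw [geodesicFlow_add g hz, add_sub_cancel]
  exact h'.1

/-- A non-recurrent direction has a neighborhood to which it does not return. Shrinking it to the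
closure of a member of a countable basis leaves countably many compact sets, and the direction is
wandering for one of them. -/
theorem exists_wandering_cover (hH : IsEmbeddedSubmanifold (n := n) d H) (hHc : IsCompact H) :
    ∃ A : ℕ → Set (Cotangent n M), (∀ i, MeasurableSet (A i)) ∧
      (∀ i, ∀ z : Cotangent n M, cov z ≠ 0 → ∀ t t' : ℝ, geodesicFlow g t z ∈ A i →
        geodesicFlow g t' z ∈ A i → t = t') ∧
      unitConormal g H \ recurrentSet g H ⊆ ⋃ i, A i := by
  have := secondCountableTopology_cotangent g
  have := locallyCompactSpace_cotangent (n := n) (M := M)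
  have hSN := isCompact_unitConormal g hH hHc
  obtain ⟨b, hbc, -, hb⟩ := TopologicalSpace.exists_countable_basis (Cotangent n M)
  -- The empty set is added only to make the basis nonempty, so that it is the range of a sequence.
  obtain ⟨V, hV⟩ := (hbc.insert ∅).exists_eq_range (insert_nonempty _ _)
  have hK : ∀ i, IsCompact (unitConormal g H ∩ closure (V i)) := fun i =>
    hSN.inter_right isClosed_closure
  refine ⟨fun i => wanderingSet g (unitConormal g H ∩ closure (V i)), fun i =>
    measurableSet_wanderingSet g (hK i) fun z hz => hz.1.1.2.1, fun i z hz t t' h h' =>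
    eq_of_mem_wanderingSet g hz h h', ?_⟩
  rintro z ⟨hz, hzR⟩
  have h1 : ∃ U : Set (Cotangent n M), IsOpen U ∧ z ∈ U ∧
      ∀ t : ℝ, t ≠ 0 → geodesicFlow g t z ∉ U ∩ unitConormal g H := by
    by_contra hcon
    push Not at hcon
    exact hzR ⟨hz, fun U hU hzU => hcon U hU hzU⟩
  obtain ⟨U, hU, hzU, hUt⟩ := h1
  obtain ⟨W, hWb, hzW, hWU⟩ := hb.exists_closure_subset (hU.mem_nhds hzU)
  obtain ⟨i, hi⟩ : W ∈ range V := by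
    rw [← hV]
    exact mem_insert_of_mem _ hWb
  refine mem_iUnion.2 ⟨i, ⟨hz, hi ▸ subset_closure hzW⟩, fun t ht hG => hUt t ht ⟨?_, hG.1⟩⟩
  exact hWU (hi ▸ hG.2)

/-! ### A measurable extension of the Jacobian -/

/-- The unit conormal directions over the domain of `φ` that are conormal at time `t` over the
domain of `ψ`. -/
def chartReturnSet (g : Metric n M) (H : Set M) (φ ψ : OpenPartialHomeomorph M (Eucl n)) (t : ℝ) :
    Set (Cotangent n M) :=
  {z | z ∈ returnSet g H t ∧ (geodesicFlow g t z).proj ∈ ψ.source ∧ z.proj ∈ φ.source}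

theorem measurableSet_chartReturnSet (hH : IsEmbeddedSubmanifold (n := n) d H)
    (hHc : IsCompact H) (t : ℝ) : MeasurableSet (chartReturnSet g H φ ψ t) := by
  have h := (measurableSet_returnSet_inter g hH hHc t
    (isOpen_proj_preimage ψ.open_source).measurableSet).inter
    (isOpen_proj_preimage (n := n) φ.open_source).measurableSet
  convert! h using 1
  ext z
  exact and_assoc.symm

/-- The map `fderiv` of an arbitrary function is measurable, so the Jacobian factor needs no
regularity. The other factors are continuous only on the set where the charts apply, which is why
measurability is checked on the subtype. -/
theorem measurable_indicator_volRatio (hφ : IsAdapted d H φ) (hψ : IsAdapted d H ψ)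
    (hH : IsEmbeddedSubmanifold (n := n) d H) (hHc : IsCompact H) (t : ℝ) :
    Measurable ((chartReturnSet g H φ ψ t).indicator fun z =>
      ENNReal.ofReal (volRatio g d φ ψ (geodesicFlow g t) z)) := by
  refine measurable_indicator_of_subtype (measurableSet_chartReturnSet g hH hHc t)
    (Measurable.ennreal_ofReal ?_)
  set Q := chartReturnSet g H φ ψ t with hQ
  have hproj := continuous_proj_cotangent (n := n) (M := M)
  have h1 : Measurable fun z : Q => conormalCoord d φ (z : Cotangent n M) :=
    (continuousOn_iff_continuous_domRestrict.1
      ((continuousOn_conormalCoord hφ).mono fun z (hz : z ∈ Q) => hz.2.2)).measurable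
  have h2 : Measurable fun z : Q => densityCoeff g d φ (z : Cotangent n M).proj :=
    (continuousOn_iff_continuous_domRestrict.1
      ((continuousOn_densityCoeff g hφ).comp hproj.continuousOn
        fun z (hz : z ∈ Q) => hz.2.2)).measurable
  have h3 : Measurable fun z : Q =>
      densityCoeff g d ψ (geodesicFlow g t (z : Cotangent n M)).proj :=
    (continuousOn_iff_continuous_domRestrict.1
      ((continuousOn_densityCoeff g hψ).comp (hproj.comp_continuousOn
        ((continuousOn_geodesicFlow_left g t).mono fun z (hz : z ∈ Q) => hz.1.1.1.2.1))
        fun z (hz : z ∈ Q) => hz.2.1)).measurable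
  have h4 : Measurable fun w : Eucl n =>
      |(fderiv ℝ (fun w => conormalCoord d ψ (geodesicFlow g t (conormalParam d φ w))) w).det| :=
    (ContinuousLinearMap.continuous_det.abs).measurable.comp (measurable_fderiv ℝ _)
  exact ((h4.comp h1).mul h3).div h2

theorem setLIntegral_indicator_volRatio_le (hφ : IsAdapted d H φ) (hψ : IsAdapted d H ψ)
    (hH : IsEmbeddedSubmanifold (n := n) d H) (hHc : IsCompact H) (t : ℝ)
    {B : Set (Cotangent n M)} (hB : MeasurableSet B) :
    ∫⁻ z in returnSet g H t ∩ geodesicFlow g t ⁻¹' B,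
      (chartReturnSet g H φ ψ t).indicator (fun z =>
        ENNReal.ofReal (volRatio g d φ ψ (geodesicFlow g t) z)) z ∂(lerayMeasure g d H) ≤
      lerayMeasure g d H (returnSet g H (-t) ∩ B) := by
  have hQ := measurableSet_chartReturnSet g (φ := φ) (ψ := ψ) hH hHc t
  rw [lintegral_indicator hQ, Measure.restrict_restrict hQ]
  refine lintegral_lerayMeasure_volRatio_le g hφ hψ (measurableSet_conormal g hH hHc)
    (hQ.inter (measurableSet_returnSet_inter g hH hHc t hB))
    ((measurableSet_returnSet g hH hHc _).inter hB) ?_ ?_ ?_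
  · exact fun z hz => ⟨hz.1.1.1.1, hz.1.2.2⟩
  · exact fun z hz => ⟨hz.1.1.2, hz.1.2.1⟩
  · exact fun z hz => ⟨geodesicFlow_mem_returnSet_neg g hz.1.1, hz.2.2⟩

/-- `jacobian` uses charts chosen separately at each point, with no control on measurability.
Finitely many adapted charts cover `H`; the sum of the volume ratios over all pairs of them is
measurable, dominates the Jacobian by chart independence, and satisfies the volume bound up to the
number of pairs. -/
theorem exists_measurable_jacobian (hH : IsEmbeddedSubmanifold (n := n) d H)
    (hHc : IsCompact H) :
    ∃ c : ℝ≥0∞, c ≠ ⊤ ∧ 1 ≤ c ∧ ∃ K : ℝ → Cotangent n M → ℝ≥0∞, (∀ t, Measurable (K t)) ∧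
      (∀ t, ∀ z ∈ unitLooping g H t, ENNReal.ofReal (jacobian g d H t z) ≤ K t z) ∧
      ∀ t, ∀ B, MeasurableSet B →
        ∫⁻ z in returnSet g H t ∩ geodesicFlow g t ⁻¹' B, K t z ∂(lerayMeasure g d H) ≤
          c * lerayMeasure g d H (returnSet g H (-t) ∩ B) := by
  classical
  have hch : ∀ x : H, IsAdapted d H (adaptedChart (n := n) d H (x : M)) ∧
      (x : M) ∈ (adaptedChart (n := n) d H (x : M)).source := fun x => adaptedChart_spec hH x.2
  obtain ⟨s, hs⟩ := hHc.elim_finite_subcover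
    (fun x : H => (adaptedChart (n := n) d H (x : M)).source)
    (fun x => (adaptedChart (n := n) d H (x : M)).open_source)
    fun x hx => mem_iUnion.2 ⟨⟨x, hx⟩, (hch ⟨x, hx⟩).2⟩
  let R : ℝ → H × H → Cotangent n M → ℝ≥0∞ := fun t p =>
    (chartReturnSet g H (adaptedChart (n := n) d H (p.1 : M)) (adaptedChart d H (p.2 : M)) t).indicator
      fun z => ENNReal.ofReal
        (volRatio g d (adaptedChart d H (p.1 : M)) (adaptedChart d H (p.2 : M)) (geodesicFlow g t) z)
  have hR : ∀ t p, Measurable (R t p) := fun t p =>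
    measurable_indicator_volRatio g (hch p.1).1 (hch p.2).1 hH hHc t
  -- The extra `1` ensures `c ≥ 1`, also when the cover is empty, so that dividing by `c` later is
  -- harmless.
  refine ⟨(s ×ˢ s).card + 1, by finiteness, le_add_self,
    fun t z => ∑ p ∈ s ×ˢ s, R t p z, fun t => ?_, fun t z hz => ?_, fun t B hB => ?_⟩
  · exact Finset.measurable_fun_sum _ fun p _ => hR t p
  · obtain ⟨x, hxs, hx⟩ := mem_iUnion₂.1 (hs hz.1.1.1)
    obtain ⟨y, hys, hy⟩ := mem_iUnion₂.1 (hs hz.2.1.1)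
    have h1 : R t (x, y) z ≤ ∑ p ∈ s ×ˢ s, R t p z :=
      Finset.single_le_sum (f := fun p => R t p z) (fun _ _ => bot_le)
        (Finset.mem_product.2 ⟨hxs, hys⟩)
    refine le_trans (le_of_eq ?_) h1
    have hmem : z ∈ chartReturnSet g H (adaptedChart (n := n) d H (x : M))
        (adaptedChart d H (y : M)) t := ⟨⟨hz.1, hz.2.1⟩, hy, hx⟩
    simp only [R]
    rw [indicator_of_mem hmem, jacobian_eq_volRatio g (hch x).1 (hch y).1 hH hz hx hy]
  · rw [lintegral_finsetSum _ fun p _ => hR t p]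
    refine (Finset.sum_le_card_nsmul _ _ _ fun p _ =>
      setLIntegral_indicator_volRatio_le g (hch p.1).1 (hch p.2).1 hH hHc t hB).trans ?_
    rw [nsmul_eq_mul]
    gcongr
    exact le_self_add

/-! ### The averaging condition -/

/-- A weak form of the arithmetic–geometric mean inequality. It makes the integral of a square root
linear in the Jacobian, with a weight `r` at disposal. -/
theorem rpow_half_le {r : ℝ} (hr : 0 < r) (k : ℝ≥0∞) :
    k ^ (1 / 2 : ℝ) ≤ ENNReal.ofReal r + ENNReal.ofReal r⁻¹ * k := by
  rcases eq_or_ne k ⊤ with rfl | hk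
  · rw [ENNReal.mul_top (ENNReal.ofReal_pos.2 (inv_pos.2 hr)).ne', add_top]
    exact le_top
  · obtain ⟨x, hx, rfl⟩ : ∃ x : ℝ, 0 ≤ x ∧ ENNReal.ofReal x = k :=
      ⟨k.toReal, ENNReal.toReal_nonneg, ENNReal.ofReal_toReal hk⟩
    rw [ENNReal.ofReal_rpow_of_nonneg hx (by norm_num), ← Real.sqrt_eq_rpow,
      ← ENNReal.ofReal_mul (inv_nonneg.2 hr.le),
      ← ENNReal.ofReal_add hr.le (mul_nonneg (inv_nonneg.2 hr.le) hx)]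
    refine ENNReal.ofReal_le_ofReal ?_
    have h1 := Real.sq_sqrt hx
    have h2 : r + r⁻¹ * x = (r ^ 2 + x) / r := by field_simp
    rw [h2, le_div_iff₀ hr]
    nlinarith [sq_nonneg (Real.sqrt x - r), Real.sqrt_nonneg x, sq_nonneg r]

/-- The oscillating factor has norm one. The domain is enlarged from `SΣ_t`, whose measurability is
not at issue this way, to the Borel set `returnSet`. -/
theorem ofReal_norm_q_le {K : ℝ → Cotangent n M → ℝ≥0∞} (hK : ∀ t, Measurable (K t))
    (hJ : ∀ t, ∀ z ∈ unitLooping g H t, ENNReal.ofReal (jacobian g d H t z) ≤ K t z) (t : ℝ) :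
    ENNReal.ofReal ‖q g d H t‖ ≤ ‖((2 * Real.pi : ℝ) : ℂ) ^ (-(n : ℤ) + d)‖ₑ *
      ∫⁻ z in returnSet g H t, K t z ^ (1 / 2 : ℝ) ∂(lerayMeasure g d H) := by
  rw [ofReal_norm, q, enorm_mul]
  gcongr
  refine (enorm_integral_le_lintegral_enorm _).trans ?_
  refine le_trans (setLIntegral_mono ((hK t).pow_const _) fun z hz => ?_)
    (lintegral_mono_set fun z hz => ⟨hz.1, hz.2.1⟩)
  have h1 : ‖Complex.I ^ maslov g d H t z * (Real.sqrt (jacobian g d H t z) : ℂ)‖ₑ =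
      ENNReal.ofReal (Real.sqrt (jacobian g d H t z)) := by
    rw [← ofReal_norm, norm_mul, norm_zpow, Complex.norm_I, one_zpow, one_mul,
      Complex.norm_real, Real.norm_eq_abs, abs_of_nonneg (Real.sqrt_nonneg _)]
  rw [h1]
  rcases le_total 0 (jacobian g d H t z) with h | h
  · rw [Real.sqrt_eq_rpow, ← ENNReal.ofReal_rpow_of_nonneg h (by norm_num)]
    exact ENNReal.rpow_le_rpow (hJ t z hz) (by norm_num)
  · rw [Real.sqrt_eq_zero_of_nonpos h, ENNReal.ofReal_zero]
    exact bot_le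

theorem averagingCondition_of_lerayMeasure_recurrentSet_eq_zero
    (hH : IsEmbeddedSubmanifold (n := n) d H) (hHc : IsCompact H)
    (hR : lerayMeasure g d H (recurrentSet g H) = 0) : AveragingCondition g d H := by
  have := isFiniteMeasure_lerayMeasure g hH hHc
  obtain ⟨c, hc, hc1, K, hKm, hKJ, hKint⟩ := exists_measurable_jacobian g hH hHc
  obtain ⟨C, hC, hcount⟩ := exists_card_le_mul g hH hHc
  obtain ⟨A, hA, hAS, hAcov⟩ := exists_wandering_cover g hH hHc
  have hc0 : c ≠ 0 := (lt_of_lt_of_le one_pos hc1).ne'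
  have hcinv : c⁻¹ ≤ 1 := ENNReal.inv_le_one.2 hc1
  have hAμ : lerayMeasure g d H (⋃ i, A i)ᶜ = 0 := by
    refine measure_mono_null (t := (unitConormal g H)ᶜ ∪ recurrentSet g H) ?_
      (measure_union_null (lerayMeasure_compl_unitConormal g hH hHc) hR)
    intro z hz
    by_contra hcon
    rw [mem_union, not_or, notMem_compl_iff] at hcon
    exact hz (hAcov hcon)
  -- Both `K` and its square root are divided by `c`. This brings the volume bound to constant `1`,
  -- and the pointwise bound survives because `c⁻¹ ≤ 1`; the factor is restored in the limit.
  have key := tendsto_average_of_le (μ := lerayMeasure g d H) (G := geodesicFlow g)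
    (S := returnSet g H) (a := fun t z => c⁻¹ * K t z ^ (1 / 2 : ℝ))
    (K := fun t z => c⁻¹ * K t z) (L := loopTimes g d H) (A := A) hC (fun t ht => ht.1)
    (measurableSet_returnSet g hH hHc)
    (fun t B hB => measurableSet_returnSet_inter g hH hHc t hB) hA hAμ
    (fun i z t t' hz _ h h' => hAS i z hz.1.1.2.1 t t' h h') hcount
    (fun t z r hr => by
      calc c⁻¹ * K t z ^ (1 / 2 : ℝ)
          ≤ c⁻¹ * (ENNReal.ofReal r + ENNReal.ofReal r⁻¹ * K t z) := by
            gcongr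
            exact rpow_half_le hr _
        _ = c⁻¹ * ENNReal.ofReal r + ENNReal.ofReal r⁻¹ * (c⁻¹ * K t z) := by ring
        _ ≤ 1 * ENNReal.ofReal r + ENNReal.ofReal r⁻¹ * (c⁻¹ * K t z) := by gcongr
        _ = _ := by rw [one_mul])
    (fun t _ B hB => by
      rw [lintegral_const_mul' _ _ (ENNReal.inv_ne_top.2 hc0)]
      calc c⁻¹ * _ ≤ c⁻¹ * (c * lerayMeasure g d H (returnSet g H (-t) ∩ B)) := by
            gcongr
            exact hKint t B hB
        _ = _ := by rw [← mul_assoc, ENNReal.inv_mul_cancel hc0 hc, one_mul])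
  set κ := ‖((2 * Real.pi : ℝ) : ℂ) ^ (-(n : ℤ) + d)‖ₑ with hκ
  have hκc : κ * c ≠ ⊤ := ENNReal.mul_ne_top enorm_ne_top hc
  have hlim := ENNReal.Tendsto.const_mul (a := κ * c) key (Or.inr hκc)
  rw [mul_zero] at hlim
  refine tendsto_of_tendsto_of_tendsto_of_le_of_le tendsto_const_nhds hlim (fun _ => bot_le)
    fun T => ?_
  simp only
  rw [mul_left_comm (κ * c)]
  refine mul_le_mul' le_rfl
    (le_trans (ENNReal.tsum_le_tsum fun t => ?_) (le_of_eq ENNReal.tsum_mul_left))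
  rw [lintegral_const_mul' _ _ (ENNReal.inv_ne_top.2 hc0), mul_assoc, ← mul_assoc c,
    ENNReal.mul_inv_cancel hc0 hc, one_mul]
  exact ofReal_norm_q_le g hKm hKJ t

end Looping

end Kuznecov

end

theorem mainTheorem6 {n d : ℕ} {M : Type*} [TopologicalSpace M]
    [ChartedSpace (EuclideanSpace ℝ (Fin n)) M] [IsManifold (𝓡 n) ∞ M]
    [CompactSpace M] [T2Space M] (g : Kuznecov.Metric n M)
    (H : Set M) (hH : Kuznecov.IsEmbeddedSubmanifold (n := n) d H) (hHc : IsCompact H)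
    (hR : Kuznecov.lerayMeasure g d H (Kuznecov.recurrentSet g H) = 0) :
    Kuznecov.AveragingCondition g d H :=
  Kuznecov.averagingCondition_of_lerayMeasure_recurrentSet_eq_zero g hH hHc hR
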